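/- Let $q\in\mathbb{C}$ with $0<|q|<1$, and fix a square root $q^{1/2}$. Let $\Lambda=\Lambda^{\infty/2}V$ be the infinite wedge space: the complex vector space with orthonormal basis $v_S=\underline{s_1}\wedge\underline{s_2}\wedge\cdots$, where $S=\{s_1>s_2>\cdots\}\subset\mathbb{Z}+\tfrac12$ runs over the sets for which $S_+=\{k\in S: k>0\}$ and $S_-=\{k\notin S: k<0\}$ are finite. Let $\psi_k$ be exterior multiplication by $\underline k$, $\psi_k^*$ its adjoint, $H=\sum_k k\,{:}\psi_k\psi_k^*{:}$ the energy operator (so that $q^Hv_S=q^{\sum_{k\in S_+}|k|+\sum_{k\in S_-}|k|}v_S$), and $\mathsf T(t)=\sum_{k\in\mathbb{Z}+1/2}t^k\psi_k\psi_k^*$, which is defined for $|t|>1$. For $n\ge 0$ consider $$\mathsf F(t_1,\dots,t_n)=\operatorname{tr}_{\Lambda}\bigl(q^H\,\mathsf T(t_1)\cdots\mathsf T(t_n)\bigr),\qquad F(t_1,\dots,t_n)=(q;q)_\infty\sum_\lambda q^{|\lambda|}\prod_{k=1}^n\sum_{i\ge1}t_k^{\lambda_i-i+\frac12},$$ where $\lambda$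 runs over all partitions and $(q;q)_\infty=\prod_{m\ge1}(1-q^m)$, and put $\Theta_3(t;q)=\sum_{m\in\mathbb{Z}}q^{m^2/2}t^m$. Since half-integer powers of the $t_i$ occur, $\mathsf F$ and $F$ are understood as functions of $x_i=t_i^{1/2}$; replacing $t_1$ by $qt_1$ means replacing $x_1$ by $q^{1/2}x_1$, and merging variables means multiplying the corresponding $x_i$. Let $U_n$ be the set of $x$ with $|t_i|>1$ for all $i$ and $|t_1\cdots t_n|<|q|^{-1}$, and let $D_n$ be the set of $x\in(\mathbb{C}\setminus\{0\})^n$ with $q^m\prod_{i\in J}t_i\ne1$ for all $m\in\mathbb{Z}$ and all nonempty $J\subset\{1,\dots,n\}$. Then: 1. On $U_n$ the series defining $\mathsf F$ and $F$ (the traces and the sums over partitions, as well as the inner sums) converge absolutely. 2. $\mathsf F$ and $F$ extend from $U_n$ to meromorphic functions on $(\mathbb{C}\setminus\{0\})^n$ that are holomorphic on $D_n$; these extensions, again denoted by $\mathsf F$ and $F$, are unique on $D_n$. 3. For all $n\ge1$, as an identity of meromorphic functions that holds at every point of $D_n$, $$\mathsf F(qt_1,t_2,\dots,t_n)=\sum_{s=0}^{n-1}(-1)^{s+1}\sum_{1<i_1<\dots<i_s\le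 n}\mathsf F(t_1t_{i_1}\cdots t_{i_s},\dots,\widehat{t_{i_1}},\dots,\widehat{t_{i_s}},\dots),$$ where the variables under a hat are omitted. 4. For all $n\ge0$, on $D_n$, $$\mathsf F(t_1,\dots,t_n)=\Theta_3(t_1\cdots t_n;q)\,\frac{1}{(q;q)_\infty}\,F(t_1,\dots,t_n).$$ 5. Consequently, for all $n\ge1$, on $D_n$, $$F(qt_1,t_2,\dots,t_n)=-q^{1/2}\,t_1\cdots t_n\sum_{s=0}^{n-1}(-1)^s\sum_{1<i_1<\dots<i_s\le n}F(t_1t_{i_1}\cdots t_{i_s},\dots,\widehat{t_{i_1}},\dots,\widehat{t_{i_s}},\dots).$$ -/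

import Mathlib

open scoped Topology

noncomputable section

namespace InfiniteWedge

/-!
Half-integers are encoded by integers: the integer `j` stands for `k = j + 1/2`.
Half-integer powers are made single valued by working with square roots: a variable `t` is
represented by `x` with `x ^ 2 = t`, so that `t ^ k` is `x ^ (2 * j + 1)`; likewise `q` comes with
a fixed square root `p`, `p ^ 2 = q`.
-/

/-- The index set of the standard basis of the infinite wedge space: sets `S` of half-integers
with finitely many positive elements and finitely many negative non-elements. -/
@[ext] structure Maya where
  /-- `j ∈ carrier` means that `j + 1/2` belongs to `S`. -/
  carrier : Set ℤ
  finite_pos : {j : ℤ | j ∈ carrier ∧ 0 ≤ j}.Finite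
  finite_neg : {j : ℤ | j ∉ carrier ∧ j < 0}.Finite

namespace Maya

/-- `S ∪ {k}`. -/
def insert (k : ℤ) (S : Maya) : Maya where
  carrier := S.carrier ∪ {k}
  finite_pos := by
    refine (S.finite_pos.union (Set.finite_singleton k)).subset ?_
    rintro j ⟨hj | hj, h0⟩
    · exact Or.inl ⟨hj, h0⟩
    · exact Or.inr hj
  finite_neg := by
    refine S.finite_neg.subset ?_
    rintro j ⟨hj, h0⟩
    exact ⟨fun h => hj (Or.inl h), h0⟩

/-- `S \ {k}`. -/
def erase (k : ℤ) (S : Maya) : Maya where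
  carrier := S.carrier \ {k}
  finite_pos := by
    refine S.finite_pos.subset ?_
    rintro j ⟨hj, h0⟩
    exact ⟨hj.1, h0⟩
  finite_neg := by
    refine (S.finite_neg.union (Set.finite_singleton k)).subset ?_
    rintro j ⟨hj, h0⟩
    by_cases hk : j = k
    · exact Or.inr hk
    · exact Or.inl ⟨fun h => hj ⟨h, hk⟩, h0⟩

/-- The number of elements of `S` that are larger than `k`. -/
def above (k : ℤ) (S : Maya) : ℕ := {j : ℤ | j ∈ S.carrier ∧ k < j}.ncard

/-- Twice the energy `∑_{k ∈ S₊} |k| + ∑_{k ∈ S₋} |k|`, where `S₊` is the set of positive elements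
and `S₋` the set of negative non-elements of `S`. -/
def twiceEnergy (S : Maya) : ℕ :=
  (∑ j ∈ S.finite_pos.toFinset, (2 * j + 1).natAbs) +
    ∑ j ∈ S.finite_neg.toFinset, (2 * j + 1).natAbs

end Maya

/-- The infinite wedge space `Λ^{∞/2} V`, with basis the vectors `v_S`. -/
abbrev Wedge := Maya →₀ ℂ

/-- The basis vector `v_S = s₁ ∧ s₂ ∧ s₃ ∧ ⋯`, where `S = {s₁ > s₂ > s₃ > ⋯}`. -/
def vec (S : Maya) : Wedge := Finsupp.single S 1

open Classical in
/-- `ψ_k`: exterior multiplication on the left by the basis vector of index `k`. -/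
def psi (k : ℤ) : Wedge →ₗ[ℂ] Wedge :=
  Finsupp.linearCombination ℂ fun S : Maya =>
    if k ∈ S.carrier then 0 else (-1 : ℂ) ^ S.above k • vec (S.insert k)

open Classical in
/-- `ψ*_k`: the adjoint of `ψ_k` with respect to the inner product in which the `v_S` are
orthonormal. -/
def psiStar (k : ℤ) : Wedge →ₗ[ℂ] Wedge :=
  Finsupp.linearCombination ℂ fun S : Maya =>
    if k ∈ S.carrier then (-1 : ℂ) ^ S.above k • vec (S.erase k) else 0

/-- The normally ordered product of `ψ_k` and `ψ*_k`. -/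
def normalOrd (k : ℤ) : Wedge →ₗ[ℂ] Wedge :=
  if 0 ≤ k then psi k ∘ₗ psiStar k else -(psiStar k ∘ₗ psi k)

lemma psi_vec_of_mem {k : ℤ} {S : Maya} (h : k ∈ S.carrier) : psi k (vec S) = 0 := by
  simp [psi, vec, h]

lemma psi_vec_of_notMem {k : ℤ} {S : Maya} (h : k ∉ S.carrier) :
    psi k (vec S) = (-1 : ℂ) ^ S.above k • vec (S.insert k) := by
  simp [psi, vec, h]

lemma psiStar_vec_of_mem {k : ℤ} {S : Maya} (h : k ∈ S.carrier) :
    psiStar k (vec S) = (-1 : ℂ) ^ S.above k • vec (S.erase k) := by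
  simp [psiStar, vec, h]

lemma psiStar_vec_of_notMem {k : ℤ} {S : Maya} (h : k ∉ S.carrier) :
    psiStar k (vec S) = 0 := by
  simp [psiStar, vec, h]

lemma Maya.insert_erase {k : ℤ} {S : Maya} (h : k ∈ S.carrier) : (S.erase k).insert k = S := by
  ext j
  by_cases hj : j = k <;> simp [Maya.insert, Maya.erase, hj, h]

lemma Maya.erase_insert {k : ℤ} {S : Maya} (h : k ∉ S.carrier) : (S.insert k).erase k = S := by
  ext j
  by_cases hj : j = k <;> simp [Maya.insert, Maya.erase, hj, h]

lemma Maya.above_erase (k : ℤ) (S : Maya) : (S.erase k).above k = S.above k := by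
  unfold Maya.above Maya.erase
  congr 1
  ext j
  simp only [Set.mem_ofPred_eq, Set.mem_sdiff, Set.mem_singleton_iff]
  constructor
  · rintro ⟨h, h'⟩
    exact ⟨h.1, h'⟩
  · rintro ⟨h, h'⟩
    exact ⟨⟨h, by omega⟩, h'⟩

lemma Maya.above_insert (k : ℤ) (S : Maya) : (S.insert k).above k = S.above k := by
  unfold Maya.above Maya.insert
  congr 1
  ext j
  simp only [Set.mem_ofPred_eq, Set.mem_union, Set.mem_singleton_iff]
  constructor
  · rintro ⟨h | h, h'⟩
    · exact ⟨h, h'⟩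
    · omega
  · rintro ⟨h, h'⟩
    exact ⟨Or.inl h, h'⟩

open Classical in
/-- `ψ*_k` is the adjoint of `ψ_k`. -/
lemma psiStar_adjoint (k : ℤ) (S S' : Maya) : psi k (vec S) S' = psiStar k (vec S') S := by
  by_cases h : k ∈ S.carrier <;> by_cases h' : k ∈ S'.carrier
  · rw [psi_vec_of_mem h, psiStar_vec_of_mem h']
    have : S'.erase k ≠ S := by
      rintro rfl
      exact h.2 rfl
    simp [vec, this]
  · rw [psi_vec_of_mem h, psiStar_vec_of_notMem h']
    simp
  · rw [psi_vec_of_notMem h, psiStar_vec_of_mem h']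
    by_cases e : S.insert k = S'
    · subst e
      simp [vec, Maya.erase_insert h, Maya.above_insert]
    · have e' : S'.erase k ≠ S := by
        rintro rfl
        exact e (Maya.insert_erase h')
      simp [vec, e, e']
  · rw [psi_vec_of_notMem h, psiStar_vec_of_notMem h']
    have : S.insert k ≠ S' := by
      rintro rfl
      exact h' (Or.inr rfl)
    simp [vec, this]

lemma psi_psiStar_vec_of_mem {k : ℤ} {S : Maya} (h : k ∈ S.carrier) :
    psi k (psiStar k (vec S)) = vec S := by
  have h' : k ∉ (S.erase k).carrier := fun h => h.2 rfl
  rw [psiStar_vec_of_mem h, map_smul, psi_vec_of_notMem h', Maya.above_erase,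
    Maya.insert_erase h, smul_smul, ← mul_pow]
  simp

lemma psiStar_psi_vec_of_notMem {k : ℤ} {S : Maya} (h : k ∉ S.carrier) :
    psiStar k (psi k (vec S)) = vec S := by
  have h' : k ∈ (S.insert k).carrier := Or.inr rfl
  rw [psi_vec_of_notMem h, map_smul, psiStar_vec_of_mem h', Maya.above_insert,
    Maya.erase_insert h, smul_smul, ← mul_pow]
  simp

open Classical in
lemma psi_psiStar_vec (k : ℤ) (S : Maya) :
    psi k (psiStar k (vec S)) = if k ∈ S.carrier then vec S else 0 := by
  split_ifs with h
  · exact psi_psiStar_vec_of_mem h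
  · rw [psiStar_vec_of_notMem h, map_zero]

open Classical in
lemma normalOrd_vec (k : ℤ) (S : Maya) :
    normalOrd k (vec S) =
      (if k ∈ S.carrier ∧ 0 ≤ k then (1 : ℂ) else if k ∉ S.carrier ∧ k < 0 then -1 else 0) •
        vec S := by
  unfold normalOrd
  by_cases hk : 0 ≤ k <;> by_cases h : k ∈ S.carrier
  · simp [hk, h, psi_psiStar_vec_of_mem h]
  · simp [hk, h, psiStar_vec_of_notMem h]
  · simp [hk, h, psi_vec_of_mem h]
  · simp [hk, h, psiStar_psi_vec_of_notMem h, not_le.mp hk]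

/-- The operator `T(t) = ∑_k t^k ψ_k ψ*_k`, `t = x ^ 2`; the infinite sum is taken coefficientwise
with respect to the basis `v_S` (it converges for `1 < |t|`). -/
def opT (x : ℂ) : Wedge →ₗ[ℂ] Wedge :=
  Finsupp.linearCombination ℂ fun S : Maya =>
    Finsupp.onFinset {S} (fun S' => ∑' j : ℤ, x ^ (2 * j + 1) * psi j (psiStar j (vec S)) S') (by
      intro S' hS'
      by_contra hne
      rw [Finset.mem_singleton] at hne
      refine hS' ?_
      have hz : ∀ j : ℤ, x ^ (2 * j + 1) * psi j (psiStar j (vec S)) S' = 0 := by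
        intro j
        rw [psi_psiStar_vec]
        split_ifs
        · rw [vec, Finsupp.single_eq_of_ne hne, mul_zero]
        · simp
      simp only [hz, tsum_zero])

/-- The energy operator: the sum over `k` of `k` times the normally ordered product of `ψ_k` and
`ψ*_k` (on each `v_S` only finitely many terms are nonzero). -/
def opH : Wedge →ₗ[ℂ] Wedge :=
  Finsupp.linearCombination ℂ fun S : Maya =>
    Finsupp.onFinset {S} (fun S' => ∑ᶠ j : ℤ, ((j : ℂ) + 1 / 2) * normalOrd j (vec S) S') (by
      intro S' hS'
      by_contra hne
      rw [Finset.mem_singleton] at hne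
      refine hS' ?_
      have hz : ∀ j : ℤ, ((j : ℂ) + 1 / 2) * normalOrd j (vec S) S' = 0 := by
        intro j
        rw [normalOrd_vec, Finsupp.smul_apply, vec, Finsupp.single_eq_of_ne hne, smul_zero,
          mul_zero]
      simp only [hz, finsum_zero])

/-- `v_S` is an eigenvector of the energy operator, the eigenvalue being a half-integer
or an integer. -/
lemma opH_vec (S : Maya) : opH (vec S) = ((S.twiceEnergy : ℂ) / 2) • vec S := by
  classical
  have h1 : opH (vec S) S = (S.twiceEnergy : ℂ) / 2 := by
    have : opH (vec S) S = ∑ᶠ j : ℤ, ((j : ℂ) + 1 / 2) * normalOrd j (vec S) S := by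
      simp [opH, vec]
    rw [this]
    have hd : Disjoint S.finite_pos.toFinset S.finite_neg.toFinset := by
      rw [Finset.disjoint_left]
      intro j hj hj'
      simp only [Set.Finite.mem_toFinset, Set.mem_ofPred_eq] at hj hj'
      exact hj'.1 hj.1
    rw [finsum_eq_sum_of_support_subset (s := S.finite_pos.toFinset ∪ S.finite_neg.toFinset),
      Finset.sum_union hd, Maya.twiceEnergy]
    · push_cast
      rw [add_div, Finset.sum_div, Finset.sum_div]
      congr 1
      · refine Finset.sum_congr rfl fun j hj => ?_
        simp only [Set.Finite.mem_toFinset, Set.mem_ofPred_eq] at hj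
        have e : (((2 * j + 1).natAbs : ℕ) : ℂ) = 2 * (j : ℂ) + 1 := by
          have : (((2 * j + 1).natAbs : ℕ) : ℤ) = 2 * j + 1 := by omega
          rw [← Int.cast_natCast, this]
          push_cast
          ring
        rw [normalOrd_vec, if_pos hj, e]
        simp [vec]
        ring
      · refine Finset.sum_congr rfl fun j hj => ?_
        simp only [Set.Finite.mem_toFinset, Set.mem_ofPred_eq] at hj
        have e : (((2 * j + 1).natAbs : ℕ) : ℂ) = -(2 * (j : ℂ) + 1) := by
          have : (((2 * j + 1).natAbs : ℕ) : ℤ) = -(2 * j + 1) := by omega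
          rw [← Int.cast_natCast, this]
          push_cast
          ring
        rw [normalOrd_vec, if_neg (fun h => hj.1 h.1), if_pos hj, e]
        simp [vec]
        ring
    · intro j hj
      by_contra hne
      simp only [Finset.coe_union, Set.Finite.coe_toFinset, Set.mem_union, Set.mem_ofPred_eq,
        not_or] at hne
      refine hj ?_
      change ((j : ℂ) + 1 / 2) * normalOrd j (vec S) S = 0
      rw [normalOrd_vec, if_neg hne.1, if_neg hne.2]
      simp
  ext S'
  by_cases h : S' = S
  · subst h
    rw [h1]
    simp [vec]
  · have h0 : ∀ j : ℤ, normalOrd j (vec S) S' = 0 := by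
      intro j
      rw [normalOrd_vec, Finsupp.smul_apply, vec, Finsupp.single_eq_of_ne h, smul_zero]
    have : opH (vec S) S' = ∑ᶠ j : ℤ, ((j : ℂ) + 1 / 2) * normalOrd j (vec S) S' := by
      simp [opH, vec]
    rw [this]
    simp only [h0, mul_zero, finsum_zero, Finsupp.smul_apply]
    rw [vec, Finsupp.single_eq_of_ne h, smul_zero]

/-- The operator `q^H`, where `p` is the chosen square root of `q`: on the eigenvector `v_S` of `H`
with eigenvalue `E` it acts as `q ^ E = p ^ (2 E)`. -/
def qPowH (p : ℂ) : Wedge →ₗ[ℂ] Wedge :=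
  Finsupp.linearCombination ℂ fun S : Maya => p ^ S.twiceEnergy • vec S

/-- The diagonal matrix coefficient `(A v_S, v_S)`. -/
def diagCoeff (A : Wedge →ₗ[ℂ] Wedge) (S : Maya) : ℂ := A (vec S) S

/-- The trace over the whole infinite wedge space. -/
def trace (A : Wedge →ₗ[ℂ] Wedge) : ℂ := ∑' S : Maya, diagCoeff A S

/-- The operator `q^H T(t_1) ⋯ T(t_n)`, with `t_i = x_i ^ 2` and `q = p ^ 2`. -/
def opProd (p : ℂ) {n : ℕ} (x : Fin n → ℂ) : Wedge →ₗ[ℂ] Wedge :=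
  qPowH p * (List.ofFn fun i => (opT (x i) : Module.End ℂ Wedge)).prod

/-- The series `tr (q^H T(t_1) ⋯ T(t_n))`. -/
def traceFun (p : ℂ) {n : ℕ} (x : Fin n → ℂ) : ℂ := trace (opProd p x)

/-- `(q; q)_∞ = (1 - q) (1 - q ^ 2) ⋯`. -/
def eulerProd (q : ℂ) : ℂ := ∏' m : ℕ, (1 - q ^ (m + 1))

/-- The exponent `2 (λ_i - i + 1/2)`, for the part `λ_i` of number `i = r + 1`. -/
def twiceCoord (μ : YoungDiagram) (r : ℕ) : ℤ := 2 * ((μ.rowLen r : ℤ) - ((r : ℤ) + 1)) + 1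

/-- The summand `q ^ |λ| ∏_k ∑_{i ≥ 1} t_k ^ (λ_i - i + 1/2)`. -/
def nPointTerm (q : ℂ) {n : ℕ} (x : Fin n → ℂ) (μ : YoungDiagram) : ℂ :=
  q ^ μ.card * ∏ k, ∑' r : ℕ, x k ^ twiceCoord μ r

/-- The series of the `n`-point function `F(t_1, …, t_n)` of the uniform measure. -/
def nPointFun (q : ℂ) {n : ℕ} (x : Fin n → ℂ) : ℂ :=
  eulerProd q * ∑' μ : YoungDiagram, nPointTerm q x μ

/-- `Θ_3(t; q) = ∑_m q ^ (m ^ 2 / 2) t ^ m`, with `p` the chosen square root of `q`. -/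
def theta3 (p t : ℂ) : ℂ := ∑' m : ℤ, p ^ (m ^ 2) * t ^ m

/-- The domain of convergence: `1 < |t_i|` for all `i` and `|t_1 ⋯ t_n| < |q|⁻¹`. -/
def convDomain (q : ℂ) (n : ℕ) : Set (Fin n → ℂ) :=
  {x | (∀ i, 1 < ‖x i ^ 2‖) ∧ ‖∏ i, x i ^ 2‖ < ‖q‖⁻¹}

/-- The torus `(ℂ \ {0}) ^ n`. -/
def torus (n : ℕ) : Set (Fin n → ℂ) := {x | ∀ i, x i ≠ 0}

/-- The complement in the torus of the divisors `q ^ m t_{i_1} ⋯ t_{i_k} = 1`, where `m ∈ ℤ` and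
`{i_1, …, i_k}` is a nonempty set of indices. -/
def regularSet (q : ℂ) (n : ℕ) : Set (Fin n → ℂ) :=
  {x | x ∈ torus n ∧ ∀ (m : ℤ) (J : Finset (Fin n)), J.Nonempty → q ^ m * ∏ i ∈ J, x i ^ 2 ≠ 1}

/-- `f` is a meromorphic function of several variables on `Ω`: locally it is a quotient `g / h` of
analytic functions, where `h` does not vanish identically (values on the zero set of `h` are
disregarded). -/
def IsMeromorphicOn {n : ℕ} (f : (Fin n → ℂ) → ℂ) (Ω : Set (Fin n → ℂ)) : Prop :=
  ∀ z ∈ Ω, ∃ g h : (Fin n → ℂ) → ℂ, AnalyticAt ℂ g z ∧ AnalyticAt ℂ h z ∧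
    (¬ ∀ᶠ w in 𝓝 z, h w = 0) ∧ ∀ᶠ w in 𝓝 z, h w ≠ 0 → f w = g w / h w

/-- `G` is a meromorphic continuation to the torus of the function `f` given on the domain of
convergence, with singularities only on the divisors `q ^ m t_{i_1} ⋯ t_{i_k} = 1`. -/
structure IsContinuation (q : ℂ) {n : ℕ} (f G : (Fin n → ℂ) → ℂ) : Prop where
  meromorphic : IsMeromorphicOn G (torus n)
  analytic : AnalyticOnNhd ℂ G (regularSet q n)
  eqOn : Set.EqOn G f (convDomain q n)

/-- The point obtained from `(x_1, x_2, …, x_n)` by replacing the first variable with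
`a x_1`. -/
def scaleFirst (a : ℂ) {n : ℕ} (x : Fin (n + 1) → ℂ) : Fin (n + 1) → ℂ :=
  Fin.cons (a * x 0) (Fin.tail x)

/-- The point `(x_1 x_{i_1} ⋯ x_{i_s}, …, omit x_{i_1}, …, omit x_{i_s}, …)`; the subset
`I = {i_1, …, i_s}` of the indices other than the first one is given in the numbering of
`Fin.tail x`. -/
def mergeFirst {n : ℕ} (x : Fin (n + 1) → ℂ) (I : Finset (Fin n)) : Fin (Iᶜ.card + 1) → ℂ :=
  Fin.cons (x 0 * ∏ i ∈ I, Fin.tail x i) (fun j => Fin.tail x (Iᶜ.orderEmbOfFin rfl j))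

end InfiniteWedge

end

/-! Everything is diagonal in the basis `vec S`. A diagram `S` is the same as a pair of a partition
`μ` and a charge `c` (`mayaEquiv`); its energy is `|μ| + c ^ 2 / 2`, and the eigenvalue of `T(t)` is
`t ^ c` times the inner sum attached to `μ`. Summing over `c` and `μ` separately turns the trace
into a theta function times a sum over partitions, which is the factorization (`traceFun_eq`). It
remains to continue the sum over partitions and to find its `q`-difference equation; the equation
for the trace then follows from the quasi-periodicity of theta.

For the continuation, one variable `x₀` is singled out and its inner sum is written as a sum over
occupied levels `k`. The other variables are then averaged over charge-zero diagrams containing `k`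
(`occupiedSum`). Removing `k` lowers the charge by one, multiplies the weight by an explicit factor
and shifts the eigenvalues by `x i ^ (2 * k + 1)`. Since "`k` empty" is "everything" minus "`k`
occupied", this relates the occupied sum to the one of charge one lower (`occupiedSum_eq`). The
relation can be iterated in both directions, and the Gaussian factor `p ^ (c ^ 2)` kills the
remainders. This gives two expansions, over `j ≥ 1` and over `j ≤ 0`, whose consistency says that
the sum over all integers `j` vanishes (`tsum_expansionTerm`). With the first expansion for `k ≥ 0`
and the second for `k < 0`, the sums over `k` are geometric and both have the value `-(y / (1 - y ^
2))`, `y = σ * p ^ j`. The result is a recursion on the number of variables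
(`partitionSum_recursion`), whose `kernel` makes sense on the whole torus with poles only at `q ^ j
* σ ^ 2 = 1`. Taken as a definition, the recursion is the continuation `nPointCont`.

Replacing `σ` by `p * σ` shifts `j` by one in the kernel, so `(j - 1) ^ m` appears; its binomial
expansion, indexed by subsets, reproduces the alternating sum over merged variables
(`kernel_mul_left`, `nPointCont_scaleFirst`). The leftover series without poles cancel in total:
this is the vanishing found above (`sum_kernelDefect_eq_zero`).

Identities pass from the domain of convergence to all regular points by `eqOn_regularSet`: a regular
point is reached along an exponential curve that meets the divisors for countably many parameters
only. -/

noncomputable section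

namespace InfiniteWedge

/-! ### Maya diagrams: charge, energy, and adding or removing one level. -/

namespace Maya

/-- The regularized sum of `f` over a Maya diagram: the sum over its nonnegative elements minus the
sum over its negative non-elements. -/
def regSum (f : ℤ → ℤ) (S : Maya) : ℤ :=
  ∑ j ∈ S.finite_pos.toFinset, f j - ∑ j ∈ S.finite_neg.toFinset, f j

/-- The charge `|S₊| - |S₋|`. -/
def charge (S : Maya) : ℤ := S.regSum fun _ => 1

/-- The absolute values are absorbed by the minus sign in front of the negative non-elements. In
this form the energy is additive under insertion of a level. -/
lemma twiceEnergy_eq_regSum (S : Maya) : (S.twiceEnergy : ℤ) = S.regSum fun j => 2 * j + 1 := by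
  unfold twiceEnergy regSum
  push_cast
  rw [sub_eq_add_neg, ← Finset.sum_neg_distrib]
  congr 1
  · refine Finset.sum_congr rfl fun j hj => ?_
    simp only [Set.Finite.mem_toFinset, Set.mem_ofPred_eq] at hj
    exact abs_of_nonneg (by omega)
  · refine Finset.sum_congr rfl fun j hj => ?_
    simp only [Set.Finite.mem_toFinset, Set.mem_ofPred_eq] at hj
    exact abs_of_neg (by omega)

/-- A nonnegative `k` becomes a new summand, a negative `k` fills a hole that was subtracted; either
way the change is `f k`. -/
lemma regSum_insert (f : ℤ → ℤ) {k : ℤ} {S : Maya} (h : k ∉ S.carrier) :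
    (S.insert k).regSum f = S.regSum f + f k := by
  classical
  unfold regSum
  by_cases hk : 0 ≤ k
  · have h1 : (S.insert k).finite_pos.toFinset = Insert.insert k S.finite_pos.toFinset := by
      ext j
      simp only [Set.Finite.mem_toFinset, Set.mem_ofPred_eq, Maya.insert, Set.mem_union,
        Set.mem_singleton_iff, Finset.mem_insert]
      grind
    have h2 : (S.insert k).finite_neg.toFinset = S.finite_neg.toFinset := by
      ext j
      simp only [Set.Finite.mem_toFinset, Set.mem_ofPred_eq, Maya.insert, Set.mem_union,
        Set.mem_singleton_iff]
      grind
    rw [h1, h2, Finset.sum_insert (by simp [h])]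
    ring
  · have h1 : (S.insert k).finite_pos.toFinset = S.finite_pos.toFinset := by
      ext j
      simp only [Set.Finite.mem_toFinset, Set.mem_ofPred_eq, Maya.insert, Set.mem_union,
        Set.mem_singleton_iff]
      grind
    have h2 : S.finite_neg.toFinset = Insert.insert k (S.insert k).finite_neg.toFinset := by
      ext j
      simp only [Set.Finite.mem_toFinset, Set.mem_ofPred_eq, Maya.insert, Set.mem_union,
        Set.mem_singleton_iff, Finset.mem_insert]
      grind
    rw [h1, h2, Finset.sum_insert (by simp [Maya.insert])]
    ring

/-- The regularized sum may be computed with any cutoff `-d` below which all levels are filled: the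
part of `P` in `[-d, 0)` cancels against the filled reference sea. -/
lemma regSum_eq_of_carrier_eq (f : ℤ → ℤ) {S : Maya} {P : Finset ℤ} {d : ℕ}
    (hP : ∀ j ∈ P, -(d : ℤ) ≤ j) (hS : S.carrier = ↑P ∪ {j | j < -(d : ℤ)}) :
    S.regSum f = ∑ j ∈ P, f j - ∑ j ∈ Finset.Ico (-(d : ℤ)) 0, f j := by
  classical
  have hmem : ∀ j, j ∈ S.carrier ↔ j ∈ P ∨ j < -(d : ℤ) := by
    intro j; rw [hS]; simp
  have h1 : S.finite_pos.toFinset = P.filter (0 ≤ ·) := by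
    ext j
    simp only [Set.Finite.mem_toFinset, Set.mem_ofPred_eq, hmem, Finset.mem_filter]
    grind
  have h2 : S.finite_neg.toFinset = Finset.Ico (-(d : ℤ)) 0 \ P := by
    ext j
    simp only [Set.Finite.mem_toFinset, Set.mem_ofPred_eq, hmem, Finset.mem_sdiff,
      Finset.mem_Ico]
    grind
  have h3 : P.filter (fun j => ¬ 0 ≤ j) = Finset.Ico (-(d : ℤ)) 0 ∩ P := by
    ext j
    simp only [Finset.mem_filter, Finset.mem_inter, Finset.mem_Ico]
    grind
  unfold regSum
  rw [h1, h2, ← Finset.sum_filter_add_sum_filter_not P (0 ≤ ·) f, h3,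
    ← Finset.sum_inter_add_sum_sdiff (Finset.Ico (-(d : ℤ)) 0) P f]
  ring

/-- Adding `k` to a Maya diagram or removing it. -/
def toggle (k : ℤ) : Maya ≃ Maya := by
  classical
  refine Function.Involutive.toPerm
    (fun S => if k ∈ S.carrier then S.erase k else S.insert k) ?_
  intro S
  by_cases h : k ∈ S.carrier
  · have h' : k ∉ (S.erase k).carrier := fun h => h.2 rfl
    simp [h, h', Maya.insert_erase h]
  · have h' : k ∈ (S.insert k).carrier := Or.inr rfl
    simp [h, h', Maya.erase_insert h]

lemma toggle_of_notMem {k : ℤ} {S : Maya} (h : k ∉ S.carrier) : toggle k S = S.insert k := by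
  classical
  exact if_neg h

lemma mem_toggle {k : ℤ} {S : Maya} : k ∈ (toggle k S).carrier ↔ k ∉ S.carrier := by
  classical
  by_cases h : k ∈ S.carrier
  · have : toggle k S = S.erase k := if_pos h
    simp [this, h, Maya.erase]
  · rw [toggle_of_notMem h]
    simp [h, Maya.insert]

end Maya

/-! ### The correspondence between Maya diagrams and charged partitions. -/

/-- The `r`-th largest element of the Maya diagram of the partition `μ` in charge `c`. -/
def particle (μ : YoungDiagram) (c : ℤ) (r : ℕ) : ℤ := (μ.rowLen r : ℤ) - (r + 1) + c

lemma particle_strictAnti (μ : YoungDiagram) (c : ℤ) : StrictAnti (particle μ c) := by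
  refine strictAnti_nat_of_succ_lt fun r => ?_
  have := μ.rowLen_anti r (r + 1) (by omega)
  unfold particle
  push_cast
  omega

lemma rowLen_eq_zero_of_le {μ : YoungDiagram} {r : ℕ} (h : μ.colLen 0 ≤ r) : μ.rowLen r = 0 := by
  by_contra hne
  have : (r, 0) ∈ μ := YoungDiagram.mem_iff_lt_rowLen.2 (Nat.pos_of_ne_zero hne)
  have := YoungDiagram.mem_iff_lt_colLen.1 this
  omega

lemma range_particle (μ : YoungDiagram) (c : ℤ) {R : ℕ} (hR : μ.colLen 0 ≤ R) :
    Set.range (particle μ c) =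
      ↑((Finset.range R).image (particle μ c)) ∪ {j : ℤ | j < c - R} := by
  ext j
  simp only [Set.mem_range, Finset.coe_image, Set.mem_union, Set.mem_image, Finset.coe_range,
    Set.mem_Iio, Set.mem_ofPred_eq]
  constructor
  · rintro ⟨r, rfl⟩
    by_cases hr : r < R
    · exact Or.inl ⟨r, hr, rfl⟩
    · right
      simp only [particle, rowLen_eq_zero_of_le (hR.trans (not_lt.1 hr))]
      push_cast
      omega
  · rintro (⟨r, -, rfl⟩ | h)
    · exact ⟨r, rfl⟩
    · refine ⟨(c - 1 - j).toNat, ?_⟩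
      rw [particle, rowLen_eq_zero_of_le (by omega)]
      push_cast
      omega

/-- The Maya diagram of the partition `μ` in charge `c`. -/
def mayaOf (μ : YoungDiagram) (c : ℤ) : Maya where
  carrier := Set.range (particle μ c)
  finite_pos := by
    refine (Set.finite_Icc 0 (particle μ c 0)).subset ?_
    rintro j ⟨⟨r, rfl⟩, h⟩
    exact ⟨h, (particle_strictAnti μ c).antitone (Nat.zero_le r)⟩
  finite_neg := by
    refine (Set.finite_Ico (c - μ.colLen 0) 0).subset ?_
    rintro j ⟨h, h0⟩
    refine ⟨?_, h0⟩
    by_contra hlt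
    rw [range_particle μ c le_rfl] at h
    exact h (Or.inr (not_le.1 hlt))

lemma sum_rowLen {μ : YoungDiagram} {R : ℕ} (hR : μ.colLen 0 ≤ R) :
    ∑ r ∈ Finset.range R, μ.rowLen r = μ.card := by
  rw [YoungDiagram.card, Finset.card_eq_sum_card_fiberwise (f := Prod.fst) (t := Finset.range R)]
  · refine Finset.sum_congr rfl fun r _ => ?_
    rw [μ.rowLen_eq_card]
    rfl
  · intro x hx
    have hx' : (x.1, x.2) ∈ μ := hx
    have : (x.1, 0) ∈ μ := μ.up_left_mem le_rfl (Nat.zero_le _) hx'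
    have := YoungDiagram.mem_iff_lt_colLen.1 this
    simp
    omega

lemma regSum_mayaOf (f : ℤ → ℤ) (μ : YoungDiagram) (c : ℤ) {R : ℕ} (hR : μ.colLen 0 ≤ R)
    (hc : c ≤ R) :
    (mayaOf μ c).regSum f =
      ∑ r ∈ Finset.range R, f (particle μ c r) -
        ∑ i ∈ Finset.range (R - c).toNat, f (c - R + i) := by
  have hd : (((R : ℤ) - c).toNat : ℤ) = R - c := Int.toNat_of_nonneg (by omega)
  rw [Maya.regSum_eq_of_carrier_eq f (P := (Finset.range R).image (particle μ c))
    (d := ((R : ℤ) - c).toNat)]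
  · rw [Finset.sum_image ((particle_strictAnti μ c).injective.injOn)]
    congr 1
    refine (Finset.sum_bij (fun (i : ℕ) _ => c - R + (i : ℤ)) ?_ ?_ ?_ ?_).symm
    · intro i hi
      simp only [Finset.mem_range, Finset.mem_Ico] at hi ⊢
      omega
    · intro i _ j _ h
      simpa using h
    · intro j hj
      simp only [Finset.mem_Ico] at hj
      exact ⟨(j - (c - R)).toNat, by simp; omega, by omega⟩
    · intro i _
      rfl
  · intro j hj
    simp only [Finset.mem_image, Finset.mem_range] at hj
    obtain ⟨r, hr, rfl⟩ := hj
    rw [hd]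
    unfold particle
    omega
  · rw [hd]
    simpa [mayaOf] using range_particle μ c hR

lemma charge_mayaOf (μ : YoungDiagram) (c : ℤ) : (mayaOf μ c).charge = c := by
  rw [Maya.charge, regSum_mayaOf _ μ c (R := max (μ.colLen 0) c.toNat) (le_max_left _ _)
    (by omega)]
  simp

lemma sum_range_odd (n : ℕ) (a : ℤ) :
    ∑ i ∈ Finset.range n, (2 * (a + (i : ℤ)) + 1) = n * (2 * a + n) := by
  induction n with
  | zero => simp
  | succ n ih => rw [Finset.sum_range_succ, ih]; push_cast; ring

/-- The term `c ^ 2` is twice the energy of the empty partition in charge `c`. It is the source both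
of the theta function and of the Gaussian decay in the charge. -/
lemma twiceEnergy_mayaOf (μ : YoungDiagram) (c : ℤ) :
    ((mayaOf μ c).twiceEnergy : ℤ) = 2 * μ.card + c ^ 2 := by
  -- The cutoff has to lie beyond all nonzero rows and be at least `c`, so that the levels below `c
  -- - R` are filled and negative.
  set R := max (μ.colLen 0) c.toNat with hRdef
  have hR : μ.colLen 0 ≤ R := le_max_left _ _
  have hc : c ≤ R := by omega
  rw [Maya.twiceEnergy_eq_regSum, regSum_mayaOf _ μ c hR hc, sum_range_odd,
    Int.toNat_of_nonneg (by omega)]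
  have h2 : ∀ r : ℕ, 2 * particle μ c r + 1 =
      2 * (μ.rowLen r : ℤ) + (2 * c - (2 * (0 + (r : ℤ)) + 1)) := by
    intro r; unfold particle; ring
  simp only [h2]
  rw [Finset.sum_add_distrib, Finset.sum_sub_distrib, sum_range_odd, ← Finset.mul_sum,
    ← sum_rowLen hR]
  simp
  ring

lemma youngDiagram_ext {μ ν : YoungDiagram} (h : ∀ r, μ.rowLen r = ν.rowLen r) : μ = ν := by
  ext ⟨i, j⟩
  rw [YoungDiagram.mem_cells, YoungDiagram.mem_cells, YoungDiagram.mem_iff_lt_rowLen,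
    YoungDiagram.mem_iff_lt_rowLen, h]

lemma exists_youngDiagram {f : ℕ → ℕ} (hf : Antitone f) {m : ℕ} (hm : ∀ r, m ≤ r → f r = 0) :
    ∃ μ : YoungDiagram, ∀ r, μ.rowLen r = f r := by
  classical
  have key : ∀ i j, (i, j) ∈ (Finset.range m ×ˢ Finset.range (f 0)).filter
      (fun c => c.2 < f c.1) ↔ j < f i := by
    intro i j
    simp only [Finset.mem_filter, Finset.mem_product, Finset.mem_range, and_iff_right_iff_imp]
    intro h
    refine ⟨?_, h.trans_le (hf (Nat.zero_le i))⟩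
    by_contra hi
    rw [hm i (not_lt.1 hi)] at h
    omega
  let μ : YoungDiagram :=
    { cells := (Finset.range m ×ˢ Finset.range (f 0)).filter (fun c => c.2 < f c.1)
      isLowerSet := by
        rintro ⟨a, b⟩ ⟨a', b'⟩ hle h
        have h1 := (Prod.mk_le_mk.1 hle).1
        have h2 := (Prod.mk_le_mk.1 hle).2
        rw [Finset.mem_coe, key] at h ⊢
        exact (h2.trans_lt h).trans_le (hf h1) }
  refine ⟨μ, fun r => ?_⟩
  have h : ∀ j, j < μ.rowLen r ↔ j < f r := fun j => by
    rw [← YoungDiagram.mem_iff_lt_rowLen]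
    exact key r j
  have h1 := h (f r)
  have h2 := h (μ.rowLen r)
  omega

/-- The charge is an invariant of the diagram, and a strictly monotone sequence is determined by its
range. -/
lemma mayaOf_injective : Function.Injective fun a : YoungDiagram × ℤ => mayaOf a.1 a.2 := by
  rintro ⟨μ, c⟩ ⟨ν, d⟩ h
  have hcd : c = d := by
    have := congrArg Maya.charge h
    simpa only [charge_mayaOf] using this
  subst hcd
  have hr : Set.range (particle μ c) = Set.range (particle ν c) := congrArg Maya.carrier h
  have hneg : StrictMono fun r => -particle μ c r := (particle_strictAnti μ c).neg
  have hneg' : StrictMono fun r => -particle ν c r := (particle_strictAnti ν c).neg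
  have hr' : (Set.range fun r => -particle μ c r) = Set.range fun r => -particle ν c r := by
    have e : ∀ g : ℕ → ℤ, (Set.range fun r => -g r) = (fun x => -x) '' Set.range g := by
      intro g
      rw [← Set.range_comp]
      rfl
    rw [e, e, hr]
  have := (hneg.range_inj hneg').1 hr'
  have hμ : μ = ν := youngDiagram_ext fun r => by
    have := congrFun this r
    simp only [particle] at this
    omega
  rw [hμ]

/-- The elements of `S`, listed downwards from an upper bound `M`, are `M - s r`. The number `s r -
r` of gaps passed grows until all gaps are exhausted; the gaps still ahead of the `r`-th element
form its row length. -/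
lemma mayaOf_surjective : Function.Surjective fun a : YoungDiagram × ℤ => mayaOf a.1 a.2 := by
  classical
  intro S
  obtain ⟨M, hM⟩ : ∃ M : ℤ, ∀ j ∈ S.carrier, j ≤ M := by
    obtain ⟨M, hM⟩ := S.finite_pos.bddAbove
    refine ⟨max M 0, fun j hj => ?_⟩
    by_cases h0 : 0 ≤ j
    · exact (hM ⟨hj, h0⟩).trans (le_max_left _ _)
    · omega
  obtain ⟨L, hL⟩ : ∃ L : ℤ, ∀ j < L, j ∈ S.carrier := by
    obtain ⟨L, hL⟩ := S.finite_neg.bddBelow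
    refine ⟨min L 0, fun j hj => ?_⟩
    by_contra h
    have := hL (a := j) ⟨h, by omega⟩
    omega
  set p : ℕ → Prop := fun n => M - n ∈ S.carrier with hp
  set n0 : ℕ := (M - L + 1).toNat with hn0
  have hn0p : ∀ n, n0 ≤ n → p n := fun n hn => hL _ (by omega)
  have hinf : (Set.ofPred p).Infinite := by
    refine (Set.Ici_infinite n0).mono fun n hn => hn0p n hn
  set s := Nat.nth p with hs
  have hsm : StrictMono s := Nat.nth_strictMono hinf
  set r0 := Nat.count p n0 with hr0
  have hr0n : r0 ≤ n0 := Nat.count_le _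
  -- From `n0` on there are no gaps, so the number of gaps `s r - r` is constant, equal to `n0 -
  -- r0`, for `r ≥ r0`.
  have hcount : ∀ i, Nat.count p (n0 + i) = r0 + i := by
    intro i
    induction i with
    | zero => rfl
    | succ i ih =>
      rw [← add_assoc, Nat.count_succ, ih, if_pos (hn0p _ (by omega))]
      ring
  have hsr : ∀ i, s (r0 + i) = n0 + i := by
    intro i
    rw [← hcount i]
    exact Nat.nth_count (hn0p _ (by omega))
  have hmono : Monotone fun r => (s r : ℤ) - r := by
    refine monotone_nat_of_le_succ fun r => ?_
    have := hsm (show r < r + 1 by omega)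
    push_cast
    omega
  have hle : ∀ r, (s r : ℤ) - r ≤ n0 - r0 := by
    intro r
    have h1 := hmono (show r ≤ r0 + r by omega)
    have h2 := hsr r
    simp only at h1
    push_cast at h1
    omega
  obtain ⟨μ, hμ⟩ := exists_youngDiagram (f := fun r => ((n0 : ℤ) - r0 - (s r - r)).toNat)
    (m := r0) (by
      intro a b hab
      have := hmono hab
      simp only at this
      dsimp only
      omega) (by
      intro r hr
      obtain ⟨i, rfl⟩ := Nat.exists_eq_add_of_le hr
      rw [hsr]
      push_cast
      omega)
  refine ⟨(μ, M + 1 - (n0 - r0)), ?_⟩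
  have hpart : ∀ r, particle μ (M + 1 - (n0 - r0)) r = M - s r := by
    intro r
    have := hle r
    rw [particle, hμ, Int.toNat_of_nonneg (by omega)]
    ring
  ext j
  change j ∈ Set.range (particle μ (M + 1 - (n0 - r0))) ↔ _
  constructor
  · rintro ⟨r, rfl⟩
    rw [hpart]
    exact Nat.nth_mem_of_infinite hinf r
  · intro hj
    have hjM := hM j hj
    have hpj : p (M - j).toNat := by
      rw [hp]
      dsimp only
      rwa [Int.toNat_of_nonneg (by omega), sub_sub_cancel]
    refine ⟨Nat.count p (M - j).toNat, ?_⟩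
    rw [hpart, hs, Nat.nth_count hpj]
    omega

/-- Partitions and charges parametrize Maya diagrams. -/
def mayaEquiv : YoungDiagram × ℤ ≃ Maya :=
  Equiv.ofBijective _ ⟨mayaOf_injective, mayaOf_surjective⟩

/-! ### Eigenvalues and absolute convergence. -/

/-- The eigenvalue `∑_{k ∈ S} t ^ k` of `T(t)` on `v_S`, where `t = x ^ 2`. -/
def levelSum (x : ℂ) (S : Maya) : ℂ := ∑' j : ℤ, S.carrier.indicator (fun j => x ^ (2 * j + 1)) j

/-- The analogue of `levelSum` over the reals. -/
def levelBound (y : ℝ) (S : Maya) : ℝ :=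
  ∑' j : ℤ, S.carrier.indicator (fun j => y ^ (2 * j + 1)) j

lemma summable_negative_levels {y : ℝ} (hy : 1 < y) :
    Summable ((Set.Iio (0 : ℤ)).indicator fun j : ℤ => y ^ (2 * j + 1)) := by
  have h0 : 0 < y := by linarith
  refine Summable.of_nat_of_neg_add_one ?_ ?_
  · refine summable_zero.congr fun n => ?_
    rw [Set.indicator_of_notMem (by simp)]
  · have hs : Summable fun n : ℕ => y⁻¹ * ((y ^ 2)⁻¹) ^ n :=
      (summable_geometric_of_lt_one (by positivity)
        (inv_lt_one_of_one_lt₀ (by nlinarith))).mul_left _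
    refine hs.congr fun n => ?_
    rw [Set.indicator_of_mem (by simp; omega)]
    rw [show 2 * -((n : ℤ) + 1) + 1 = -((2 * n + 1 : ℕ) : ℤ) by push_cast; ring, zpow_neg,
      zpow_natCast, pow_add, pow_mul, mul_inv, inv_pow]
    ring

lemma indicator_level_le {y : ℝ} (hy : 1 < y) (S : Maya) (j : ℤ) :
    S.carrier.indicator (fun j => y ^ (2 * j + 1)) j ≤
      (Set.Iio (0 : ℤ)).indicator (fun j : ℤ => y ^ (2 * j + 1)) j +
        (S.finite_pos.toFinset : Set ℤ).indicator (fun j => y ^ (2 * j + 1)) j := by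
  classical
  have h : ∀ j : ℤ, 0 < y ^ (2 * j + 1) := fun j => zpow_pos (by linarith) _
  have h' := h j
  simp only [Set.indicator_apply, Set.mem_Iio, Set.Finite.coe_toFinset, Set.mem_ofPred_eq]
  split_ifs <;> first | linarith | (exfalso; grind)

lemma indicator_level_nonneg {y : ℝ} (hy : 1 < y) (A : Set ℤ) (j : ℤ) :
    0 ≤ A.indicator (fun j => y ^ (2 * j + 1)) j :=
  Set.indicator_nonneg (fun _ _ => (zpow_pos (by linarith) _).le) j

lemma summable_indicator_finset (y : ℝ) (P : Finset ℤ) :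
    Summable ((P : Set ℤ).indicator fun j => y ^ (2 * j + 1)) :=
  summable_of_ne_finset_zero (s := P) fun j hj => Set.indicator_of_notMem (by simpa using hj) _

lemma summable_levelBound {y : ℝ} (hy : 1 < y) (S : Maya) :
    Summable (S.carrier.indicator fun j => y ^ (2 * j + 1)) :=
  Summable.of_nonneg_of_le (indicator_level_nonneg hy _) (indicator_level_le hy S)
    ((summable_negative_levels hy).add (summable_indicator_finset y _))

lemma levelBound_nonneg {y : ℝ} (hy : 1 < y) (S : Maya) : 0 ≤ levelBound y S :=
  tsum_nonneg (indicator_level_nonneg hy _)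

/-- The filled negative levels contribute at most a fixed geometric series, and a sum of nonnegative
numbers is at most the product of one plus each of them. The multiplicative form is what allows
summation over all finite sets of levels. -/
lemma exists_levelBound_le {y : ℝ} (hy : 1 < y) :
    ∃ K : ℝ, 0 ≤ K ∧ ∀ S : Maya, levelBound y S ≤
      K * ∏ j ∈ S.finite_pos.toFinset, (1 + y ^ (2 * j + 1)) := by
  set s := ∑' j, (Set.Iio (0 : ℤ)).indicator (fun j : ℤ => y ^ (2 * j + 1)) j with hs
  have hs0 : 0 ≤ s := tsum_nonneg (indicator_level_nonneg hy _)
  refine ⟨s + 1, by positivity, fun S => ?_⟩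
  have h1 : levelBound y S ≤ s + ∑ j ∈ S.finite_pos.toFinset, y ^ (2 * j + 1) := by
    rw [hs, sum_eq_tsum_indicator, ← (summable_negative_levels hy).tsum_add
      (summable_indicator_finset y _)]
    exact (summable_levelBound hy S).tsum_le_tsum (indicator_level_le hy S)
      ((summable_negative_levels hy).add (summable_indicator_finset y _))
  have hnn : ∀ j : ℤ, 0 ≤ y ^ (2 * j + 1) := fun j => (zpow_pos (by linarith) _).le
  have h2 : 1 + ∑ j ∈ S.finite_pos.toFinset, y ^ (2 * j + 1) ≤
      ∏ j ∈ S.finite_pos.toFinset, (1 + y ^ (2 * j + 1)) := by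
    refine Finset.induction_on S.finite_pos.toFinset (by simp) fun i P hi ih => ?_
    rw [Finset.sum_insert hi, Finset.prod_insert hi]
    have := hnn i
    have : 0 ≤ ∑ j ∈ P, y ^ (2 * j + 1) := Finset.sum_nonneg fun j _ => hnn j
    nlinarith
  have h3 : 0 ≤ ∑ j ∈ S.finite_pos.toFinset, y ^ (2 * j + 1) := Finset.sum_nonneg fun j _ => hnn j
  nlinarith

lemma norm_indicator_level (x : ℂ) (A : Set ℤ) (j : ℤ) :
    ‖A.indicator (fun j => x ^ (2 * j + 1)) j‖ = A.indicator (fun j => ‖x‖ ^ (2 * j + 1)) j := by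
  rw [norm_indicator_eq_indicator_norm]
  simp only [norm_zpow]

lemma summable_levelSum {x : ℂ} (hx : 1 < ‖x‖) (S : Maya) :
    Summable (S.carrier.indicator fun j => x ^ (2 * j + 1)) := by
  refine Summable.of_norm ?_
  simp only [norm_indicator_level]
  exact summable_levelBound hx S

lemma norm_levelSum_le {x : ℂ} (hx : 1 < ‖x‖) (S : Maya) :
    ‖levelSum x S‖ ≤ levelBound ‖x‖ S := by
  have h : Summable fun j => ‖S.carrier.indicator (fun j => x ^ (2 * j + 1)) j‖ := by
    simp only [norm_indicator_level]
    exact summable_levelBound hx S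
  refine (norm_tsum_le_tsum_norm h).trans_eq ?_
  simp only [norm_indicator_level]
  rfl

lemma levelSum_insert {x : ℂ} (hx : 1 < ‖x‖) {k : ℤ} {S : Maya} (h : k ∉ S.carrier) :
    levelSum x (S.insert k) = levelSum x S + x ^ (2 * k + 1) := by
  have e : (S.insert k).carrier.indicator (fun j => x ^ (2 * j + 1)) =
      S.carrier.indicator (fun j => x ^ (2 * j + 1)) +
        ({k} : Set ℤ).indicator (fun j => x ^ (2 * j + 1)) :=
    Set.indicator_union_of_disjoint (by simpa using h) _
  have hf : HasSum (({k} : Set ℤ).indicator fun j => x ^ (2 * j + 1)) (x ^ (2 * k + 1)) := by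
    convert hasSum_single (f := ({k} : Set ℤ).indicator fun j => x ^ (2 * j + 1)) k ?_ using 1
    · simp
    · intro j hj
      simp [hj]
  rw [levelSum, e]
  simp only [Pi.add_apply]
  rw [(summable_levelSum hx S).tsum_add hf.summable, hf.tsum_eq]
  rfl

lemma particle_eq_twiceCoord (μ : YoungDiagram) (c : ℤ) (r : ℕ) :
    2 * particle μ c r + 1 = 2 * c + twiceCoord μ r := by
  unfold particle twiceCoord
  ring

lemma levelSum_mayaOf {x : ℂ} (hx : x ≠ 0) (μ : YoungDiagram) (c : ℤ) :
    levelSum x (mayaOf μ c) = x ^ (2 * c) * ∑' r : ℕ, x ^ twiceCoord μ r := by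
  rw [levelSum, ← tsum_mul_left]
  change ∑' j, (Set.range (particle μ c)).indicator (fun j => x ^ (2 * j + 1)) j = _
  rw [← tsum_subtype, tsum_range (fun j => x ^ (2 * j + 1)) (particle_strictAnti μ c).injective]
  refine tsum_congr fun r => ?_
  rw [particle_eq_twiceCoord, zpow_add₀ hx]

lemma summable_twiceCoord {x : ℂ} (hx : 1 < ‖x‖) (μ : YoungDiagram) :
    Summable fun r : ℕ => x ^ twiceCoord μ r := by
  have h := ((particle_strictAnti μ 0).injective.summable_iff
    (f := (mayaOf μ 0).carrier.indicator fun j => x ^ (2 * j + 1)) (fun j hj =>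
      Set.indicator_of_notMem hj _)).2 (summable_levelSum hx _)
  refine h.congr fun r => ?_
  rw [Function.comp_apply, Set.indicator_of_mem (by exact ⟨r, rfl⟩), particle_eq_twiceCoord]
  simp

/-- After the product bound on each eigenvalue, the summand is dominated by a product over positive
elements times a product over holes. The series then factors into two sums over finite subsets of
`ℤ`, which converge since `(b * Y) ^ |2 j + 1|` and `b ^ |2 j + 1|` are summable in `j`. -/
lemma summable_energy_mul_levelBound {ι : Type*} (J : Finset ι) {b : ℝ} {y : ι → ℝ} (hb0 : 0 < b)
    (hb1 : b < 1) (hy : ∀ i ∈ J, 1 < y i) (hby : b * ∏ i ∈ J, y i < 1) :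
    Summable fun S : Maya => b ^ S.twiceEnergy * ∏ i ∈ J, levelBound (y i) S := by
  classical
  have hK : ∀ i : ι, ∃ K : ℝ, i ∈ J → 0 ≤ K ∧ ∀ S : Maya, levelBound (y i) S ≤
      K * ∏ j ∈ S.finite_pos.toFinset, (1 + y i ^ (2 * j + 1)) := by
    intro i
    by_cases hi : i ∈ J
    · obtain ⟨K, hK⟩ := exists_levelBound_le (hy i hi)
      exact ⟨K, fun _ => hK⟩
    · exact ⟨0, fun h => absurd h hi⟩
  choose K hK using hK
  set Y := ∏ i ∈ J, y i with hY
  have hY0 : 0 < Y := Finset.prod_pos fun i hi => by linarith [hy i hi]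
  set a : ℤ → ℝ := fun j => 2 ^ J.card * (b * Y) ^ (2 * j + 1).natAbs with ha
  set a' : ℤ → ℝ := fun j => b ^ (2 * j + 1).natAbs with ha'
  have hgeom : ∀ z : ℝ, 0 < z → z < 1 → Summable fun j : ℤ => z ^ (2 * j + 1).natAbs := by
    intro z hz0 hz1
    have hs : Summable fun n : ℕ => z * (z ^ 2) ^ n :=
      (summable_geometric_of_lt_one (by positivity) (by nlinarith)).mul_left _
    refine Summable.of_nat_of_neg_add_one (hs.congr fun n => ?_) (hs.congr fun n => ?_)
    · rw [show (2 * (n : ℤ) + 1).natAbs = 2 * n + 1 by omega, pow_succ z (2 * n), pow_mul]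
      ring
    · rw [show (2 * -((n : ℤ) + 1) + 1).natAbs = 2 * n + 1 by omega, pow_succ z (2 * n), pow_mul]
      ring
  have hbY0 : 0 < b * Y := mul_pos hb0 hY0
  have ha0 : ∀ j, 0 ≤ a j := fun j => by positivity
  have ha0' : ∀ j, 0 ≤ a' j := fun j => by positivity
  have hsum : Summable fun s : Finset ℤ × Finset ℤ => (∏ j ∈ s.1, a j) * ∏ j ∈ s.2, a' j :=
    (summable_finsetProd_of_summable_nonneg ha0 ((hgeom _ hbY0 hby).mul_left _)).mul_of_nonneg
      (summable_finsetProd_of_summable_nonneg ha0' (hgeom _ hb0 hb1))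
      (fun s => Finset.prod_nonneg fun j _ => ha0 j)
      (fun s => Finset.prod_nonneg fun j _ => ha0' j)
  have hinj : Function.Injective fun S : Maya =>
      (S.finite_pos.toFinset, S.finite_neg.toFinset) := by
    intro S S' h
    simp only [Prod.mk.injEq, Finset.ext_iff, Set.Finite.mem_toFinset, Set.mem_ofPred_eq] at h
    ext j
    have h1 := h.1 j
    have h2 := h.2 j
    by_cases hj : 0 ≤ j
    · simpa [hj] using h1
    · have := not_le.1 hj
      simp only [this, and_true] at h2
      exact not_iff_not.1 h2
  refine Summable.of_nonneg_of_le (fun S => mul_nonneg (by positivity)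
    (Finset.prod_nonneg fun i hi => levelBound_nonneg (hy i hi) S)) (fun S => ?_)
    ((hsum.comp_injective hinj).mul_left (∏ i ∈ J, K i))
  have h1 : ∏ i ∈ J, levelBound (y i) S ≤
      (∏ i ∈ J, K i) * ∏ j ∈ S.finite_pos.toFinset, ∏ i ∈ J, (1 + y i ^ (2 * j + 1)) := by
    rw [Finset.prod_comm, ← Finset.prod_mul_distrib]
    exact Finset.prod_le_prod (fun i hi => levelBound_nonneg (hy i hi) S)
      (fun i hi => (hK i hi).2 S)
  -- Because `y i > 1` and the exponent is positive, `1 + y i ^ (2 * j + 1)` is at most twice the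
  -- power.
  have h2 : ∀ j ∈ S.finite_pos.toFinset, ∏ i ∈ J, (1 + y i ^ (2 * j + 1)) ≤
      2 ^ J.card * Y ^ (2 * j + 1).natAbs := by
    intro j hj
    have hj0 : 0 ≤ j := by
      simp only [Set.Finite.mem_toFinset, Set.mem_ofPred_eq] at hj
      exact hj.2
    rw [hY, ← Finset.prod_pow, ← Finset.prod_const, ← Finset.prod_mul_distrib]
    refine Finset.prod_le_prod (fun i hi => ?_) fun i hi => ?_
    · have := zpow_pos (show 0 < y i by linarith [hy i hi]) (2 * j + 1)
      positivity
    · have e : y i ^ (2 * j + 1) = y i ^ (2 * j + 1).natAbs := by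
        rw [← zpow_natCast, Int.natAbs_of_nonneg (by omega)]
      have := one_le_pow₀ (hy i hi).le (n := (2 * j + 1).natAbs)
      rw [e]
      linarith
  have hK0 : 0 ≤ ∏ i ∈ J, K i := Finset.prod_nonneg fun i hi => (hK i hi).1
  calc b ^ S.twiceEnergy * ∏ i ∈ J, levelBound (y i) S
      ≤ b ^ S.twiceEnergy * ((∏ i ∈ J, K i) *
          ∏ j ∈ S.finite_pos.toFinset, (2 ^ J.card * Y ^ (2 * j + 1).natAbs)) := by
        refine mul_le_mul_of_nonneg_left (h1.trans (mul_le_mul_of_nonneg_left ?_ hK0))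
          (by positivity)
        refine Finset.prod_le_prod (fun j _ => Finset.prod_nonneg fun i hi => ?_) h2
        have := zpow_pos (show 0 < y i by linarith [hy i hi]) (2 * j + 1)
        positivity
    _ = _ := by
        simp only [Maya.twiceEnergy, Function.comp_apply, ha, ha', pow_add,
          ← Finset.prod_pow_eq_pow_sum, mul_pow, Finset.prod_mul_distrib]
        ring

/-! ### The operators on basis vectors, and Gaussian majorants. -/

lemma vec_apply_self (S : Maya) : vec S S = 1 := by simp [vec]

lemma opT_vec (x : ℂ) (S : Maya) : opT x (vec S) = levelSum x S • vec S := by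
  classical
  ext S'
  have h : opT x (vec S) S' = ∑' j : ℤ, x ^ (2 * j + 1) * psi j (psiStar j (vec S)) S' := by
    simp [opT, vec]
  rw [h, levelSum, Finsupp.smul_apply, smul_eq_mul, ← tsum_mul_right]
  refine tsum_congr fun j => ?_
  rw [psi_psiStar_vec, Set.indicator_apply]
  split_ifs <;> simp

lemma summable_opT_coeff {x : ℂ} (hx : 1 < ‖x‖) (S S' : Maya) :
    Summable fun j : ℤ => x ^ (2 * j + 1) * psi j (psiStar j (vec S)) S' := by
  classical
  refine ((summable_levelSum hx S).mul_right (vec S S')).congr fun j => ?_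
  rw [psi_psiStar_vec, Set.indicator_apply]
  split_ifs <;> simp

lemma diagCoeff_opProd (p : ℂ) {n : ℕ} (x : Fin n → ℂ) (S : Maya) :
    diagCoeff (opProd p x) S = p ^ S.twiceEnergy * ∏ i, levelSum (x i) S := by
  have h : ∀ l : List ℂ, ((l.map fun z => (opT z : Module.End ℂ Wedge)).prod) (vec S) =
      (l.map fun z => levelSum z S).prod • vec S := by
    intro l
    induction l with
    | nil => simp
    | cons z l ih =>
      rw [List.map_cons, List.prod_cons, Module.End.mul_apply, ih, map_smul, opT_vec, smul_smul,
        List.map_cons, List.prod_cons, mul_comm]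
  have hq : qPowH p (vec S) = p ^ S.twiceEnergy • vec S := by
    simp [qPowH, vec]
  have e : (List.ofFn fun i => (opT (x i) : Module.End ℂ Wedge)) =
      (List.ofFn x).map fun z => (opT z : Module.End ℂ Wedge) := by
    rw [List.map_ofFn]
    rfl
  rw [diagCoeff, opProd, Module.End.mul_apply, e, h, map_smul, hq, List.map_ofFn, List.prod_ofFn]
  simp [vec_apply_self, mul_comm]

/-- A polynomial times a geometric sequence is dominated by a Gaussian. -/
lemma summable_gaussian {b : ℝ} (hb0 : 0 < b) (hb1 : b < 1) (m : ℕ) {C : ℝ} (hC : 0 < C) :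
    Summable fun j : ℤ => |(j : ℝ)| ^ m * b ^ (j ^ 2) * C ^ j := by
  have hT : 0 < -Real.log b / Real.pi :=
    div_pos (neg_pos.2 (Real.log_neg hb0 hb1)) Real.pi_pos
  -- With these parameters the exponent in the theta majorant becomes `log b * j ^ 2 + |log C| *
  -- |j|`.
  have h := summable_pow_mul_jacobiTheta₂_term_bound (|Real.log C| / (2 * Real.pi)) hT m
  refine Summable.of_nonneg_of_le (fun j => by positivity) (fun j => ?_) h
  have e1 : b ^ (j ^ 2) = Real.exp (Real.log b * (j : ℝ) ^ 2) := by
    rw [← Real.rpow_intCast, Real.rpow_def_of_pos hb0]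
    push_cast
    rfl
  have e2 : C ^ j = Real.exp (Real.log C * j) := by
    rw [← Real.rpow_intCast, Real.rpow_def_of_pos hC]
  rw [mul_assoc, e1, e2, ← Real.exp_add]
  push_cast
  refine mul_le_mul_of_nonneg_left (Real.exp_le_exp.2 ?_) (by positivity)
  have h1 : Real.log C * j ≤ |Real.log C| * |(j : ℝ)| := by
    rw [← abs_mul]; exact le_abs_self _
  have h2 : -Real.pi * (-Real.log b / Real.pi * (j : ℝ) ^ 2 -
      2 * (|Real.log C| / (2 * Real.pi)) * |(j : ℝ)|) =
      Real.log b * (j : ℝ) ^ 2 + |Real.log C| * |(j : ℝ)| := by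
    field_simp
    ring
  rw [h2]
  linarith

/-! ### Occupation sums and their two expansions. -/

/-- The inner sum `∑_{i ≥ 1} t ^ (λ_i - i + 1/2)`, where `t = x ^ 2`. -/
def rowSum (x : ℂ) (μ : YoungDiagram) : ℂ := ∑' r : ℕ, x ^ twiceCoord μ r

/-- The sum over partitions of the `n`-point function in the variables with index in `J`, without
the normalizing factor. -/
def partitionSum (p : ℂ) {ι : Type*} (x : ι → ℂ) (J : Finset ι) : ℂ :=
  ∑' μ : YoungDiagram, p ^ (2 * μ.card) * ∏ i ∈ J, rowSum (x i) μ

/-- The conditions under which the sum over partitions in the variables with index in `J`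
converges. -/
structure IsConvergent (p : ℂ) {ι : Type*} (x : ι → ℂ) (J : Finset ι) : Prop where
  ne_zero : p ≠ 0
  norm_lt_one : ‖p‖ < 1
  one_lt_norm : ∀ i ∈ J, 1 < ‖x i‖
  norm_prod_lt : ‖p‖ * ∏ i ∈ J, ‖x i‖ < 1

section

variable {ι : Type*} {p : ℂ} {x : ι → ℂ} {J : Finset ι}

lemma IsConvergent.mono (h : IsConvergent p x J) {I : Finset ι} (hI : I ⊆ J) :
    IsConvergent p x I where
  ne_zero := h.ne_zero
  norm_lt_one := h.norm_lt_one
  one_lt_norm := fun i hi => h.one_lt_norm i (hI hi)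
  norm_prod_lt := by
    refine lt_of_le_of_lt (mul_le_mul_of_nonneg_left ?_ (norm_nonneg p)) h.norm_prod_lt
    exact Finset.prod_le_prod_of_subset_of_one_le hI
      (fun i _ => norm_nonneg _) (fun i hi _ => (h.one_lt_norm i hi).le)

lemma IsConvergent.x_ne_zero (h : IsConvergent p x J) {i : ι} (hi : i ∈ J) : x i ≠ 0 := by
  intro h0
  have := h.one_lt_norm i hi
  rw [h0, norm_zero] at this
  linarith

lemma IsConvergent.summable_norm_energy (h : IsConvergent p x J) :
    Summable fun S : Maya => ‖p ^ S.twiceEnergy * ∏ i ∈ J, levelSum (x i) S‖ := by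
  refine Summable.of_nonneg_of_le (fun S => norm_nonneg _) (fun S => ?_)
    (summable_energy_mul_levelBound J (norm_pos_iff.2 h.ne_zero) h.norm_lt_one h.one_lt_norm
      h.norm_prod_lt)
  rw [norm_mul, norm_pow, norm_prod]
  exact mul_le_mul_of_nonneg_left (Finset.prod_le_prod (fun i _ => norm_nonneg _)
    fun i hi => norm_levelSum_le (h.one_lt_norm i hi) S) (by positivity)

lemma pow_twiceEnergy_mayaOf (hp : p ≠ 0) (μ : YoungDiagram) (c : ℤ) :
    p ^ (mayaOf μ c).twiceEnergy = p ^ (c ^ 2) * p ^ (2 * μ.card) := by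
  rw [← zpow_natCast, twiceEnergy_mayaOf, zpow_add₀ hp, mul_comm]
  norm_cast

lemma mayaOf_left_injective (c : ℤ) : Function.Injective fun μ => mayaOf μ c := fun μ ν h => by
  have := mayaOf_injective (a₁ := (μ, c)) (a₂ := (ν, c)) h
  exact congrArg Prod.fst this

/-- Partitions are the diagrams of charge zero, so this is a subseries of the one over all diagrams.
-/
lemma IsConvergent.summable_partition (h : IsConvergent p x J) :
    Summable fun μ : YoungDiagram => p ^ (2 * μ.card) * ∏ i ∈ J, rowSum (x i) μ := by
  refine (h.summable_norm_energy.of_norm.comp_injective (mayaOf_left_injective 0)).congr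
    fun μ => ?_
  rw [Function.comp_apply, pow_twiceEnergy_mayaOf h.ne_zero]
  simp only [zero_pow two_ne_zero, zpow_zero, one_mul]
  congr 1
  refine Finset.prod_congr rfl fun i hi => ?_
  rw [levelSum_mayaOf (h.x_ne_zero hi)]
  simp [rowSum]

/-- The summand of charged sums over Maya diagrams. -/
def shiftedTerm (p : ℂ) (x : ι → ℂ) (J : Finset ι) (a k : ℤ) (S : Maya) : ℂ :=
  p ^ S.twiceEnergy * ∏ i ∈ J, (levelSum (x i) S + a * x i ^ (2 * k + 1))

lemma IsConvergent.summable_shiftedTerm (h : IsConvergent p x J) (a k : ℤ) :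
    Summable (shiftedTerm p x J a k) := by
  classical
  have : shiftedTerm p x J a k = fun S => ∑ I ∈ J.powerset,
      (p ^ S.twiceEnergy * ∏ i ∈ I, levelSum (x i) S) *
        ∏ i ∈ J \ I, ((a : ℂ) * x i ^ (2 * k + 1)) := by
    funext S
    rw [shiftedTerm, Finset.prod_add, Finset.mul_sum]
    exact Finset.sum_congr rfl fun I _ => by ring
  rw [this]
  exact summable_sum fun I hI =>
    ((h.mono (Finset.mem_powerset.1 hI)).summable_norm_energy.of_norm).mul_right _

/-- The product over `J` is multiplied out; `I` is the set of factors from which the shift is taken.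
These are the variables that will be merged with the distinguished one. -/
lemma shiftedTerm_mayaOf [DecidableEq ι] (h : IsConvergent p x J) (a k c : ℤ) (μ : YoungDiagram) :
    shiftedTerm p x J a k (mayaOf μ c) = ∑ I ∈ J.powerset,
      (p ^ (c ^ 2) * ((a : ℂ) ^ I.card * (∏ i ∈ I, x i) ^ (2 * k + 1) *
        (∏ i ∈ J \ I, x i) ^ (2 * c))) *
          (p ^ (2 * μ.card) * ∏ i ∈ J \ I, rowSum (x i) μ) := by
  rw [shiftedTerm, pow_twiceEnergy_mayaOf h.ne_zero]
  have : ∏ i ∈ J, (levelSum (x i) (mayaOf μ c) + a * x i ^ (2 * k + 1)) =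
      ∏ i ∈ J, (a * x i ^ (2 * k + 1) + x i ^ (2 * c) * rowSum (x i) μ) :=
    Finset.prod_congr rfl fun i hi => by
      rw [levelSum_mayaOf (h.x_ne_zero hi), add_comm, rowSum]
  rw [this, Finset.prod_add, Finset.mul_sum]
  refine Finset.sum_congr rfl fun I _ => ?_
  rw [Finset.prod_mul_distrib, Finset.prod_mul_distrib, Finset.prod_const, Finset.prod_zpow,
    Finset.prod_zpow]
  ring

/-- The set of Maya diagrams of charge `c`. -/
def ofCharge (c : ℤ) : Set Maya := {S | S.charge = c}

lemma tsum_indicator_ofCharge {E : Type*} [AddCommMonoid E] [TopologicalSpace E] (c : ℤ)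
    (f : Maya → E) : ∑' S, (ofCharge c).indicator f S = ∑' μ, f (mayaOf μ c) := by
  rw [← (mayaOf_left_injective c).tsum_eq]
  · refine tsum_congr fun μ => ?_
    rw [Set.indicator_of_mem]
    exact charge_mayaOf μ c
  · intro S hS
    have hc : S ∈ ofCharge c := by
      by_contra hc
      exact hS (Set.indicator_of_notMem hc _)
    obtain ⟨⟨μ, d⟩, rfl⟩ := mayaOf_surjective S
    replace hc : (mayaOf μ d).charge = c := hc
    rw [charge_mayaOf] at hc
    exact ⟨μ, by rw [← hc]⟩

lemma tsum_shiftedTerm_ofCharge [DecidableEq ι] (h : IsConvergent p x J) (a k c : ℤ) :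
    ∑' S, (ofCharge c).indicator (shiftedTerm p x J a k) S = ∑ I ∈ J.powerset,
      (p ^ (c ^ 2) * ((a : ℂ) ^ I.card * (∏ i ∈ I, x i) ^ (2 * k + 1) *
        (∏ i ∈ J \ I, x i) ^ (2 * c))) * partitionSum p x (J \ I) := by
  rw [tsum_indicator_ofCharge]
  simp only [shiftedTerm_mayaOf h]
  rw [Summable.tsum_finsetSum]
  · exact Finset.sum_congr rfl fun I _ => by rw [tsum_mul_left]; rfl
  · exact fun I _ => (h.mono Finset.sdiff_subset).summable_partition.mul_left _

/-- The sum of the terms of charge `c` over the Maya diagrams containing `k`. -/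
def occupiedSum (p : ℂ) (x : ι → ℂ) (J : Finset ι) (c a k : ℤ) : ℂ :=
  ∑' S, (ofCharge c ∩ {S | k ∈ S.carrier}).indicator (shiftedTerm p x J a k) S

/-- The point is the factor `‖p‖ ^ (c ^ 2)`, which beats the power of `a` and the exponentials in
`c` when `a = -c`. The condition that `k` is occupied is simply dropped. -/
lemma norm_occupiedSum_le [DecidableEq ι] (h : IsConvergent p x J) (c a k : ℤ) :
    ‖occupiedSum p x J c a k‖ ≤ ∑ I ∈ J.powerset,
      (‖p‖ ^ (c ^ 2) * (|(a : ℝ)| ^ I.card * ‖∏ i ∈ I, x i‖ ^ (2 * k + 1) *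
        ‖∏ i ∈ J \ I, x i‖ ^ (2 * c))) *
          ∑' μ : YoungDiagram, ‖p ^ (2 * μ.card) * ∏ i ∈ J \ I, rowSum (x i) μ‖ := by
  have hs : Summable fun S => ‖shiftedTerm p x J a k S‖ := (h.summable_shiftedTerm a k).norm
  have hs' : ∀ A : Set Maya, Summable fun S => ‖A.indicator (shiftedTerm p x J a k) S‖ :=
    fun A => ((h.summable_shiftedTerm a k).indicator A).norm
  calc ‖occupiedSum p x J c a k‖
      ≤ ∑' S, ‖(ofCharge c ∩ {S | k ∈ S.carrier}).indicator (shiftedTerm p x J a k) S‖ :=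
        norm_tsum_le_tsum_norm (hs' _)
    _ ≤ ∑' S, (ofCharge c).indicator (fun S => ‖shiftedTerm p x J a k S‖) S := by
        refine (hs' _).tsum_le_tsum (fun S => ?_) (hs.indicator _)
        rw [norm_indicator_eq_indicator_norm]
        exact Set.indicator_le_indicator_of_subset Set.inter_subset_left (fun _ => norm_nonneg _) S
    _ = ∑' μ, ‖shiftedTerm p x J a k (mayaOf μ c)‖ := tsum_indicator_ofCharge c _
    _ ≤ ∑' μ : YoungDiagram, ∑ I ∈ J.powerset,
      (‖p‖ ^ (c ^ 2) * (|(a : ℝ)| ^ I.card * ‖∏ i ∈ I, x i‖ ^ (2 * k + 1) *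
        ‖∏ i ∈ J \ I, x i‖ ^ (2 * c))) *
          ‖p ^ (2 * μ.card) * ∏ i ∈ J \ I, rowSum (x i) μ‖ := by
        refine (hs.comp_injective (mayaOf_left_injective c)).tsum_le_tsum (fun μ => ?_)
          (summable_sum fun I _ =>
            (h.mono Finset.sdiff_subset).summable_partition.norm.mul_left _)
        rw [shiftedTerm_mayaOf h]
        refine (norm_sum_le _ _).trans_eq (Finset.sum_congr rfl fun I _ => ?_)
        rw [norm_mul]
        congr 1
        simp only [norm_mul, norm_zpow, norm_pow, Complex.norm_intCast]
    _ = _ := by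
        rw [Summable.tsum_finsetSum]
        · exact Finset.sum_congr rfl fun I _ => by rw [tsum_mul_left]
        · exact fun I _ => (h.mono Finset.sdiff_subset).summable_partition.norm.mul_left _

lemma shiftedTerm_insert (h : IsConvergent p x J) (a k : ℤ) {S : Maya} (hk : k ∉ S.carrier) :
    shiftedTerm p x J a k (S.insert k) =
      p ^ (2 * k + 1) * shiftedTerm p x J (a + 1) k S := by
  have he : p ^ (S.insert k).twiceEnergy = p ^ (2 * k + 1) * p ^ S.twiceEnergy := by
    rw [← zpow_natCast, Maya.twiceEnergy_eq_regSum, Maya.regSum_insert _ hk,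
      ← Maya.twiceEnergy_eq_regSum, zpow_add₀ h.ne_zero, zpow_natCast, mul_comm]
  rw [shiftedTerm, he, shiftedTerm, mul_assoc]
  congr 2
  refine Finset.prod_congr rfl fun i hi => ?_
  rw [levelSum_insert (h.one_lt_norm i hi) hk]
  push_cast
  ring

/-- Removing `k` identifies the diagrams of charge `c` containing `k` with those of charge `c - 1`
not containing `k`, and the latter are all diagrams of that charge minus those containing `k`. The
eigenvalue lost by the removal is recorded by raising `a` to `a + 1`. -/
lemma occupiedSum_eq (h : IsConvergent p x J) (c a k : ℤ) :
    occupiedSum p x J c a k = p ^ (2 * k + 1) *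
      (∑' S, (ofCharge (c - 1)).indicator (shiftedTerm p x J (a + 1) k) S -
        occupiedSum p x J (c - 1) (a + 1) k) := by
  have hs := h.summable_shiftedTerm (a + 1) k
  rw [occupiedSum, occupiedSum, ← (hs.indicator _).tsum_sub (hs.indicator _), ← tsum_mul_left,
    -- After the toggle, the diagrams containing `k` contribute zero on both sides, and the others
    -- are compared through `S.insert k`.
    ← (Maya.toggle k).tsum_eq]
  refine tsum_congr fun S => ?_
  classical
  simp only [Set.indicator_apply, Set.mem_inter_iff, Set.mem_ofPred_eq, ofCharge, Maya.mem_toggle]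
  by_cases hk : k ∈ S.carrier
  · simp [hk]
  · have hc : (S.insert k).charge = S.charge + 1 := Maya.regSum_insert _ hk
    simp only [hk, not_false_eq_true, and_true, and_false, if_false, sub_zero,
      Maya.toggle_of_notMem hk, hc, shiftedTerm_insert h a k hk, ← eq_sub_iff_add_eq]
    split_ifs <;> simp

/-- The alternating terms of the expansion of `occupiedSum`. -/
def expansionTerm [DecidableEq ι] (p : ℂ) (x : ι → ℂ) (J : Finset ι) (k j : ℤ) : ℂ :=
  ∑ I ∈ J.powerset, ((-1) ^ j * p ^ (j * (2 * k + 1)) * p ^ (j ^ 2) * (j : ℂ) ^ I.card *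
    (∏ i ∈ I, x i) ^ (2 * k + 1) * (∏ i ∈ J \ I, x i) ^ (-2 * j)) * partitionSum p x (J \ I)

/-- The sequence whose differences are the terms of the expansion. -/
def telescope (p : ℂ) (x : ι → ℂ) (J : Finset ι) (k j : ℤ) : ℂ :=
  (-1) ^ j * p ^ (j * (2 * k + 1)) * occupiedSum p x J (-j) j k

lemma IsConvergent.summable_telescope (h : IsConvergent p x J) (k : ℤ) :
    Summable (telescope p x J k) := by
  classical
  have hp := norm_pos_iff.2 h.ne_zero
  have hprod : ∀ I ⊆ J, 0 < ‖∏ i ∈ I, x i‖ := fun I hI =>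
    norm_pos_iff.2 (Finset.prod_ne_zero_iff.2 fun i hi => h.x_ne_zero (hI hi))
  refine Summable.of_norm_bounded (g := fun j : ℤ => ∑ I ∈ J.powerset,
    (|(j : ℝ)| ^ I.card * ‖p‖ ^ (j ^ 2) *
      (‖p‖ ^ (2 * k + 1) * ‖∏ i ∈ J \ I, x i‖ ^ (-2 : ℤ)) ^ j) *
      (‖∏ i ∈ I, x i‖ ^ (2 * k + 1) *
        ∑' μ : YoungDiagram, ‖p ^ (2 * μ.card) * ∏ i ∈ J \ I, rowSum (x i) μ‖))
    (summable_sum fun I _ => (summable_gaussian hp h.norm_lt_one I.card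
      (mul_pos (zpow_pos hp _) (zpow_pos (hprod _ Finset.sdiff_subset) _))).mul_right _)
    fun j => ?_
  rw [telescope, norm_mul]
  refine (mul_le_mul_of_nonneg_left (norm_occupiedSum_le h (-j) j k) (norm_nonneg _)).trans_eq ?_
  rw [Finset.mul_sum]
  refine Finset.sum_congr rfl fun I _ => ?_
  rw [norm_mul, norm_zpow, norm_zpow, norm_neg, norm_one, one_zpow, mul_zpow, ← zpow_mul,
    ← zpow_mul, neg_sq, mul_comm j, show 2 * -j = -2 * j by ring]
  ring

/-- One step of `occupiedSum_eq`, from charge `-j` to charge `-(j + 1)`, normalized so that the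
occupied sums of consecutive charges enter with coefficients `1` and `-1`. -/
lemma telescope_sub [DecidableEq ι] (h : IsConvergent p x J) (k j : ℤ) :
    telescope p x J k (j + 1) - telescope p x J k j = expansionTerm p x J k (j + 1) := by
  have e : telescope p x J k j = (-1) ^ j * p ^ (j * (2 * k + 1)) *
      (p ^ (2 * k + 1) * (∑' S, (ofCharge (-(j + 1))).indicator (shiftedTerm p x J (j + 1) k) S -
        occupiedSum p x J (-(j + 1)) (j + 1) k)) := by
    rw [telescope, occupiedSum_eq h, neg_add']
  have e1 : p ^ ((j + 1) * (2 * k + 1)) = p ^ (j * (2 * k + 1)) * p ^ (2 * k + 1) := by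
    rw [← zpow_add₀ h.ne_zero]
    congr 1
    ring
  have e2 : (-1 : ℂ) ^ (j + 1) = -(-1) ^ j := by
    rw [zpow_add₀ (by norm_num)]
    simp
  have e3 : expansionTerm p x J k (j + 1) = (-1) ^ (j + 1) * p ^ ((j + 1) * (2 * k + 1)) *
      ∑' S, (ofCharge (-(j + 1))).indicator (shiftedTerm p x J (j + 1) k) S := by
    rw [tsum_shiftedTerm_ofCharge h, expansionTerm, Finset.mul_sum]
    refine Finset.sum_congr rfl fun I _ => ?_
    rw [neg_sq, show 2 * -(j + 1) = -2 * (j + 1) by ring]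
    ring
  rw [e, e3, telescope, e1, e2]
  ring

/-- The terms are differences of a sequence that is summable over `ℤ`, hence shift invariance makes
the total vanish. For `k = 0` this becomes the cancellation needed in the `q`-difference equation.
-/
lemma tsum_expansionTerm [DecidableEq ι] (h : IsConvergent p x J) (k : ℤ) :
    ∑' j, expansionTerm p x J k j = 0 := by
  have hs := h.summable_telescope k
  have hs' := (Equiv.subRight (1 : ℤ)).summable_iff.2 hs
  have : ∀ j, expansionTerm p x J k j =
      telescope p x J k j - (telescope p x J k ∘ Equiv.subRight (1 : ℤ)) j := fun j => by
    have := telescope_sub h k (j - 1)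
    rw [sub_add_cancel] at this
    exact this.symm
  rw [tsum_congr this, hs.tsum_sub hs']
  simp only [Function.comp_apply]
  rw [(Equiv.subRight (1 : ℤ)).tsum_eq, sub_self]

lemma telescope_zero (k : ℤ) : telescope p x J k 0 = occupiedSum p x J 0 0 k := by
  simp [telescope]

/-- Telescoping towards charge `-∞`; the version below telescopes towards `+∞`. Both are needed,
since each survives summation against `x₀ ^ (2 * k + 1)` only for one sign of the level. -/
lemma occupiedSum_eq_neg_tsum [DecidableEq ι] (h : IsConvergent p x J) (k : ℤ) :
    occupiedSum p x J 0 0 k = -∑' n : ℕ, expansionTerm p x J k (n + 1) := by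
  have hs : Summable fun n : ℕ => telescope p x J k n :=
    (h.summable_telescope k).comp_injective Nat.cast_injective
  have hs' : Summable fun n : ℕ => telescope p x J k ((n : ℤ) + 1) :=
    ((summable_nat_add_iff 1).2 hs).congr fun n => by push_cast; rfl
  simp only [← telescope_sub h]
  rw [hs'.tsum_sub hs, hs.tsum_eq_zero_add]
  push_cast
  rw [telescope_zero]
  ring

lemma occupiedSum_eq_tsum [DecidableEq ι] (h : IsConvergent p x J) (k : ℤ) :
    occupiedSum p x J 0 0 k = ∑' n : ℕ, expansionTerm p x J k (-n) := by
  have hs : Summable fun n : ℕ => telescope p x J k (-n) :=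
    (h.summable_telescope k).comp_injective (neg_injective.comp Nat.cast_injective)
  have hs' : Summable fun n : ℕ => telescope p x J k (-((n + 1 : ℕ) : ℤ)) :=
    (summable_nat_add_iff 1).2 hs
  have e : ∀ n : ℕ, expansionTerm p x J k (-n) =
      telescope p x J k (-n) - telescope p x J k (-((n + 1 : ℕ) : ℤ)) := fun n => by
    have := telescope_sub h k (-n - 1)
    rw [sub_add_cancel] at this
    rw [← this]
    push_cast
    congr 2
    ring
  rw [tsum_congr e, hs.tsum_sub hs', hs.tsum_eq_zero_add]
  simp only [Nat.cast_zero, neg_zero]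
  rw [telescope_zero]
  ring

end

/-! ### Summation over the levels, the kernel, and the recursion. -/

lemma hasSum_nonneg_levels {y : ℂ} (hy : ‖y‖ < 1) :
    HasSum ((Set.Ici (0 : ℤ)).indicator fun k => y ^ (2 * k + 1)) (y / (1 - y ^ 2)) := by
  have hs : HasSum (fun n : ℕ => y * (y ^ 2) ^ n) (y * (1 - y ^ 2)⁻¹) :=
    (hasSum_geometric_of_norm_lt_one (by
      rw [norm_pow]; exact pow_lt_one₀ (norm_nonneg _) hy two_ne_zero)).mul_left y
  rw [← div_eq_mul_inv] at hs
  rw [← (Nat.cast_injective (R := ℤ)).hasSum_iff]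
  · refine hs.congr_fun fun n => ?_
    rw [Function.comp_apply, Set.indicator_of_mem (by simp)]
    rw [show (2 * (n : ℤ) + 1) = ((2 * n + 1 : ℕ) : ℤ) by push_cast; ring, zpow_natCast, pow_succ,
      pow_mul, mul_comm]
  · intro k hk
    refine Set.indicator_of_notMem (fun h0 => hk ?_) _
    exact ⟨k.toNat, Int.toNat_of_nonneg h0⟩

/-- Obtained from the previous series by `k ↦ -1 - k` and `y ↦ y⁻¹`. It is minus the same rational
function, so both expansions lead to one kernel. -/
lemma hasSum_neg_levels {y : ℂ} (hy : 1 < ‖y‖) :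
    HasSum ((Set.Iio (0 : ℤ)).indicator fun k => y ^ (2 * k + 1)) (-(y / (1 - y ^ 2))) := by
  have hy0 : y ≠ 0 := norm_pos_iff.1 (by linarith)
  have h := hasSum_nonneg_levels (y := y⁻¹) (by rw [norm_inv]; exact inv_lt_one_of_one_lt₀ hy)
  rw [← (Equiv.subLeft (-1 : ℤ)).hasSum_iff] at h
  convert h using 1
  · funext k
    simp only [Function.comp_apply, Equiv.subLeft_apply, Set.indicator_apply, Set.mem_Iio,
      Set.mem_Ici, inv_zpow']
    by_cases hk : k < 0
    · rw [if_pos hk, if_pos (by omega)]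
      congr 1
      ring
    · rw [if_neg hk, if_neg (by omega)]
  · have h1 : 1 - y ^ 2 ≠ 0 := by
      intro h0
      have : ‖y‖ ^ 2 = 1 := by rw [← norm_pow, ← sub_eq_zero.1 h0, norm_one]
      nlinarith
    have h2 : 1 - y⁻¹ ^ 2 ≠ 0 := by
      intro h0
      apply h1
      field_simp at h0
      linear_combination -h0
    rw [← neg_div, div_eq_div_iff h1 h2]
    field_simp
    ring

/-- The sign pattern with which the terms of the expansion contribute. -/
def signPattern (k j : ℤ) : ℂ := if 0 ≤ k then (if 1 ≤ j then -1 else 0) else if j ≤ 0 then 1 else 0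

/-- For `j ≥ 1` only nonnegative levels occur and `|σ p ^ j| < 1`; for `j ≤ 0` only negative ones
and `|σ p ^ j| > 1`. This is where `1 < |σ| < |p|⁻¹` enters. -/
lemma hasSum_signPattern {σ p : ℂ} (hσ : 1 < ‖σ‖) (hp1 : ‖p‖ < 1) (hσp : ‖σ * p‖ < 1)
    (hp0 : p ≠ 0) (j : ℤ) :
    HasSum (fun k => signPattern k j * (σ * p ^ j) ^ (2 * k + 1))
      (-(σ * p ^ j / (1 - (σ * p ^ j) ^ 2))) := by
  have hp := norm_pos_iff.2 hp0
  by_cases hj : 1 ≤ j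
  · have hy : ‖σ * p ^ j‖ < 1 := by
      refine lt_of_le_of_lt ?_ hσp
      rw [norm_mul, norm_mul, norm_zpow]
      refine mul_le_mul_of_nonneg_left ?_ (norm_nonneg _)
      simpa using zpow_le_zpow_right_of_le_one₀ hp hp1.le hj
    refine (hasSum_nonneg_levels hy).neg.congr_fun fun k => ?_
    simp only [signPattern, Set.indicator_apply, Set.mem_Ici, hj, if_true,
      if_neg (show ¬ j ≤ 0 by omega)]
    split_ifs <;> simp
  · have hy : 1 < ‖σ * p ^ j‖ := by
      refine lt_of_lt_of_le hσ ?_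
      rw [norm_mul, norm_zpow]
      refine le_mul_of_one_le_right (norm_nonneg _) ?_
      simpa using zpow_le_zpow_right_of_le_one₀ hp hp1.le (show j ≤ 0 by omega)
    refine (hasSum_neg_levels hy).congr_fun fun k => ?_
    simp only [signPattern, Set.indicator_apply, Set.mem_Iio, hj, if_false,
      if_pos (show j ≤ 0 by omega)]
    by_cases hk : 0 ≤ k
    · simp [hk]
    · simp [hk, not_le.1 hk]

lemma summable_gaussian_complex {p : ℂ} (hp0 : p ≠ 0) (hp1 : ‖p‖ < 1) (m : ℕ) {C : ℂ}
    (hC : C ≠ 0) : Summable fun j : ℤ => ‖(-1) ^ j * (j : ℂ) ^ m * p ^ (j ^ 2) * C ^ j‖ := by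
  refine (summable_gaussian (norm_pos_iff.2 hp0) hp1 m (norm_pos_iff.2 hC)).congr fun j => ?_
  simp [norm_zpow, norm_pow]

/-- The bound is independent of `j` and summable in `k`, which justifies interchanging the two
summations. -/
lemma norm_signPattern_le {p σ : ℂ} (hσ : 1 < ‖σ‖) (hp1 : ‖p‖ < 1) (hp0 : p ≠ 0) (k j : ℤ) :
    ‖signPattern k j * (σ * p ^ j) ^ (2 * k + 1)‖ ≤
      ‖(Set.Ici (0 : ℤ)).indicator (fun k => (σ * p) ^ (2 * k + 1)) k‖ +
        ‖(Set.Iio (0 : ℤ)).indicator (fun k => σ ^ (2 * k + 1)) k‖ := by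
  have hp := norm_pos_iff.2 hp0
  have hσ0 : 0 < ‖σ‖ := by linarith
  unfold signPattern
  by_cases hk : 0 ≤ k
  · rw [if_pos hk, Set.indicator_of_mem (by exact hk), Set.indicator_of_notMem (by simp [hk]),
      norm_zero, add_zero]
    split_ifs with hj
    · rw [neg_one_mul, norm_neg, norm_zpow, norm_zpow]
      refine zpow_le_zpow_left₀ (by omega) (norm_nonneg _) ?_
      rw [norm_mul, norm_mul, norm_zpow]
      refine mul_le_mul_of_nonneg_left ?_ (norm_nonneg _)
      simpa using zpow_le_zpow_right_of_le_one₀ hp hp1.le hj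
    · rw [zero_mul, norm_zero]
      positivity
  · rw [if_neg hk, Set.indicator_of_notMem (by simpa using hk),
      Set.indicator_of_mem (by simpa using hk), norm_zero, zero_add]
    split_ifs with hj
    · rw [one_mul, norm_zpow, norm_zpow, show 2 * k + 1 = -(-2 * k - 1) by ring, zpow_neg,
        zpow_neg]
      refine inv_anti₀ (zpow_pos hσ0 _) (zpow_le_zpow_left₀ (by omega) (norm_nonneg _) ?_)
      rw [norm_mul, norm_zpow]
      refine le_mul_of_one_le_right (norm_nonneg _) ?_
      simpa using zpow_le_zpow_right_of_le_one₀ hp hp1.le hj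
    · rw [zero_mul, norm_zero]
      positivity

lemma summable_signPattern {p σ : ℂ} (hσ : 1 < ‖σ‖) (hp1 : ‖p‖ < 1) (hσp : ‖σ * p‖ < 1)
    (hp0 : p ≠ 0) {v : ℤ → ℂ} (hv : Summable fun j => ‖v j‖) :
    Summable fun a : ℤ × ℤ => v a.2 * (signPattern a.1 a.2 * (σ * p ^ a.2) ^ (2 * a.1 + 1)) := by
  have h1 : Summable fun k : ℤ => ‖(Set.Ici (0 : ℤ)).indicator
      (fun k => (σ * p) ^ (2 * k + 1)) k‖ := (hasSum_nonneg_levels hσp).summable.norm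
  have h2 : Summable fun k : ℤ => ‖(Set.Iio (0 : ℤ)).indicator (fun k => σ ^ (2 * k + 1)) k‖ :=
    (hasSum_neg_levels hσ).summable.norm
  refine Summable.of_norm_bounded ((h1.add h2).mul_of_nonneg hv
    (fun k => add_nonneg (norm_nonneg _) (norm_nonneg _)) (fun j => norm_nonneg _)) fun a => ?_
  rw [norm_mul, mul_comm]
  exact mul_le_mul_of_nonneg_right (norm_signPattern_le hσ hp1 hp0 a.1 a.2) (norm_nonneg _)

lemma tsum_signPattern {p σ : ℂ} (hσ : 1 < ‖σ‖) (hp1 : ‖p‖ < 1) (hσp : ‖σ * p‖ < 1)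
    (hp0 : p ≠ 0) {v : ℤ → ℂ} (hv : Summable fun j => ‖v j‖) :
    ∑' a : ℤ × ℤ, v a.2 * (signPattern a.1 a.2 * (σ * p ^ a.2) ^ (2 * a.1 + 1)) =
      ∑' j, v j * -(σ * p ^ j / (1 - (σ * p ^ j) ^ 2)) := by
  have hs := summable_signPattern hσ hp1 hσp hp0 hv
  rw [hs.tsum_prod, ← Summable.tsum_comm (f := fun (k j : ℤ) =>
    v j * (signPattern k j * (σ * p ^ j) ^ (2 * k + 1))) hs]
  refine tsum_congr fun j => ?_
  rw [tsum_mul_left, (hasSum_signPattern hσ hp1 hσp hp0 j).tsum_eq]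

/-- The coefficients of the kernel. -/
def kernelCoeff (p : ℂ) (m : ℕ) (ρ : ℂ) (j : ℤ) : ℂ :=
  (-1) ^ j * (j : ℂ) ^ m * p ^ (j ^ 2) * ρ ^ (-2 * j)

/-- The kernel of the recursion for the `n`-point function: a function of the merged variable
`σ ^ 2` and of the product `ρ ^ 2` of the remaining variables. -/
def kernel (p : ℂ) (m : ℕ) (σ ρ : ℂ) : ℂ :=
  ∑' j : ℤ, kernelCoeff p m ρ j * -(σ * p ^ j / (1 - (σ * p ^ j) ^ 2))

lemma summable_kernelCoeff {p ρ : ℂ} (hp0 : p ≠ 0) (hp1 : ‖p‖ < 1) (m : ℕ) (hρ : ρ ≠ 0) :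
    Summable fun j => ‖kernelCoeff p m ρ j‖ := by
  refine (summable_gaussian_complex hp0 hp1 m (C := ρ ^ (-2 : ℤ)) (zpow_ne_zero _ hρ)).congr
    fun j => ?_
  rw [← zpow_mul, kernelCoeff]

section

variable {ι : Type*} [DecidableEq ι] {p : ℂ} {x : ι → ℂ} {J : Finset ι}

lemma occupiedSum_eq_signPattern (h : IsConvergent p x J) (k : ℤ) :
    occupiedSum p x J 0 0 k = ∑' j : ℤ, signPattern k j * expansionTerm p x J k j := by
  by_cases hk : 0 ≤ k
  · rw [occupiedSum_eq_neg_tsum h, ← tsum_neg]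
    have hinj : Function.Injective fun n : ℕ => (n : ℤ) + 1 := fun a b hab => by simpa using hab
    rw [← hinj.tsum_eq]
    · refine tsum_congr fun n => ?_
      rw [signPattern, if_pos hk, if_pos (by omega)]
      ring
    · intro j hj
      by_cases hj1 : 1 ≤ j
      · exact ⟨(j - 1).toNat, by dsimp only; omega⟩
      · exact absurd (by simp [signPattern, hk, hj1]) hj
  · rw [occupiedSum_eq_tsum h]
    have hinj : Function.Injective fun n : ℕ => -(n : ℤ) := fun a b hab => by simpa using hab
    rw [← hinj.tsum_eq]
    · refine tsum_congr fun n => ?_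
      rw [signPattern, if_neg hk, if_pos (by omega)]
      ring
    · intro j hj
      by_cases hj1 : j ≤ 0
      · exact ⟨(-j).toNat, by dsimp only; omega⟩
      · exact absurd (by simp [signPattern, hk, hj1]) hj

lemma prod_insertNone_elim {M : Type*} [CommMonoid M] (J : Finset ι) (f : Option ι → M) :
    ∏ i ∈ Finset.insertNone J, f i = f none * ∏ i ∈ J, f (some i) := by
  simp [Finset.insertNone]

/-- The sum over partitions with a distinguished variable, in terms of occupation sums. -/
lemma partitionSum_eq_tsum_occupiedSum (h : IsConvergent p x J) {x₀ : ℂ} (hx₀ : 1 < ‖x₀‖)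
    (hpx : ‖p‖ * (‖x₀‖ * ∏ i ∈ J, ‖x i‖) < 1) :
    ∑' μ : YoungDiagram, p ^ (2 * μ.card) * (rowSum x₀ μ * ∏ i ∈ J, rowSum (x i) μ) =
      ∑' k : ℤ, x₀ ^ (2 * k + 1) * occupiedSum p x J 0 0 k := by
  set W : Maya → ℂ := (ofCharge 0).indicator (shiftedTerm p x J 0 0) with hW
  -- With shift coefficient `0` the summand no longer involves `k`.
  have hWk : ∀ k, (ofCharge 0).indicator (shiftedTerm p x J 0 k) = W := fun k => by
    have : shiftedTerm p x J 0 k = shiftedTerm p x J 0 0 := by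
      funext S
      simp [shiftedTerm]
    rw [this]
  have hx0 : x₀ ≠ 0 := norm_pos_iff.1 (by linarith)
  have hlhs : ∑' μ : YoungDiagram, p ^ (2 * μ.card) * (rowSum x₀ μ * ∏ i ∈ J, rowSum (x i) μ) =
      ∑' S : Maya, W S * levelSum x₀ S := by
    have e : ∀ S, W S * levelSum x₀ S =
        (ofCharge 0).indicator (fun S => shiftedTerm p x J 0 0 S * levelSum x₀ S) S := fun S => by
      classical
      rw [hW, Set.indicator_apply, Set.indicator_apply]
      split_ifs <;> simp
    rw [tsum_congr e, tsum_indicator_ofCharge]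
    refine tsum_congr fun μ => ?_
    rw [shiftedTerm, pow_twiceEnergy_mayaOf h.ne_zero, levelSum_mayaOf hx0, ← rowSum]
    have : ∏ i ∈ J, (levelSum (x i) (mayaOf μ 0) + (0 : ℤ) * x i ^ (2 * (0 : ℤ) + 1)) =
        ∏ i ∈ J, rowSum (x i) μ := Finset.prod_congr rfl fun i hi => by
      rw [levelSum_mayaOf (h.x_ne_zero hi)]
      simp [rowSum]
    rw [this]
    simp
    ring
  have hrhs : ∀ k : ℤ, x₀ ^ (2 * k + 1) * occupiedSum p x J 0 0 k =
      ∑' S : Maya, W S * S.carrier.indicator (fun j => x₀ ^ (2 * j + 1)) k := fun k => by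
    rw [occupiedSum, ← tsum_mul_left]
    refine tsum_congr fun S => ?_
    rw [Set.inter_comm, ← Set.indicator_indicator, hWk]
    classical
    simp only [Set.indicator_apply, Set.mem_ofPred_eq]
    split_ifs <;> ring
  have hs : Summable fun a : Maya × ℤ =>
      W a.1 * a.1.carrier.indicator (fun j => x₀ ^ (2 * j + 1)) a.2 := by
    refine Summable.of_norm ?_
    rw [summable_prod_of_nonneg (fun _ => norm_nonneg _)]
    have hS : ∀ S : Maya, Summable fun k =>
        ‖W S * S.carrier.indicator (fun j => x₀ ^ (2 * j + 1)) k‖ := fun S => by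
      exact ((summable_levelSum hx₀ S).mul_left _).norm
    refine ⟨hS, ?_⟩
    -- The general convergence statement is applied to the variables of `J` together with `x₀`,
    -- placed at the index `none`.
    have hb := summable_energy_mul_levelBound (Finset.insertNone J) (norm_pos_iff.2 h.ne_zero)
      h.norm_lt_one (y := fun o => o.elim ‖x₀‖ fun i => ‖x i‖) (by
        intro i hi
        cases i with
        | none => exact hx₀
        | some i => exact h.one_lt_norm i (by simpa using hi))
      (by rw [prod_insertNone_elim]; exact hpx)
    refine Summable.of_nonneg_of_le (fun S => tsum_nonneg fun _ => norm_nonneg _) (fun S => ?_) hb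
    dsimp only
    simp only [norm_mul, norm_indicator_level]
    rw [tsum_mul_left, prod_insertNone_elim]
    change ‖W S‖ * levelBound ‖x₀‖ S ≤
      ‖p‖ ^ S.twiceEnergy * (levelBound ‖x₀‖ S * ∏ i ∈ J, levelBound ‖x i‖ S)
    have h1 : ‖W S‖ ≤ ‖p‖ ^ S.twiceEnergy * ∏ i ∈ J, levelBound ‖x i‖ S := by
      refine (norm_indicator_le_norm_self _ _).trans ?_
      rw [shiftedTerm, norm_mul, norm_pow, norm_prod]
      refine mul_le_mul_of_nonneg_left (Finset.prod_le_prod (fun i _ => norm_nonneg _)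
        fun i hi => ?_) (by positivity)
      simpa using norm_levelSum_le (h.one_lt_norm i hi) S
    have h2 := levelBound_nonneg hx₀ S
    calc _ ≤ _ := mul_le_mul_of_nonneg_right h1 h2
      _ = _ := by ring
  rw [hlhs, tsum_congr hrhs, Summable.tsum_comm (f := fun (S : Maya) (k : ℤ) =>
    W S * S.carrier.indicator (fun j => x₀ ^ (2 * j + 1)) k) hs]
  exact tsum_congr fun S => by rw [tsum_mul_left]; rfl

/-- The recursion for the sums over partitions. -/
theorem partitionSum_recursion (h : IsConvergent p x J) {x₀ : ℂ} (hx₀ : 1 < ‖x₀‖)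
    (hpx : ‖p‖ * (‖x₀‖ * ∏ i ∈ J, ‖x i‖) < 1) :
    ∑' μ : YoungDiagram, p ^ (2 * μ.card) * (rowSum x₀ μ * ∏ i ∈ J, rowSum (x i) μ) =
      ∑ I ∈ J.powerset, kernel p I.card (x₀ * ∏ i ∈ I, x i) (∏ i ∈ J \ I, x i) *
        partitionSum p x (J \ I) := by
  have hp := norm_pos_iff.2 h.ne_zero
  have hx0 : x₀ ≠ 0 := norm_pos_iff.1 (by linarith)
  have hprod : ∀ I ⊆ J, 1 ≤ ∏ i ∈ I, ‖x i‖ := fun I hI => by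
    rw [← Finset.prod_const_one (s := I)]
    exact Finset.prod_le_prod (fun _ _ => zero_le_one) fun i hi => (h.one_lt_norm i (hI hi)).le
  have hσ : ∀ I ∈ J.powerset, 1 < ‖x₀ * ∏ i ∈ I, x i‖ := fun I hI => by
    rw [norm_mul, norm_prod]
    exact lt_of_lt_of_le hx₀
      (le_mul_of_one_le_right (norm_nonneg _) (hprod I (Finset.mem_powerset.1 hI)))
  have hσp : ∀ I ∈ J.powerset, ‖x₀ * (∏ i ∈ I, x i) * p‖ < 1 := fun I hI => by
    rw [norm_mul, norm_mul, norm_prod, mul_comm]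
    refine lt_of_le_of_lt ?_ hpx
    refine mul_le_mul_of_nonneg_left (mul_le_mul_of_nonneg_left ?_ (norm_nonneg _)) hp.le
    exact Finset.prod_le_prod_of_subset_of_one_le (Finset.mem_powerset.1 hI)
      (fun i _ => norm_nonneg _) (fun i hi _ => (h.one_lt_norm i hi).le)
  have hv : ∀ I ∈ J.powerset, Summable fun j => ‖kernelCoeff p I.card (∏ i ∈ J \ I, x i) j‖ :=
    fun I _ => summable_kernelCoeff h.ne_zero h.norm_lt_one _
      (Finset.prod_ne_zero_iff.2 fun i hi => h.x_ne_zero (Finset.sdiff_subset hi))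
  have hs : ∀ I ∈ J.powerset, Summable fun a : ℤ × ℤ =>
      kernelCoeff p I.card (∏ i ∈ J \ I, x i) a.2 * (signPattern a.1 a.2 *
        (x₀ * (∏ i ∈ I, x i) * p ^ a.2) ^ (2 * a.1 + 1)) * partitionSum p x (J \ I) :=
    fun I hI => (summable_signPattern (hσ I hI) h.norm_lt_one (hσp I hI) h.ne_zero
      (hv I hI)).mul_right _
  -- All powers with exponent proportional to `2 * k + 1` combine to a power of `x₀ * (∏ i ∈ I, x i)
  -- * p ^ j`: the variables in `I` merge with `x₀`.
  have e : ∀ k j : ℤ, x₀ ^ (2 * k + 1) * (signPattern k j * expansionTerm p x J k j) =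
      ∑ I ∈ J.powerset, kernelCoeff p I.card (∏ i ∈ J \ I, x i) j * (signPattern k j *
        (x₀ * (∏ i ∈ I, x i) * p ^ j) ^ (2 * k + 1)) * partitionSum p x (J \ I) := by
    intro k j
    rw [expansionTerm, Finset.mul_sum, Finset.mul_sum]
    refine Finset.sum_congr rfl fun I _ => ?_
    rw [mul_zpow, mul_zpow, ← zpow_mul, kernelCoeff]
    ring
  have hk : ∀ k, x₀ ^ (2 * k + 1) * occupiedSum p x J 0 0 k =
      ∑' j : ℤ, ∑ I ∈ J.powerset, kernelCoeff p I.card (∏ i ∈ J \ I, x i) j * (signPattern k j *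
        (x₀ * (∏ i ∈ I, x i) * p ^ j) ^ (2 * k + 1)) * partitionSum p x (J \ I) := fun k => by
    rw [occupiedSum_eq_signPattern h, ← tsum_mul_left]
    exact tsum_congr (e k)
  rw [partitionSum_eq_tsum_occupiedSum h hx₀ hpx, tsum_congr hk,
    ← (summable_sum hs).tsum_prod, Summable.tsum_finsetSum hs]
  refine Finset.sum_congr rfl fun I hI => ?_
  rw [tsum_mul_right, tsum_signPattern (hσ I hI) h.norm_lt_one (hσp I hI) h.ne_zero (hv I hI),
    kernel]

end

/-! ### Analyticity and poles of the kernel. -/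

/-- A sum of products of functions of two separate variables is jointly analytic. -/
lemma analyticAt_tsum_mul {a b : ℤ → ℂ → ℂ} {U V : Set ℂ} (hU : IsOpen U) (hV : IsOpen V)
    {u w : ℤ → ℝ} (hu : Summable u) (hw : Summable w)
    (ha : ∀ j, DifferentiableOn ℂ (a j) U) (hb : ∀ j, DifferentiableOn ℂ (b j) V)
    (hau : ∀ j, ∀ s ∈ U, ‖a j s‖ ≤ u j) (hbw : ∀ j, ∀ r ∈ V, ‖b j r‖ ≤ w j)
    {s₀ r₀ : ℂ} (hs₀ : s₀ ∈ U) (hr₀ : r₀ ∈ V) :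
    AnalyticAt ℂ (fun z : ℂ × ℂ => ∑' j, a j z.1 * b j z.2) (s₀, r₀) := by
  -- The sum is the pairing of a one-variable analytic function with values in the dual of `ℓ¹` and
  -- one with values in `ℓ¹`; joint analyticity follows because the pairing is bilinear and
  -- continuous.
  let E := lp (fun _ : ℤ => ℂ) 1
  let e : ℤ → E := fun j => lp.single 1 j 1
  let ev : ℤ → (E →L[ℂ] ℂ) := fun j => lp.evalCLM ℂ (fun _ : ℤ => ℂ) 1 j
  have hev' : ∀ i (f : E), ev i f = f i := fun _ _ => rfl
  have he : ∀ j, ‖e j‖ = 1 := fun j => by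
    simp [e, lp.norm_single (E := fun _ : ℤ => ℂ) (p := 1) (by simp)]
  have hev : ∀ j, ‖ev j‖ ≤ 1 := fun j => by
    refine ContinuousLinearMap.opNorm_le_bound _ zero_le_one fun f => ?_
    rw [one_mul]
    exact lp.norm_apply_le_norm (by simp) f j
  have hA' : ∀ j, ∀ s ∈ U, ‖a j s • ev j‖ ≤ u j := fun j s hs => by
    rw [norm_smul]
    exact (mul_le_of_le_one_right (norm_nonneg _) (hev j)).trans (hau j s hs)
  have hB' : ∀ j, ∀ r ∈ V, ‖b j r • e j‖ ≤ w j := fun j r hr => by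
    rw [norm_smul, he, mul_one]
    exact hbw j r hr
  have hA : AnalyticAt ℂ (fun s => ∑' j, a j s • ev j) s₀ :=
    (Complex.differentiableOn_tsum_of_summable_norm hu
      (fun j => (ha j).smul_const (ev j)) hU hA').analyticAt (hU.mem_nhds hs₀)
  have hB : AnalyticAt ℂ (fun r => ∑' j, b j r • e j) r₀ :=
    (Complex.differentiableOn_tsum_of_summable_norm hw
      (fun j => (hb j).smul_const (e j)) hV hB').analyticAt (hV.mem_nhds hr₀)
  have hA2 : AnalyticAt ℂ (fun z : ℂ × ℂ => ∑' j, a j z.1 • ev j) (s₀, r₀) :=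
    hA.comp_of_eq analyticAt_fst rfl
  have hB2 : AnalyticAt ℂ (fun z : ℂ × ℂ => ∑' j, b j z.2 • e j) (s₀, r₀) :=
    hB.comp_of_eq analyticAt_snd rfl
  have hAB := ((ContinuousLinearMap.id ℂ (E →L[ℂ] ℂ)).analyticAt_bilinear
    (∑' j, a j s₀ • ev j, ∑' j, b j r₀ • e j)).comp_of_eq (hA2.prod hB2) rfl
  refine hAB.congr ?_
  filter_upwards [prod_mem_nhds (hU.mem_nhds hs₀) (hV.mem_nhds hr₀)] with z hz
  have hsA : Summable fun j => a j z.1 • ev j :=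
    Summable.of_norm_bounded hu fun j => hA' j _ hz.1
  have hsB : Summable fun j => b j z.2 • e j :=
    Summable.of_norm_bounded hw fun j => hB' j _ hz.2
  have hcoord : ∀ i, ev i (∑' j, b j z.2 • e j) = b i z.2 := fun i => by
    rw [(ev i).map_tsum hsB, tsum_eq_single i]
    · rw [map_smul, hev', lp.single_apply_self, smul_eq_mul, mul_one]
    · intro j hj
      rw [map_smul, hev', lp.single_apply_ne _ _ _ hj.symm, smul_zero]
  change ContinuousLinearMap.apply ℂ ℂ (∑' j, b j z.2 • e j) (∑' j, a j z.1 • ev j) = _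
  rw [ContinuousLinearMap.map_tsum _ hsA]
  refine tsum_congr fun j => ?_
  rw [ContinuousLinearMap.apply_apply, smul_apply, hcoord, smul_eq_mul]

/-- A neighbourhood of the nonzero point `z` that is bounded and bounded away from `0`. -/
def annulusAt (z : ℂ) : Set ℂ := {w | w ≠ 0 ∧ ‖w‖ < ‖z‖ + ‖z⁻¹‖ + 1 ∧ ‖w⁻¹‖ < ‖z‖ + ‖z⁻¹‖ + 1}

lemma isOpen_annulusAt (z : ℂ) : IsOpen (annulusAt z) := by
  have h : annulusAt z = {w | w ≠ 0} ∩ {w | ‖w‖ < ‖z‖ + ‖z⁻¹‖ + 1} ∩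
      {w | 1 < (‖z‖ + ‖z⁻¹‖ + 1) * ‖w‖} := by
    ext w
    simp only [annulusAt, Set.mem_ofPred_eq, Set.mem_inter_iff, and_assoc]
    refine and_congr_right fun hw => and_congr_right fun _ => ?_
    rw [norm_inv, inv_lt_iff_one_lt_mul₀ (norm_pos_iff.2 hw)]
  rw [h]
  refine (isOpen_ne.inter (isOpen_lt continuous_norm continuous_const)).inter
    (isOpen_lt continuous_const (continuous_const.mul continuous_norm))

lemma mem_annulusAt {z : ℂ} (hz : z ≠ 0) : z ∈ annulusAt z := by
  have := norm_nonneg z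
  have := norm_nonneg z⁻¹
  exact ⟨hz, by linarith, by linarith⟩

lemma norm_zpow_le_pow_natAbs {w : ℂ} {R : ℝ} (h1 : ‖w‖ ≤ R) (h2 : ‖w⁻¹‖ ≤ R) (n : ℤ) :
    ‖w ^ n‖ ≤ R ^ n.natAbs := by
  obtain ⟨k, rfl | rfl⟩ := n.eq_nat_or_neg
  · rw [zpow_natCast, norm_pow, Int.natAbs_natCast]
    exact pow_le_pow_left₀ (norm_nonneg _) h1 k
  · rw [zpow_neg, zpow_natCast, ← inv_pow, norm_pow, Int.natAbs_neg, Int.natAbs_natCast]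
    exact pow_le_pow_left₀ (norm_nonneg _) h2 k

lemma summable_gaussian_natAbs {b : ℝ} (hb0 : 0 < b) (hb1 : b < 1) (m : ℕ) {C : ℝ} (hC : 0 < C) :
    Summable fun j : ℤ => |(j : ℝ)| ^ m * b ^ (j ^ 2) * C ^ j.natAbs := by
  refine Summable.of_nonneg_of_le (fun j => by positivity) (fun j => ?_)
    ((summable_gaussian hb0 hb1 m hC).add (summable_gaussian hb0 hb1 m (inv_pos.2 hC)))
  rw [← mul_add]
  refine mul_le_mul_of_nonneg_left ?_ (by positivity)
  have h1 := zpow_pos hC j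
  have h2 := zpow_pos (inv_pos.2 hC) j
  rcases le_total 0 j with h | h
  · have : C ^ j.natAbs = C ^ j := by rw [← zpow_natCast, Int.natAbs_of_nonneg h]
    linarith
  · have : C ^ j.natAbs = C⁻¹ ^ j := by
      rw [← zpow_natCast, Int.ofNat_natAbs_of_nonpos h, inv_zpow']
    linarith

lemma summable_inv_two_pow_natAbs : Summable fun j : ℤ => ((2 : ℝ) ^ j.natAbs)⁻¹ := by
  have hs : Summable fun n : ℕ => ((2 : ℝ)⁻¹) ^ n :=
    summable_geometric_of_lt_one (by norm_num) (by norm_num)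
  refine Summable.of_nat_of_neg (hs.congr fun n => ?_) (hs.congr fun n => ?_) <;> simp

lemma norm_div_one_sub_sq_le {y : ℂ} (hy : ‖y‖ ≤ 1 / 2) :
    1 - y ^ 2 ≠ 0 ∧ ‖y / (1 - y ^ 2)‖ ≤ 1 := by
  have h1 : ‖y ^ 2‖ ≤ 1 / 4 := by
    rw [norm_pow]
    nlinarith [norm_nonneg y]
  have h2 : 3 / 4 ≤ ‖1 - y ^ 2‖ := by
    have := norm_sub_norm_le (1 : ℂ) (y ^ 2)
    rw [norm_one] at this
    linarith
  refine ⟨fun h => ?_, ?_⟩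
  · rw [h, norm_zero] at h2
    linarith
  · rw [norm_div, div_le_one (by linarith)]
    linarith

lemma norm_div_one_sub_sq_le_of_inv {y : ℂ} (hy0 : y ≠ 0) (hy : ‖y⁻¹‖ ≤ 1 / 2) :
    1 - y ^ 2 ≠ 0 ∧ ‖y / (1 - y ^ 2)‖ ≤ 1 := by
  obtain ⟨h1, h2⟩ := norm_div_one_sub_sq_le hy
  have h3 : 1 - y ^ 2 ≠ 0 := by
    intro h
    apply h1
    field_simp
    linear_combination -h
  refine ⟨h3, ?_⟩
  have : y / (1 - y ^ 2) = -(y⁻¹ / (1 - y⁻¹ ^ 2)) := by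
    rw [← neg_div, div_eq_div_iff h3 h1]
    field_simp
    ring
  rwa [this, norm_neg]

/-- Outside a finite set of indices, the fractions occurring in the kernel are locally bounded. -/
lemma exists_finset_fraction_bound {p : ℂ} (hp0 : p ≠ 0) (hp1 : ‖p‖ < 1) (σ₀ : ℂ) :
    ∃ P : Finset ℤ, ∀ j ∉ P, ∀ σ ∈ annulusAt σ₀,
      1 - (σ * p ^ j) ^ 2 ≠ 0 ∧ ‖-(σ * p ^ j / (1 - (σ * p ^ j) ^ 2))‖ ≤ 1 := by
  have hp := norm_pos_iff.2 hp0
  set R := ‖σ₀‖ + ‖σ₀⁻¹‖ + 1 with hR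
  have hR0 : 0 < R := by positivity
  obtain ⟨N, hN⟩ : ∃ N : ℕ, R * ‖p‖ ^ N ≤ 1 / 2 := by
    obtain ⟨N, hN⟩ := exists_pow_lt_of_lt_one (show 0 < 1 / 2 / R by positivity) hp1
    refine ⟨N, ?_⟩
    rw [lt_div_iff₀ hR0] at hN
    linarith
  -- For `j > N` the number `σ * p ^ j` has norm at most `1 / 2`, and for `j < -N` its inverse has;
  -- `y / (1 - y ^ 2)` is odd under `y ↦ y⁻¹`.
  refine ⟨Finset.Icc (-(N : ℤ)) N, fun j hj σ hσ => ?_⟩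
  rw [norm_neg]
  simp only [Finset.mem_Icc, not_and_or, not_le] at hj
  rcases hj with hj | hj
  · refine norm_div_one_sub_sq_le_of_inv (mul_ne_zero hσ.1 (zpow_ne_zero _ hp0)) ?_
    refine le_trans ?_ hN
    rw [mul_inv, norm_mul, ← zpow_neg, norm_zpow]
    refine mul_le_mul hσ.2.2.le ?_ (by positivity) hR0.le
    simpa using zpow_le_zpow_right_of_le_one₀ hp hp1.le (show (N : ℤ) ≤ -j by omega)
  · refine norm_div_one_sub_sq_le ?_
    refine le_trans ?_ hN
    rw [norm_mul, norm_zpow]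
    refine mul_le_mul hσ.2.1.le ?_ (by positivity) hR0.le
    simpa using zpow_le_zpow_right_of_le_one₀ hp hp1.le (show (N : ℤ) ≤ j by omega)

/-- Away from the poles at finitely many indices, the kernel is analytic. -/
lemma exists_kernel_eq {p : ℂ} (hp0 : p ≠ 0) (hp1 : ‖p‖ < 1) (m : ℕ) {σ₀ ρ₀ : ℂ} (hσ₀ : σ₀ ≠ 0)
    (hρ₀ : ρ₀ ≠ 0) : ∃ (P : Finset ℤ) (T : ℂ × ℂ → ℂ), AnalyticAt ℂ T (σ₀, ρ₀) ∧
      ∀ᶠ z in 𝓝 (σ₀, ρ₀), kernel p m z.1 z.2 =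
        ∑ j ∈ P, kernelCoeff p m z.2 j * -(z.1 * p ^ j / (1 - (z.1 * p ^ j) ^ 2)) + T z := by
  have hp := norm_pos_iff.2 hp0
  set R' := ‖ρ₀‖ + ‖ρ₀⁻¹‖ + 1 with hR'
  have hR'0 : 0 < R' := by positivity
  obtain ⟨P, hbound⟩ := exists_finset_fraction_bound hp0 hp1 σ₀
  set f : ℂ → ℤ → ℂ := fun σ j => -(σ * p ^ j / (1 - (σ * p ^ j) ^ 2)) with hf
  -- The fractions are bounded but not summable in `j`, so a factor `2 ^ |j|` is moved to the
  -- coefficients, whose Gaussian decay absorbs it.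
  set a : ℤ → ℂ → ℂ := fun j σ => if j ∈ P then 0 else f σ j * ((2 : ℂ) ^ j.natAbs)⁻¹ with ha
  set b : ℤ → ℂ → ℂ := fun j ρ => kernelCoeff p m ρ j * 2 ^ j.natAbs with hb
  set u : ℤ → ℝ := fun j => ((2 : ℝ) ^ j.natAbs)⁻¹ with hu
  set w : ℤ → ℝ := fun j => |(j : ℝ)| ^ m * ‖p‖ ^ (j ^ 2) * (R' ^ 2 * 2) ^ j.natAbs with hw
  have hau : ∀ j, ∀ s ∈ annulusAt σ₀, ‖a j s‖ ≤ u j := by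
    intro j s hs
    rw [ha, hu]
    dsimp only
    split_ifs with hj
    · rw [norm_zero]
      positivity
    · rw [norm_mul, norm_inv, norm_pow, Complex.norm_ofNat]
      exact mul_le_of_le_one_left (by positivity) (hbound j hj s hs).2
  have hbw : ∀ j, ∀ r ∈ annulusAt ρ₀, ‖b j r‖ ≤ w j := by
    intro j r hr
    have h1 := norm_zpow_le_pow_natAbs hr.2.1.le hr.2.2.le (-2 * j)
    rw [show (-2 * j).natAbs = 2 * j.natAbs by omega, pow_mul] at h1
    have h2 : ‖kernelCoeff p m r j‖ = |(j : ℝ)| ^ m * ‖p‖ ^ (j ^ 2) * ‖r ^ (-2 * j)‖ := by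
      rw [kernelCoeff]
      simp [norm_zpow, norm_pow]
    rw [hb, hw]
    dsimp only
    rw [norm_mul, h2, norm_pow, Complex.norm_ofNat, mul_pow, mul_assoc]
    refine mul_le_mul_of_nonneg_left ?_ (by positivity)
    exact mul_le_mul_of_nonneg_right h1 (by positivity)
  have ha' : ∀ j, DifferentiableOn ℂ (a j) (annulusAt σ₀) := by
    intro j
    by_cases hj : j ∈ P
    · simp only [ha, hj, if_true]
      exact differentiableOn_const 0
    · simp only [ha, hj, if_false]
      intro σ hσ
      have := (hbound j hj σ hσ).1
      refine DifferentiableAt.differentiableWithinAt ?_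
      simp only [hf]
      fun_prop (disch := assumption)
  have hb' : ∀ j, DifferentiableOn ℂ (b j) (annulusAt ρ₀) := by
    intro j ρ hρ
    refine DifferentiableAt.differentiableWithinAt ?_
    simp only [hb, kernelCoeff]
    refine DifferentiableAt.mul_const (DifferentiableAt.const_mul ?_ _) _
    exact differentiableAt_zpow.2 (Or.inl hρ.1)
  have hu' : Summable u := summable_inv_two_pow_natAbs
  have hw' : Summable w := summable_gaussian_natAbs hp hp1 m (by positivity)
  refine ⟨P, fun z => ∑' j, a j z.1 * b j z.2,
    analyticAt_tsum_mul (isOpen_annulusAt _) (isOpen_annulusAt _) hu' hw' ha' hb' hau hbw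
      (mem_annulusAt hσ₀) (mem_annulusAt hρ₀), ?_⟩
  filter_upwards [prod_mem_nhds ((isOpen_annulusAt σ₀).mem_nhds (mem_annulusAt hσ₀))
    ((isOpen_annulusAt ρ₀).mem_nhds (mem_annulusAt hρ₀))] with z hz
  have hsum : Summable fun j => a j z.1 * b j z.2 := by
    refine Summable.of_norm_bounded (g := w) hw' fun j => ?_
    rw [norm_mul]
    refine (mul_le_of_le_one_left (norm_nonneg _) ((hau j _ hz.1).trans ?_)).trans (hbw j _ hz.2)
    exact inv_le_one_of_one_le₀ (one_le_pow₀ (by norm_num))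
  have hfin : Summable ((P : Set ℤ).indicator fun j => kernelCoeff p m z.2 j * f z.1 j) :=
    summable_of_ne_finset_zero (s := P) fun j hj => Set.indicator_of_notMem (by simpa using hj) _
  rw [kernel, sum_eq_tsum_indicator, ← hfin.tsum_add hsum]
  refine tsum_congr fun j => ?_
  by_cases hj : j ∈ P
  · simp [ha, hj, hf]
  · rw [Set.indicator_of_notMem (by simpa using hj)]
    simp only [ha, hb, hf, hj, if_false]
    field_simp
    ring

lemma summable_kernel {p : ℂ} (hp0 : p ≠ 0) (hp1 : ‖p‖ < 1) (m : ℕ) {σ ρ : ℂ} (hσ : σ ≠ 0)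
    (hρ : ρ ≠ 0) :
    Summable fun j => kernelCoeff p m ρ j * -(σ * p ^ j / (1 - (σ * p ^ j) ^ 2)) := by
  obtain ⟨P, hP⟩ := exists_finset_fraction_bound hp0 hp1 σ
  refine Summable.of_norm_bounded_eventually (summable_kernelCoeff hp0 hp1 m hρ) ?_
  filter_upwards [P.finite_toSet.compl_mem_cofinite] with j hj
  rw [norm_mul]
  exact mul_le_of_le_one_right (norm_nonneg _)
    (hP j (by simpa using hj) σ (mem_annulusAt hσ)).2

/-! ### Local quotients with denominators controlled on a prescribed set. -/

/-- Near `z`, the function `f` is a quotient of analytic functions, the denominator of which has no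
zeros in the set `A`. -/
def IsQuotientAt {E : Type*} [NormedAddCommGroup E] [NormedSpace ℂ E] (A : Set E) (f : E → ℂ)
    (z : E) : Prop :=
  ∃ g h : E → ℂ, AnalyticAt ℂ g z ∧ AnalyticAt ℂ h z ∧ (∀ᶠ w in 𝓝 z, w ∈ A → h w ≠ 0) ∧
    ∀ᶠ w in 𝓝 z, h w ≠ 0 → f w = g w / h w

section

variable {E E' : Type*} [NormedAddCommGroup E] [NormedSpace ℂ E] [NormedAddCommGroup E']
  [NormedSpace ℂ E'] {A : Set E} {f f' : E → ℂ} {z : E}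

lemma isQuotientAt_of_analyticAt (hf : AnalyticAt ℂ f z) : IsQuotientAt A f z :=
  ⟨f, fun _ => 1, hf, analyticAt_const, by simp, by simp⟩

lemma IsQuotientAt.add (hf : IsQuotientAt A f z) (hf' : IsQuotientAt A f' z) :
    IsQuotientAt A (fun w => f w + f' w) z := by
  obtain ⟨g, h, hg, hh, hA, he⟩ := hf
  obtain ⟨g', h', hg', hh', hA', he'⟩ := hf'
  refine ⟨fun w => g w * h' w + h w * g' w, fun w => h w * h' w,
    (hg.mul hh').add (hh.mul hg'), hh.mul hh', ?_, ?_⟩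
  · filter_upwards [hA, hA'] with w h1 h2 hw
    exact mul_ne_zero (h1 hw) (h2 hw)
  · filter_upwards [he, he'] with w h1 h2 hw
    have ha := left_ne_zero_of_mul hw
    have hb := right_ne_zero_of_mul hw
    rw [h1 ha, h2 hb, div_add_div _ _ ha hb]

lemma IsQuotientAt.mul (hf : IsQuotientAt A f z) (hf' : IsQuotientAt A f' z) :
    IsQuotientAt A (fun w => f w * f' w) z := by
  obtain ⟨g, h, hg, hh, hA, he⟩ := hf
  obtain ⟨g', h', hg', hh', hA', he'⟩ := hf'
  refine ⟨fun w => g w * g' w, fun w => h w * h' w, hg.mul hg', hh.mul hh', ?_, ?_⟩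
  · filter_upwards [hA, hA'] with w h1 h2 hw
    exact mul_ne_zero (h1 hw) (h2 hw)
  · filter_upwards [he, he'] with w h1 h2 hw
    rw [h1 (left_ne_zero_of_mul hw), h2 (right_ne_zero_of_mul hw), div_mul_div_comm]

lemma IsQuotientAt.sum {κ : Type*} {s : Finset κ} {F : κ → E → ℂ}
    (hF : ∀ k ∈ s, IsQuotientAt A (F k) z) : IsQuotientAt A (fun w => ∑ k ∈ s, F k w) z := by
  classical
  induction s using Finset.induction_on with
  | empty => simpa using isQuotientAt_of_analyticAt analyticAt_const
  | insert k s hk ih =>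
    simp only [Finset.sum_insert hk]
    exact (hF k (by simp)).add (ih fun i hi => hF i (by simp [hi]))

lemma IsQuotientAt.congr (hf : IsQuotientAt A f z) (h : ∀ᶠ w in 𝓝 z, f' w = f w) :
    IsQuotientAt A f' z := by
  obtain ⟨g, d, hg, hd, hA, he⟩ := hf
  refine ⟨g, d, hg, hd, hA, ?_⟩
  filter_upwards [he, h] with w h1 h2 hw
  rw [h2, h1 hw]

lemma IsQuotientAt.comp {φ : E' → E} {A' : Set E'} {z' : E'} (hf : IsQuotientAt A f (φ z'))
    (hφ : AnalyticAt ℂ φ z') (hA' : ∀ w ∈ A', φ w ∈ A) : IsQuotientAt A' (fun w => f (φ w)) z' := by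
  obtain ⟨g, h, hg, hh, hA, he⟩ := hf
  refine ⟨fun w => g (φ w), fun w => h (φ w), hg.comp hφ, hh.comp hφ, ?_, ?_⟩
  · filter_upwards [hφ.continuousAt.eventually hA] with w h1 hw
    exact h1 (hA' w hw)
  · exact hφ.continuousAt.eventually he

end

/-- The points at which the kernel has no pole. -/
def kernelRegular (p : ℂ) : Set (ℂ × ℂ) := {z | ∀ j : ℤ, 1 - (z.1 * p ^ j) ^ 2 ≠ 0}

lemma analyticAt_kernelCoeff (p : ℂ) (m : ℕ) (j : ℤ) {z : ℂ × ℂ} (hz : z.2 ≠ 0) :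
    AnalyticAt ℂ (fun z : ℂ × ℂ => kernelCoeff p m z.2 j) z := by
  unfold kernelCoeff
  exact analyticAt_const.mul (analyticAt_snd.zpow hz)

lemma analyticAt_kernel {p : ℂ} (hp0 : p ≠ 0) (hp1 : ‖p‖ < 1) (m : ℕ) {z : ℂ × ℂ} (h1 : z.1 ≠ 0)
    (h2 : z.2 ≠ 0) (hz : z ∈ kernelRegular p) :
    AnalyticAt ℂ (fun z : ℂ × ℂ => kernel p m z.1 z.2) z := by
  obtain ⟨P, T, hT, he⟩ := exists_kernel_eq hp0 hp1 m h1 h2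
  have h : AnalyticAt ℂ (fun z : ℂ × ℂ =>
      ∑ j ∈ P, kernelCoeff p m z.2 j * -(z.1 * p ^ j / (1 - (z.1 * p ^ j) ^ 2)) + T z) z := by
    refine AnalyticAt.add (Finset.analyticAt_fun_sum _ fun j _ => ?_) hT
    refine (analyticAt_kernelCoeff p m j h2).mul (AnalyticAt.neg (AnalyticAt.div ?_ ?_ (hz j)))
    · exact analyticAt_fst.mul analyticAt_const
    · exact analyticAt_const.sub ((analyticAt_fst.mul analyticAt_const).pow 2)
  exact h.congr (Filter.EventuallyEq.symm he)

lemma isQuotientAt_kernel {p : ℂ} (hp0 : p ≠ 0) (hp1 : ‖p‖ < 1) (m : ℕ) {z : ℂ × ℂ} (h1 : z.1 ≠ 0)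
    (h2 : z.2 ≠ 0) : IsQuotientAt (kernelRegular p) (fun z : ℂ × ℂ => kernel p m z.1 z.2) z := by
  obtain ⟨P, T, hT, he⟩ := exists_kernel_eq hp0 hp1 m h1 h2
  refine IsQuotientAt.congr (IsQuotientAt.add (IsQuotientAt.sum (s := P) fun j _ => ?_)
    (isQuotientAt_of_analyticAt hT)) he
  refine ⟨fun z => kernelCoeff p m z.2 j * -(z.1 * p ^ j), fun z => 1 - (z.1 * p ^ j) ^ 2,
    (analyticAt_kernelCoeff p m j h2).mul (analyticAt_fst.mul analyticAt_const).neg,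
    analyticAt_const.sub ((analyticAt_fst.mul analyticAt_const).pow 2),
    Filter.Eventually.of_forall fun w hw => hw j, Filter.Eventually.of_forall fun w _ => ?_⟩
  dsimp only
  rw [← neg_div, mul_div_assoc]

/-- Laurent series with rapidly decreasing coefficients are analytic outside the origin. -/
lemma analyticAt_tsum_zpow {c : ℤ → ℂ} (hc : ∀ C : ℝ, 0 < C → Summable fun j : ℤ =>
    ‖c j‖ * C ^ j.natAbs) {z : ℂ} (hz : z ≠ 0) : AnalyticAt ℂ (fun z => ∑' j, c j * z ^ j) z := by
  have hR : 0 < ‖z‖ + ‖z⁻¹‖ + 1 := by positivity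
  refine (Complex.differentiableOn_tsum_of_summable_norm (hc _ hR) (fun j w hw => ?_)
    (isOpen_annulusAt z) (fun j w hw => ?_)).analyticAt
    ((isOpen_annulusAt z).mem_nhds (mem_annulusAt hz))
  · exact ((differentiableAt_zpow.2 (Or.inl hw.1)).const_mul _).differentiableWithinAt
  · rw [norm_mul]
    exact mul_le_mul_of_nonneg_left (norm_zpow_le_pow_natAbs hw.2.1.le hw.2.2.le j)
      (norm_nonneg _)

/-! ### The geometry of the regular set and the identity theorem. -/

lemma countable_exp_line (c a b : ℂ) (h : c * Complex.exp a ≠ 1) :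
    {z : ℂ | c * Complex.exp (a + z * b) = 1}.Countable := by
  by_cases hb : b = 0
  · convert Set.countable_empty
    ext z
    simp [hb, h]
  · refine (Set.countable_range fun n : ℤ =>
      (Complex.log c⁻¹ + n * (2 * Real.pi * Complex.I) - a) / b).mono fun z hz => ?_
    have hz' : c * Complex.exp (a + z * b) = 1 := hz
    have hc : c ≠ 0 := left_ne_zero_of_mul (hz' ▸ one_ne_zero)
    have h1 : Complex.exp (a + z * b) = Complex.exp (Complex.log c⁻¹) := by
      rw [Complex.exp_log (inv_ne_zero hc)]
      exact eq_inv_of_mul_eq_one_right hz'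
    obtain ⟨n, hn⟩ := Complex.exp_eq_exp_iff_exists_int.1 h1
    refine ⟨n, ?_⟩
    dsimp only
    rw [← hn]
    field_simp
    ring

/-- A curve joining a regular point to an arbitrary point of the torus: outside a countable set of
parameters it consists of regular points. -/
lemma exists_curve {q : ℂ} {n : ℕ} {x₀ x : Fin n → ℂ} (h₀ : x₀ ∈ regularSet q n)
    (h : x ∈ torus n) : ∃ γ : ℂ → Fin n → ℂ, (∀ z, AnalyticAt ℂ γ z) ∧ γ 0 = x₀ ∧ γ 1 = x ∧
      {z | γ z ∉ regularSet q n}.Countable := by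
  set u₀ : Fin n → ℂ := fun i => Complex.log (x₀ i) with hu₀
  set u : Fin n → ℂ := fun i => Complex.log (x i) with hu
  have hx₀ : ∀ i, Complex.exp (u₀ i) = x₀ i := fun i => Complex.exp_log (h₀.1 i)
  have hx : ∀ i, Complex.exp (u i) = x i := fun i => Complex.exp_log (h i)
  refine ⟨fun z i => Complex.exp (u₀ i + z * (u i - u₀ i)), fun z => ?_, ?_, ?_, ?_⟩
  · refine AnalyticAt.pi fun i => ?_
    exact AnalyticAt.cexp (analyticAt_const.add (analyticAt_id.mul analyticAt_const))
  · funext i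
    simp [hx₀]
  · funext i
    simp [hx]
  -- The curve interpolates logarithms linearly, so on it each divisor becomes an equation `c * exp
  -- (a + z * b) = 1`; that equation fails at `z = 0`, hence has countably many solutions.
  · have key : ∀ (m : ℤ) (J : Finset (Fin n)), J.Nonempty →
        {z : ℂ | q ^ m * ∏ i ∈ J, Complex.exp (u₀ i + z * (u i - u₀ i)) ^ 2 = 1}.Countable := by
      intro m J hJ
      have e : ∀ z : ℂ, ∏ i ∈ J, Complex.exp (u₀ i + z * (u i - u₀ i)) ^ 2 =
          Complex.exp ((2 * ∑ i ∈ J, u₀ i) + z * (2 * ∑ i ∈ J, (u i - u₀ i))) := fun z => by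
        simp only [← Complex.exp_nat_mul, ← Complex.exp_sum]
        congr 1
        rw [Finset.mul_sum, Finset.mul_sum, Finset.mul_sum, ← Finset.sum_add_distrib]
        exact Finset.sum_congr rfl fun i _ => by push_cast; ring
      simp only [e]
      refine countable_exp_line _ _ _ ?_
      have := e 0
      simp only [zero_mul, add_zero, hx₀] at this
      rw [← this]
      exact h₀.2 m J hJ
    refine (Set.countable_iUnion fun m : ℤ => Set.countable_iUnion fun J : Finset (Fin n) =>
      Set.countable_iUnion fun hJ : J.Nonempty => key m J hJ).mono fun z hz => ?_
    simp only [Set.mem_ofPred_eq, regularSet, torus, not_and, not_forall, not_not] at hz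
    obtain ⟨m, J, hJ, hz⟩ := hz fun i => Complex.exp_ne_zero _
    simp only [Set.mem_iUnion]
    exact ⟨m, J, hJ, hz⟩

lemma isConvergent_of_mem_convDomain {p q : ℂ} (hpq : p ^ 2 = q) (hq0 : q ≠ 0) (hq1 : ‖q‖ < 1)
    {n : ℕ} {x : Fin n → ℂ} (hx : x ∈ convDomain q n) : IsConvergent p x Finset.univ := by
  have hp0 : p ≠ 0 := by
    rintro rfl
    exact hq0 (by rw [← hpq]; simp)
  have hq : ‖q‖ = ‖p‖ ^ 2 := by rw [← hpq, norm_pow]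
  refine ⟨hp0, ?_, fun i _ => ?_, ?_⟩
  · rw [hq] at hq1
    exact (sq_lt_one_iff₀ (norm_nonneg _)).1 hq1
  · have := hx.1 i
    rw [norm_pow] at this
    exact (one_lt_sq_iff₀ (norm_nonneg _)).1 this
  · have := hx.2
    have h := mul_lt_mul_of_pos_left this (norm_pos_iff.2 hq0)
    rw [mul_inv_cancel₀ (norm_ne_zero_iff.2 hq0), hq, Finset.prod_pow, norm_pow, ← mul_pow,
      norm_prod] at h
    exact (sq_lt_one_iff₀ (by positivity)).1 h

lemma convDomain_nonempty {q : ℂ} (hq0 : q ≠ 0) (hq1 : ‖q‖ < 1) (n : ℕ) :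
    (convDomain q n).Nonempty := by
  have hq := norm_pos_iff.2 hq0
  -- All variables are taken equal to `s⁻¹`: then `|t_1 ⋯ t_n| = s⁻¹ ^ (2 * n)`, just below `‖q‖⁻¹ =
  -- s⁻¹ ^ (2 * n + 1)`.
  set s : ℝ := ‖q‖ ^ ((2 * n + 1 : ℕ) : ℝ)⁻¹ with hs
  have hs0 : 0 < s := Real.rpow_pos_of_pos hq _
  have hsn : s ^ (2 * n + 1) = ‖q‖ := Real.rpow_inv_natCast_pow hq.le (by omega)
  have hs1 : s < 1 := Real.rpow_lt_one hq.le hq1 (by positivity)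
  have hn : ‖((s⁻¹ : ℝ) : ℂ)‖ = s⁻¹ := by
    rw [Complex.norm_real, Real.norm_of_nonneg (by positivity)]
  refine ⟨fun _ => ((s⁻¹ : ℝ) : ℂ), fun i => ?_, ?_⟩
  · rw [norm_pow, hn]
    exact one_lt_pow₀ ((one_lt_inv₀ hs0).2 hs1) two_ne_zero
  · rw [Finset.prod_const, Finset.card_univ, Fintype.card_fin, ← pow_mul, norm_pow, hn, ← hsn,
      inv_pow]
    refine inv_strictAnti₀ (by positivity) ?_
    exact pow_lt_pow_right_of_lt_one₀ hs0 hs1 (by omega)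

lemma isOpen_convDomain (q : ℂ) (n : ℕ) : IsOpen (convDomain q n) := by
  have h : convDomain q n =
      (⋂ i : Fin n, {x | 1 < ‖x i ^ 2‖}) ∩ {x | ‖∏ i, x i ^ 2‖ < ‖q‖⁻¹} := by
    ext x
    simp [convDomain]
  rw [h]
  refine (isOpen_iInter_of_finite fun i => ?_).inter ?_
  · exact isOpen_lt continuous_const (by fun_prop)
  · exact isOpen_lt (by fun_prop) continuous_const

/-- The norm of any nonempty partial product lies strictly between `1` and `‖q‖⁻¹`, hence between
two consecutive powers of `‖q‖`. -/
lemma convDomain_subset_regularSet {q : ℂ} (hq0 : q ≠ 0) (hq1 : ‖q‖ < 1) (n : ℕ) :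
    convDomain q n ⊆ regularSet q n := by
  intro x hx
  have hq := norm_pos_iff.2 hq0
  refine ⟨fun i h0 => ?_, fun m J hJ he => ?_⟩
  · have := hx.1 i
    rw [h0] at this
    norm_num at this
  · have h1 : 1 < ∏ i ∈ J, ‖x i ^ 2‖ := by
      obtain ⟨i, hi⟩ := hJ
      refine lt_of_lt_of_le (hx.1 i) ?_
      simpa using Finset.prod_le_prod_of_subset_of_one_le (Finset.singleton_subset_iff.2 hi)
        (fun i _ => norm_nonneg (x i ^ 2)) (fun i _ _ => (hx.1 i).le)
    have h2 : ∏ i ∈ J, ‖x i ^ 2‖ < ‖q‖⁻¹ := by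
      refine lt_of_le_of_lt ?_ hx.2
      rw [norm_prod]
      exact Finset.prod_le_prod_of_subset_of_one_le (Finset.subset_univ J)
        (fun i _ => norm_nonneg _) (fun i _ _ => (hx.1 i).le)
    have h3 : ‖q‖ ^ m * ∏ i ∈ J, ‖x i ^ 2‖ = 1 := by
      rw [← norm_zpow, ← norm_prod, ← norm_mul, he, norm_one]
    rcases le_or_gt m 0 with hm | hm
    · have : 1 ≤ ‖q‖ ^ m := by simpa using zpow_le_zpow_right_of_le_one₀ hq hq1.le hm
      nlinarith
    · have h4 : ‖q‖ ^ m ≤ ‖q‖ := by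
        simpa using zpow_le_zpow_right_of_le_one₀ hq hq1.le (show (1 : ℤ) ≤ m by omega)
      have h5 : ‖q‖ * ∏ i ∈ J, ‖x i ^ 2‖ < 1 := by
        simpa [hq.ne'] using mul_lt_mul_of_pos_left h2 hq
      nlinarith

lemma torus_subset_closure {q : ℂ} (hq0 : q ≠ 0) (hq1 : ‖q‖ < 1) (n : ℕ) :
    torus n ⊆ closure (regularSet q n) := by
  intro x hx
  obtain ⟨x₀, hx₀⟩ := convDomain_nonempty hq0 hq1 n
  obtain ⟨γ, hγ, -, h1, hc⟩ := exists_curve (convDomain_subset_regularSet hq0 hq1 n hx₀) hx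
  have hd : Dense {z | γ z ∉ regularSet q n}ᶜ := hc.dense_compl ℂ
  have hm := map_mem_closure (f := γ) (t := regularSet q n)
    (continuous_iff_continuousAt.2 fun z => (hγ z).continuousAt) (hd 1) (fun z hz => by
      simpa using hz)
  rwa [h1] at hm

/-- The identity theorem on the set of regular points. -/
theorem eqOn_regularSet {q : ℂ} (hq0 : q ≠ 0) (hq1 : ‖q‖ < 1) {n : ℕ} {f g : (Fin n → ℂ) → ℂ}
    (hf : AnalyticOnNhd ℂ f (regularSet q n)) (hg : AnalyticOnNhd ℂ g (regularSet q n))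
    (h : Set.EqOn f g (convDomain q n)) : Set.EqOn f g (regularSet q n) := by
  intro x hx
  obtain ⟨x₀, hx₀⟩ := convDomain_nonempty hq0 hq1 n
  obtain ⟨γ, hγ, h0, h1, hc⟩ :=
    exists_curve (convDomain_subset_regularSet hq0 hq1 n hx₀) hx.1
  set U : Set ℂ := {z | γ z ∉ regularSet q n}ᶜ with hU
  have hmem : ∀ z, z ∈ U ↔ γ z ∈ regularSet q n := fun z => by simp [hU]
  -- The plane minus a countable set is connected, so vanishing near the parameter `0` propagates to
  -- the parameter `1`.
  have hpre : IsPreconnected U := (hc.isConnected_compl_of_one_lt_rank (by simp)).2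
  have han : AnalyticOnNhd ℂ (fun z => f (γ z) - g (γ z)) U := fun z hz =>
    ((hf _ ((hmem z).1 hz)).comp (hγ z)).sub ((hg _ ((hmem z).1 hz)).comp (hγ z))
  have hev : (fun z => f (γ z) - g (γ z)) =ᶠ[𝓝 0] 0 := by
    have : ∀ᶠ z in 𝓝 (0 : ℂ), γ z ∈ convDomain q n :=
      (hγ 0).continuousAt.eventually_mem ((isOpen_convDomain q n).mem_nhds (by rwa [h0]))
    filter_upwards [this] with z hz
    simp [h hz]
  have := han.eqOn_zero_of_preconnected_of_eventuallyEq_zero hpre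
    ((hmem 0).2 (by rw [h0]; exact convDomain_subset_regularSet hq0 hq1 n hx₀)) hev
    ((hmem 1).2 (by rwa [h1]))
  simpa [h1, sub_eq_zero] using this

/-- Regular points accumulate at every point of the torus, and the denominator is nonzero at those
close by; so it cannot vanish identically. -/
lemma isMeromorphicOn_of_isQuotientAt {q : ℂ} (hq0 : q ≠ 0) (hq1 : ‖q‖ < 1) {n : ℕ}
    {f : (Fin n → ℂ) → ℂ} (h : ∀ z ∈ torus n, IsQuotientAt (regularSet q n) f z) :
    IsMeromorphicOn f (torus n) := by
  intro z hz
  obtain ⟨g, d, hg, hd, hA, he⟩ := h z hz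
  refine ⟨g, d, hg, hd, fun h0 => ?_, he⟩
  have hfr := mem_closure_iff_frequently.1 (torus_subset_closure hq0 hq1 n hz)
  obtain ⟨w, hw, hw1, hw2⟩ := (hfr.and_eventually (hA.and h0)).exists
  exact hw1 hw hw2

lemma comp_mem_regularSet {q : ℂ} {m n : ℕ} {x : Fin n → ℂ} (hx : x ∈ regularSet q n)
    {e : Fin m → Fin n} (he : Function.Injective e) : (fun j => x (e j)) ∈ regularSet q m := by
  refine ⟨fun j => hx.1 _, fun k J hJ => ?_⟩
  have := hx.2 k (J.map ⟨e, he⟩) (by simpa using hJ)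
  simpa using this

lemma scaleFirst_mem_regularSet {p q : ℂ} (hpq : p ^ 2 = q) (hq0 : q ≠ 0) {n : ℕ}
    {x : Fin (n + 1) → ℂ} (hx : x ∈ regularSet q (n + 1)) :
    scaleFirst p x ∈ regularSet q (n + 1) := by
  have hp0 : p ≠ 0 := by
    rintro rfl
    exact hq0 (by rw [← hpq]; simp)
  refine ⟨fun i => ?_, fun k J hJ => ?_⟩
  · refine Fin.cases ?_ (fun i => ?_) i
    · simpa [scaleFirst, hp0] using hx.1 0
    · simpa [scaleFirst, Fin.tail] using hx.1 i.succ
  · have hS : ∀ i ≠ 0, scaleFirst p x i = x i := by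
      intro i hi
      obtain ⟨j, rfl⟩ := Fin.exists_succ_eq.2 hi
      simp [scaleFirst, Fin.tail]
    have h0 : scaleFirst p x 0 = p * x 0 := by simp [scaleFirst]
    by_cases h : 0 ∈ J
    · have e : ∏ i ∈ J, scaleFirst p x i ^ 2 = q * ∏ i ∈ J, x i ^ 2 := by
        rw [← Finset.mul_prod_erase J _ h, ← Finset.mul_prod_erase J (fun i => x i ^ 2) h, h0,
          Finset.prod_congr rfl fun i hi => by rw [hS i (Finset.ne_of_mem_erase hi)], ← hpq]
        ring
      rw [e, ← mul_assoc, ← zpow_add_one₀ hq0]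
      exact hx.2 _ J hJ
    · rw [Finset.prod_congr rfl fun i hi => by rw [hS i (ne_of_mem_of_not_mem hi h)]]
      exact hx.2 _ J hJ

lemma prod_insert_zero_map_succ {n : ℕ} {M : Type*} [CommMonoid M] (f : Fin (n + 1) → M)
    (I : Finset (Fin n)) :
    ∏ i ∈ insert 0 (I.map (Fin.succEmb n)), f i = f 0 * ∏ i ∈ I, f i.succ := by
  rw [Finset.prod_insert (by simp [Fin.succ_ne_zero]), Finset.prod_map]
  rfl

lemma prod_orderEmbOfFin {α M : Type*} [LinearOrder α] [CommMonoid M] (J : Finset α) (f : α → M) :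
    ∏ j, f (J.orderEmbOfFin rfl j) = ∏ i ∈ J, f i :=
  (Finset.prod_map Finset.univ (J.orderEmbOfFin rfl).toEmbedding f).symm.trans
    (by rw [Finset.map_orderEmbOfFin_univ])

/-! ### The continuation defined by the recursion. -/

/-- The continuation of the `n`-point function, defined by recursion on the number of variables;
`c` is the value of the function of no variables. -/
def nPointCont (p c : ℂ) : (n : ℕ) → (Fin n → ℂ) → ℂ
  | 0, _ => c
  | n + 1, x => ∑ I : Finset (Fin n),
      kernel p I.card (x 0 * ∏ i ∈ I, x i.succ) (∏ i ∈ Iᶜ, x i.succ) *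
        nPointCont p c Iᶜ.card (fun j => x (Iᶜ.orderEmbOfFin rfl j).succ)
  termination_by n => n
  decreasing_by
    have := Finset.card_le_univ Iᶜ
    rw [Fintype.card_fin] at this
    omega

/-- The continuation in the variables with index in `J`. -/
def nPointContOn (p c : ℂ) {n : ℕ} (x : Fin n → ℂ) (J : Finset (Fin n)) : ℂ :=
  nPointCont p c J.card fun j => x (J.orderEmbOfFin rfl j)

lemma nPointCont_zero (p c : ℂ) (x : Fin 0 → ℂ) : nPointCont p c 0 x = c := by
  rw [nPointCont]

lemma nPointCont_succ (p c : ℂ) {n : ℕ} (x : Fin (n + 1) → ℂ) :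
    nPointCont p c (n + 1) x = ∑ I : Finset (Fin n),
      kernel p I.card (x 0 * ∏ i ∈ I, x i.succ) (∏ i ∈ Iᶜ, x i.succ) *
        nPointContOn p c (fun i => x i.succ) Iᶜ := by
  rw [nPointCont]
  rfl

lemma nPointCont_congr (p c : ℂ) {a b : ℕ} (h : a = b) {f : Fin a → ℂ} {g : Fin b → ℂ}
    (hfg : ∀ j, f j = g (Fin.cast h j)) : nPointCont p c a f = nPointCont p c b g := by
  subst h
  congr 1
  funext j
  exact hfg j

lemma nPointContOn_map (p c : ℂ) {m n : ℕ} (x : Fin n → ℂ) (e : Fin m ↪o Fin n)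
    (I : Finset (Fin m)) :
    nPointContOn p c (fun j => x (e j)) I = nPointContOn p c x (I.map e.toEmbedding) := by
  refine nPointCont_congr p c (Finset.card_map _).symm fun j => ?_
  have h := Finset.orderEmbOfFin_unique' (s := I.map e.toEmbedding) (k := I.card)
    (Finset.card_map _) (f := (I.orderEmbOfFin rfl).trans e) (fun j => by simp)
  have h' := congrArg (fun f : Fin I.card ↪o Fin n => f j) h
  dsimp only [RelEmbedding.trans_apply] at h' ⊢
  exact congrArg x h'

/-- The recursion for the continuation at a point with a distinguished variable. -/
lemma nPointCont_cons (p c : ℂ) {n : ℕ} (y : ℂ) (x : Fin n → ℂ) (J : Finset (Fin n)) :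
    nPointCont p c (J.card + 1) (Fin.cons y fun j => x (J.orderEmbOfFin rfl j)) =
      ∑ I ∈ J.powerset, kernel p I.card (y * ∏ i ∈ I, x i) (∏ i ∈ J \ I, x i) *
        nPointContOn p c x (J \ I) := by
  set e := J.orderEmbOfFin rfl with he
  have heJ : Finset.univ.map e.toEmbedding = J := Finset.map_orderEmbOfFin_univ J rfl
  have hcompl : ∀ I : Finset (Fin J.card),
      Iᶜ.map e.toEmbedding = J \ I.map e.toEmbedding := fun I => by
    have := Finset.map_sdiff (f := e.toEmbedding) Finset.univ I
    rwa [heJ] at this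
  rw [nPointCont_succ]
  refine Finset.sum_bij (fun I _ => I.map e.toEmbedding) (fun I _ => ?_) (fun I _ I' _ h => ?_)
    (fun I hI => ?_) (fun I _ => ?_)
  · rw [Finset.mem_powerset]
    exact (Finset.map_subset_map.2 (Finset.subset_univ I)).trans heJ.subset
  · exact Finset.map_injective _ h
  · rw [Finset.mem_powerset, ← heJ, Finset.subset_map_iff] at hI
    obtain ⟨I', -, rfl⟩ := hI
    exact ⟨I', Finset.mem_univ _, rfl⟩
  · rw [← hcompl, Finset.prod_map, Finset.prod_map, Finset.card_map, ← nPointContOn_map]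
    simp only [Fin.cons_zero, Fin.cons_succ]
    rfl

/-- The pole `(σ * p ^ j) ^ 2 = 1` is the divisor `q ^ j * ∏ t_i = 1` of the index set consisting of
`0` and the merged indices. -/
lemma kernelRegular_of_mem {p q : ℂ} (hpq : p ^ 2 = q) {n : ℕ}
    {x : Fin (n + 1) → ℂ} (hx : x ∈ regularSet q (n + 1)) (I : Finset (Fin n)) (ρ : ℂ) :
    (x 0 * ∏ i ∈ I, x i.succ, ρ) ∈ kernelRegular p := by
  intro j hj
  have := hx.2 j (insert 0 (I.map (Fin.succEmb n))) (Finset.insert_nonempty _ _)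
  rw [prod_insert_zero_map_succ] at this
  apply this
  rw [← hpq, Finset.prod_pow]
  rw [sub_eq_zero] at hj
  rw [hj]
  dsimp only
  rw [mul_pow, mul_pow, ← zpow_natCast (p ^ j), ← zpow_natCast p 2, ← zpow_mul, ← zpow_mul,
    mul_comm j]
  ring

lemma analyticAt_coord {n : ℕ} (i : Fin n) (x : Fin n → ℂ) :
    AnalyticAt ℂ (fun x : Fin n → ℂ => x i) x :=
  (ContinuousLinearMap.proj (R := ℂ) (φ := fun _ : Fin n => ℂ) i).analyticAt x

lemma analyticAt_kernelArgs {n : ℕ} (I : Finset (Fin n)) (x : Fin (n + 1) → ℂ) :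
    AnalyticAt ℂ (fun x : Fin (n + 1) → ℂ =>
      (x 0 * ∏ i ∈ I, x i.succ, ∏ i ∈ Iᶜ, x i.succ)) x :=
  ((analyticAt_coord _ _).mul (Finset.analyticAt_fun_prod _ fun _ _ => analyticAt_coord _ _)).prod
    (Finset.analyticAt_fun_prod _ fun _ _ => analyticAt_coord _ _)

lemma analyticAt_reindex {m n : ℕ} (e : Fin m → Fin n) (x : Fin n → ℂ) :
    AnalyticAt ℂ (fun (x : Fin n → ℂ) (j : Fin m) => x (e j)) x :=
  AnalyticAt.pi fun j => analyticAt_coord (e j) x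

lemma succ_orderEmb_injective {n : ℕ} (J : Finset (Fin n)) :
    Function.Injective fun j => (J.orderEmbOfFin rfl j).succ :=
  (Fin.succ_injective n).comp (J.orderEmbOfFin rfl).injective

section

variable {p q : ℂ}

theorem analyticOnNhd_nPointCont (hpq : p ^ 2 = q) (hp0 : p ≠ 0) (hp1 : ‖p‖ < 1) (c : ℂ) (n : ℕ) :
    AnalyticOnNhd ℂ (nPointCont p c n) (regularSet q n) := by
  induction n using Nat.strong_induction_on with
  | _ n ih =>
    cases n with
    | zero =>
      have : nPointCont p c 0 = fun _ => c := funext fun x => nPointCont_zero p c x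
      rw [this]
      exact analyticOnNhd_const
    | succ n =>
      intro x hx
      refine AnalyticAt.congr (Finset.analyticAt_fun_sum _ fun I _ => AnalyticAt.fun_mul ?_ ?_)
        (Filter.Eventually.of_forall fun x => (nPointCont_succ p c x).symm)
      · have h := analyticAt_kernel hp0 hp1 I.card (z := (x 0 * ∏ i ∈ I, x i.succ,
          ∏ i ∈ Iᶜ, x i.succ)) (mul_ne_zero (hx.1 _) (Finset.prod_ne_zero_iff.2 fun i _ => hx.1 _))
          (Finset.prod_ne_zero_iff.2 fun i _ => hx.1 _)
          (kernelRegular_of_mem hpq hx I _)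
        exact AnalyticAt.comp (g := fun z : ℂ × ℂ => kernel p I.card z.1 z.2)
          (f := fun x : Fin (n + 1) → ℂ => (x 0 * ∏ i ∈ I, x i.succ, ∏ i ∈ Iᶜ, x i.succ)) h
          (analyticAt_kernelArgs I x)
      · have hcard : Iᶜ.card < n + 1 := by
          have := Finset.card_le_univ Iᶜ
          rw [Fintype.card_fin] at this
          omega
        exact AnalyticAt.comp (g := nPointCont p c Iᶜ.card)
          (f := fun (x : Fin (n + 1) → ℂ) (j : Fin Iᶜ.card) => x (Iᶜ.orderEmbOfFin rfl j).succ)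
          (ih _ hcard _ (comp_mem_regularSet hx (succ_orderEmb_injective Iᶜ)))
          (analyticAt_reindex _ x)

lemma isQuotientAt_nPointCont (hpq : p ^ 2 = q) (hp0 : p ≠ 0) (hp1 : ‖p‖ < 1) (c : ℂ)
    (n : ℕ) : ∀ x ∈ torus n, IsQuotientAt (regularSet q n) (nPointCont p c n) x := by
  induction n using Nat.strong_induction_on with
  | _ n ih =>
    intro x hx
    cases n with
    | zero =>
      have : nPointCont p c 0 = fun _ => c := funext fun x => nPointCont_zero p c x
      rw [this]
      exact isQuotientAt_of_analyticAt analyticAt_const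
    | succ n =>
      refine IsQuotientAt.congr (IsQuotientAt.sum (s := Finset.univ)
        fun I _ => IsQuotientAt.mul ?_ ?_)
        (Filter.Eventually.of_forall fun x => nPointCont_succ p c x)
      · exact IsQuotientAt.comp (φ := fun x : Fin (n + 1) → ℂ =>
          (x 0 * ∏ i ∈ I, x i.succ, ∏ i ∈ Iᶜ, x i.succ)) (isQuotientAt_kernel hp0 hp1 I.card
          (mul_ne_zero (hx _) (Finset.prod_ne_zero_iff.2 fun i _ => hx _))
          (Finset.prod_ne_zero_iff.2 fun i _ => hx _)) (analyticAt_kernelArgs I x)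
          fun w hw => kernelRegular_of_mem hpq hw I _
      · have hcard : Iᶜ.card < n + 1 := by
          have := Finset.card_le_univ Iᶜ
          rw [Fintype.card_fin] at this
          omega
        exact IsQuotientAt.comp (φ := fun (x : Fin (n + 1) → ℂ) (j : Fin Iᶜ.card) =>
          x (Iᶜ.orderEmbOfFin rfl j).succ) (ih _ hcard _ fun j => hx _) (analyticAt_reindex _ x)
          fun w hw => comp_mem_regularSet hw (succ_orderEmb_injective Iᶜ)

lemma analyticAt_nPointContOn (hpq : p ^ 2 = q) (hp0 : p ≠ 0) (hp1 : ‖p‖ < 1) (c : ℂ)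
    {n : ℕ} (J : Finset (Fin n)) {x : Fin n → ℂ}
    (hx : x ∈ regularSet q n) : AnalyticAt ℂ (fun x => nPointContOn p c x J) x :=
  AnalyticAt.comp (g := nPointCont p c J.card)
    (f := fun (x : Fin n → ℂ) (j : Fin J.card) => x (J.orderEmbOfFin rfl j))
    (analyticOnNhd_nPointCont hpq hp0 hp1 c _ _
      (comp_mem_regularSet hx (J.orderEmbOfFin rfl).injective)) (analyticAt_reindex _ x)

end

/-! ### Agreement of the continuation with the series. -/

/-- The sum over all partitions of the weights. -/
def partitionFun (p : ℂ) : ℂ := ∑' μ : YoungDiagram, p ^ (2 * μ.card)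

/-- The continuation and the series satisfy the same recursion, and `c = a * partitionFun p` fixes
the value for no variables. The factor `a` later becomes `eulerProd q`; Euler's formula for
`partitionFun` is not needed. -/
theorem nPointCont_eq_partitionSum (p a : ℂ) (n : ℕ) : ∀ x : Fin n → ℂ,
    IsConvergent p x Finset.univ →
      nPointCont p (a * partitionFun p) n x = a * partitionSum p x Finset.univ := by
  induction n using Nat.strong_induction_on with
  | _ n ih =>
    intro x hx
    cases n with
    | zero =>
      rw [nPointCont_zero, partitionFun, partitionSum]
      simp
    | succ n =>
      have hJ : ∀ J : Finset (Fin n), IsConvergent p (fun i : Fin n => x i.succ) J := fun J => by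
        have h1 := hx.mono (Finset.subset_univ (J.map (Fin.succEmb n)))
        refine ⟨h1.ne_zero, h1.norm_lt_one, fun i _ => hx.one_lt_norm _ (Finset.mem_univ _), ?_⟩
        simpa using h1.norm_prod_lt
      have hsum := partitionSum_recursion (x := fun i : Fin n => x i.succ) (hJ Finset.univ)
        (hx.one_lt_norm 0 (Finset.mem_univ _)) (by
          have := hx.norm_prod_lt
          rwa [Fin.prod_univ_succ] at this)
      have hl : partitionSum p x Finset.univ = ∑' μ : YoungDiagram, p ^ (2 * μ.card) *
          (rowSum (x 0) μ * ∏ i : Fin n, rowSum (x i.succ) μ) := by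
        simp only [partitionSum, Fin.prod_univ_succ]
      rw [hl, hsum, nPointCont_succ, Finset.mul_sum, Finset.powerset_univ]
      refine Finset.sum_congr rfl fun I _ => ?_
      have hcard : Iᶜ.card < n + 1 := by
        have := Finset.card_le_univ Iᶜ
        rw [Fintype.card_fin] at this
        omega
      have hI := hJ Iᶜ
      have hind : nPointContOn p (a * partitionFun p) (fun i => x i.succ) Iᶜ =
          a * partitionSum p (fun i => x i.succ) Iᶜ := by
        rw [nPointContOn, ih _ hcard]
        · congr 1
          refine tsum_congr fun μ => ?_
          rw [prod_orderEmbOfFin Iᶜ fun i : Fin n => rowSum (x i.succ) μ]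
        · refine ⟨hI.ne_zero, hI.norm_lt_one, fun j _ => hI.one_lt_norm _
            (Finset.orderEmbOfFin_mem _ _ _), ?_⟩
          rw [prod_orderEmbOfFin Iᶜ fun i : Fin n => ‖x i.succ‖]
          exact hI.norm_prod_lt
      rw [hind, Finset.compl_eq_univ_sdiff]
      ring

lemma nPointContOn_eq_partitionSum (p a : ℂ) {n : ℕ} {x : Fin n → ℂ} {J : Finset (Fin n)}
    (h : IsConvergent p x J) :
    nPointContOn p (a * partitionFun p) x J = a * partitionSum p x J := by
  rw [nPointContOn, nPointCont_eq_partitionSum]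
  · congr 1
    refine tsum_congr fun μ => ?_
    rw [prod_orderEmbOfFin J fun i => rowSum (x i) μ]
  · refine ⟨h.ne_zero, h.norm_lt_one, fun j _ => h.one_lt_norm _
      (Finset.orderEmbOfFin_mem _ _ _), ?_⟩
    rw [prod_orderEmbOfFin J fun i => ‖x i‖]
    exact h.norm_prod_lt

/-! ### The `q`-difference equation for the kernel and for the continuation. -/

/-- The series measuring the failure of the kernel to be invariant under `σ ↦ p σ`. -/
def kernelDefect (p : ℂ) (m : ℕ) (ρ : ℂ) : ℂ := ∑' j : ℤ, kernelCoeff p m ρ j * p ^ j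

lemma summable_kernelDefect {p ρ : ℂ} (hp0 : p ≠ 0) (hp1 : ‖p‖ < 1) (m : ℕ) (hρ : ρ ≠ 0) :
    Summable fun j => kernelCoeff p m ρ j * p ^ j := by
  refine Summable.of_norm ((summable_gaussian_complex hp0 hp1 m (C := ρ ^ (-2 : ℤ) * p)
    (mul_ne_zero (zpow_ne_zero _ hρ) hp0)).congr fun j => ?_)
  rw [mul_zpow, ← zpow_mul, kernelCoeff, mul_assoc]
  congr 1
  ring

/-- The binomial expansion of `(j - 1) ^ L.card` is indexed by subsets of `L` rather than by
degrees, in order to match the sum over merged sets of variables. -/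
lemma kernelCoeff_pred {p ρ : ℂ} (hp0 : p ≠ 0) (hρ : ρ ≠ 0) {ι : Type*} (L : Finset ι) (j : ℤ) :
    kernelCoeff p L.card ρ (j - 1) = -(p * ρ ^ 2) * (p ^ j)⁻¹ ^ 2 *
      ∑ I ∈ L.powerset, (-1) ^ (L.card - I.card) * kernelCoeff p I.card ρ j := by
  have h1 : ((j - 1 : ℤ) : ℂ) ^ L.card =
      ∑ I ∈ L.powerset, (j : ℂ) ^ I.card * (-1) ^ (L.card - I.card) := by
    rw [Finset.sum_pow_mul_eq_add_pow]
    push_cast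
    ring
  have h2 : p ^ ((j - 1) ^ 2) = p ^ (j ^ 2) * p * (p ^ j)⁻¹ ^ 2 := by
    rw [show (j - 1) ^ 2 = j ^ 2 + 1 + -j + -j by ring, zpow_add₀ hp0, zpow_add₀ hp0,
      zpow_add₀ hp0, zpow_neg]
    simp
    ring
  have h3 : ρ ^ (-2 * (j - 1)) = ρ ^ (-2 * j) * ρ ^ 2 := by
    rw [show -2 * (j - 1) = -2 * j + 2 by ring, zpow_add₀ hρ]
    norm_cast
  have h4 : (-1 : ℂ) ^ (j - 1) = -(-1) ^ j := by
    rw [zpow_sub_one₀ (by norm_num)]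
    norm_num
  simp only [kernelCoeff]
  rw [h1, h2, h3, h4, Finset.mul_sum, Finset.mul_sum, Finset.sum_mul, Finset.sum_mul]
  exact Finset.sum_congr rfl fun I _ => by ring

lemma kernel_mul_left {p σ ρ : ℂ} (hp0 : p ≠ 0) (hp1 : ‖p‖ < 1) (hσ : σ ≠ 0) (hρ : ρ ≠ 0)
    (hreg : (σ, ρ) ∈ kernelRegular p) {ι : Type*} (L : Finset ι) :
    kernel p L.card (p * σ) ρ = -(p * ρ ^ 2 * σ ^ 2) *
      ((∑ I ∈ L.powerset, (-1) ^ (L.card - I.card) * kernel p I.card σ ρ) +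
        σ⁻¹ * (ρ ^ 2)⁻¹ * kernelDefect p L.card ρ) := by
  set y : ℤ → ℂ := fun j => σ * p ^ j with hy
  have hy0 : ∀ j, y j ≠ 0 := fun j => mul_ne_zero hσ (zpow_ne_zero _ hp0)
  have hy1 : ∀ j, 1 - y j ^ 2 ≠ 0 := hreg
  have hshift : kernel p L.card (p * σ) ρ =
      ∑' j, kernelCoeff p L.card ρ (j - 1) * -(y j / (1 - y j ^ 2)) := by
    rw [kernel, ← (Equiv.subRight (1 : ℤ)).tsum_eq]
    refine tsum_congr fun j => ?_
    have : p * σ * p ^ (j - 1) = y j := by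
      rw [hy, zpow_sub₀ hp0]
      field_simp
    rw [Equiv.subRight_apply, this]
  -- The shifted coefficient carries `y j ^ (-2)`, and `y⁻¹ ^ 2 * (y / (1 - y ^ 2)) = y / (1 - y ^
  -- 2) + y⁻¹`. The first part gives kernels again; the second has no pole and sums to the defect.
  have hterm : ∀ j, kernelCoeff p L.card ρ (j - 1) * -(y j / (1 - y j ^ 2)) =
      -(p * ρ ^ 2 * σ ^ 2) * ((∑ I ∈ L.powerset, (-1) ^ (L.card - I.card) *
        (kernelCoeff p I.card ρ j * -(y j / (1 - y j ^ 2))))) +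
          kernelCoeff p L.card ρ (j - 1) * -(y j) := by
    intro j
    have h := kernelCoeff_pred hp0 hρ L j
    set s := ∑ I ∈ L.powerset, (-1) ^ (L.card - I.card) * kernelCoeff p I.card ρ j with hs
    have h5 : ∑ I ∈ L.powerset, (-1) ^ (L.card - I.card) *
        (kernelCoeff p I.card ρ j * -(y j / (1 - y j ^ 2))) = s * -(y j / (1 - y j ^ 2)) := by
      rw [hs, Finset.sum_mul]
      exact Finset.sum_congr rfl fun I _ => by ring
    have hpj : (p ^ j)⁻¹ ^ 2 = σ ^ 2 * (y j)⁻¹ ^ 2 := by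
      rw [hy]
      field_simp
    rw [h5, h, hpj]
    have h6 := hy0 j
    have h7 := hy1 j
    field_simp
    ring
  have hs1 : ∀ I ∈ L.powerset, Summable fun j => (-1) ^ (L.card - I.card) *
      (kernelCoeff p I.card ρ j * -(y j / (1 - y j ^ 2))) := fun I _ =>
    (summable_kernel hp0 hp1 _ hσ hρ).mul_left _
  have hdef : ∀ j, kernelCoeff p L.card ρ (j - 1) * -(y j) =
      -(p * σ) * (kernelCoeff p L.card ρ (j - 1) * p ^ (j - 1)) := by
    intro j
    rw [hy, zpow_sub_one₀ hp0]
    field_simp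
  have hs2' := ((Equiv.subRight (1 : ℤ)).summable_iff.2
    (summable_kernelDefect hp0 hp1 L.card hρ)).mul_left (-(p * σ))
  have hs2 : Summable fun j => kernelCoeff p L.card ρ (j - 1) * -(y j) :=
    hs2'.congr fun j => (hdef j).symm
  have hd : ∑' j, kernelCoeff p L.card ρ (j - 1) * -(y j) =
      -(p * σ) * kernelDefect p L.card ρ := by
    rw [tsum_congr hdef, tsum_mul_left]
    exact congrArg _ ((Equiv.subRight (1 : ℤ)).tsum_eq fun j => kernelCoeff p L.card ρ j * p ^ j)
  rw [hshift, tsum_congr hterm, ((summable_sum hs1).mul_left _).tsum_add hs2, tsum_mul_left,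
    Summable.tsum_finsetSum hs1, hd, mul_add]
  congr 1
  · congr 1
    refine Finset.sum_congr rfl fun I _ => ?_
    rw [tsum_mul_left]
    rfl
  · field_simp

lemma analyticAt_kernelDefect {p ρ : ℂ} (hp0 : p ≠ 0) (hp1 : ‖p‖ < 1) (m : ℕ) (hρ : ρ ≠ 0) :
    AnalyticAt ℂ (kernelDefect p m) ρ := by
  have hp := norm_pos_iff.2 hp0
  set c : ℤ → ℂ := fun j => (-1) ^ j * (j : ℂ) ^ m * p ^ (j ^ 2) * p ^ j with hc
  have hsum : ∀ C : ℝ, 0 < C → Summable fun j : ℤ => ‖c j‖ * C ^ j.natAbs := by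
    intro C hC
    have hpp : 0 < ‖p‖ + ‖p⁻¹‖ := by positivity
    refine Summable.of_nonneg_of_le (fun j => by positivity) (fun j => ?_)
      (summable_gaussian_natAbs hp hp1 m (C := (‖p‖ + ‖p⁻¹‖) * C) (by positivity))
    have h1 : ‖p ^ j‖ ≤ (‖p‖ + ‖p⁻¹‖) ^ j.natAbs :=
      norm_zpow_le_pow_natAbs (by linarith [norm_nonneg p⁻¹]) (by linarith) j
    have h2 : ‖c j‖ = |(j : ℝ)| ^ m * ‖p‖ ^ (j ^ 2) * ‖p ^ j‖ := by
      simp [hc, norm_zpow, norm_pow]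
    rw [h2, mul_pow, mul_assoc]
    exact mul_le_mul_of_nonneg_left (mul_le_mul_of_nonneg_right h1 (by positivity))
      (by positivity)
  refine (AnalyticAt.comp (g := fun z : ℂ => ∑' j, c j * z ^ j) (f := fun ρ : ℂ => ρ ^ (-2 : ℤ))
    (analyticAt_tsum_zpow hsum (zpow_ne_zero _ hρ)) (analyticAt_id.zpow hρ)).congr
    (Filter.Eventually.of_forall fun ρ => tsum_congr fun j => ?_)
  dsimp only
  rw [← zpow_mul, kernelCoeff]
  ring

section

variable {p q : ℂ}

lemma ne_zero_of_sq_eq (hpq : p ^ 2 = q) (hq0 : q ≠ 0) : p ≠ 0 := by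
  rintro rfl
  exact hq0 (by rw [← hpq]; simp)

lemma norm_lt_one_of_sq_eq (hpq : p ^ 2 = q) (hq1 : ‖q‖ < 1) : ‖p‖ < 1 := by
  rw [← hpq, norm_pow] at hq1
  exact (sq_lt_one_iff₀ (norm_nonneg _)).1 hq1

/-- The vanishing of the total defect. -/
theorem sum_kernelDefect_eq_zero (hpq : p ^ 2 = q) (hq0 : q ≠ 0) (hq1 : ‖q‖ < 1) (a : ℂ) {n : ℕ}
    {x : Fin n → ℂ} (hx : x ∈ regularSet q n) :
    ∑ I : Finset (Fin n), (∏ i ∈ I, x i) * kernelDefect p I.card (∏ i ∈ Iᶜ, x i) *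
      nPointContOn p (a * partitionFun p) x Iᶜ = 0 := by
  have hp0 := ne_zero_of_sq_eq hpq hq0
  have hp1 := norm_lt_one_of_sq_eq hpq hq1
  refine eqOn_regularSet hq0 hq1 (f := fun x : Fin n → ℂ => ∑ I : Finset (Fin n),
    (∏ i ∈ I, x i) * kernelDefect p I.card (∏ i ∈ Iᶜ, x i) *
      nPointContOn p (a * partitionFun p) x Iᶜ) (g := fun _ => 0) ?_ analyticOnNhd_const ?_ hx
  · intro x hx
    refine Finset.analyticAt_fun_sum _ fun I _ => AnalyticAt.fun_mul (AnalyticAt.fun_mul ?_ ?_)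
      (analyticAt_nPointContOn hpq hp0 hp1 _ _ hx)
    · exact Finset.analyticAt_fun_prod _ fun _ _ => analyticAt_coord _ _
    · exact AnalyticAt.comp (g := kernelDefect p I.card) (f := fun x : Fin n → ℂ => ∏ i ∈ Iᶜ, x i)
        (analyticAt_kernelDefect hp0 hp1 _ (Finset.prod_ne_zero_iff.2 fun i _ => hx.1 i))
        (Finset.analyticAt_fun_prod _ fun _ _ => analyticAt_coord _ _)
  · intro x hx
    have hc := isConvergent_of_mem_convDomain hpq hq0 hq1 hx
    have hxr := convDomain_subset_regularSet hq0 hq1 n hx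
    have hs : ∀ I ∈ (Finset.univ : Finset (Fin n)).powerset, Summable fun j =>
        kernelCoeff p I.card (∏ i ∈ Finset.univ \ I, x i) j * p ^ j *
          ((∏ i ∈ I, x i) * partitionSum p x (Finset.univ \ I)) := fun I _ =>
      (summable_kernelDefect hp0 hp1 _ (Finset.prod_ne_zero_iff.2 fun i _ => hxr.1 i)).mul_right _
    -- At `k = 0` the factor `p ^ (j * (2 * k + 1))` is `p ^ j` and each variable of `I` occurs to
    -- the first power, as in the total defect.
    have h := tsum_expansionTerm hc 0
    have e : ∀ j, expansionTerm p x Finset.univ 0 j = ∑ I ∈ (Finset.univ : Finset (Fin n)).powerset,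
        kernelCoeff p I.card (∏ i ∈ Finset.univ \ I, x i) j * p ^ j *
          ((∏ i ∈ I, x i) * partitionSum p x (Finset.univ \ I)) := by
      intro j
      refine Finset.sum_congr rfl fun I _ => ?_
      rw [kernelCoeff]
      simp only [mul_zero, zero_add, zpow_one, mul_one]
      ring
    rw [tsum_congr e, Summable.tsum_finsetSum hs, Finset.powerset_univ] at h
    dsimp only
    rw [← mul_zero a, ← h, Finset.mul_sum]
    refine Finset.sum_congr rfl fun I _ => ?_
    rw [nPointContOn_eq_partitionSum p a (hc.mono (Finset.subset_univ _)), tsum_mul_right,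
      kernelDefect, Finset.compl_eq_univ_sdiff]
    ring

/-- Merging `I` and then `I'` through the recursion yields the same kernel arguments as merging `I ∪
I'` at once; only the degree `I'.card` remembers the splitting. -/
lemma nPointCont_mergeFirst (p c : ℂ) {n : ℕ} (x : Fin (n + 1) → ℂ) (I : Finset (Fin n)) :
    nPointCont p c (Iᶜ.card + 1) (mergeFirst x I) = ∑ I' ∈ Iᶜ.powerset,
      kernel p I'.card (x 0 * ∏ i ∈ I ∪ I', x i.succ) (∏ i ∈ (I ∪ I')ᶜ, x i.succ) *
        nPointContOn p c (fun i => x i.succ) (I ∪ I')ᶜ := by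
  refine (nPointCont_cons p c (x 0 * ∏ i ∈ I, x i.succ) (fun i => x i.succ) Iᶜ).trans ?_
  refine Finset.sum_congr rfl fun I' hI' => ?_
  have hd : Disjoint I I' := by
    rw [Finset.mem_powerset] at hI'
    exact disjoint_compl_right.mono_right hI'
  have hc : Iᶜ \ I' = (I ∪ I')ᶜ := by
    ext i
    simp
  rw [hc, Finset.prod_union hd, mul_assoc]

lemma sum_disjoint_pairs {n : ℕ} (f : Finset (Fin n) → Finset (Fin n) → ℂ) :
    ∑ I : Finset (Fin n), ∑ I' ∈ Iᶜ.powerset, f I (I ∪ I') =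
      ∑ L : Finset (Fin n), ∑ I ∈ L.powerset, f I L := by
  have h : ∀ I : Finset (Fin n), ∑ I' ∈ Iᶜ.powerset, f I (I ∪ I') =
      ∑ L ∈ Finset.univ.filter (I ⊆ ·), f I L := fun I => by
    refine Finset.sum_bij' (fun I' _ => I ∪ I') (fun L _ => L \ I) ?_ ?_ ?_ ?_ ?_
    · intro I' _
      simp
    · intro L _
      rw [Finset.mem_powerset, Finset.compl_eq_univ_sdiff]
      exact Finset.sdiff_subset_sdiff (Finset.subset_univ _) le_rfl
    · intro I' hI'
      rw [Finset.mem_powerset] at hI'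
      rw [Finset.union_sdiff_left]
      exact Finset.sdiff_eq_self_of_disjoint (disjoint_compl_left.mono_left hI')
    · intro L hL
      simp only [Finset.mem_filter, Finset.mem_univ, true_and] at hL
      exact Finset.union_sdiff_of_subset hL
    · intro I' _
      rfl
  simp only [h]
  rw [Finset.sum_comm' (t' := Finset.univ) (s' := fun L => L.powerset)]
  intro I L
  simp

/-- The `q`-difference equation for the continuation of the `n`-point function. -/
theorem nPointCont_scaleFirst (hpq : p ^ 2 = q) (hq0 : q ≠ 0) (hq1 : ‖q‖ < 1) (a : ℂ) {n : ℕ}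
    {x : Fin (n + 1) → ℂ} (hx : x ∈ regularSet q (n + 1)) :
    nPointCont p (a * partitionFun p) (n + 1) (scaleFirst p x) =
      -(p * ∏ i, x i ^ 2) * ∑ I : Finset (Fin n), (-1) ^ I.card *
        nPointCont p (a * partitionFun p) (Iᶜ.card + 1) (mergeFirst x I) := by
  have hp0 := ne_zero_of_sq_eq hpq hq0
  have hp1 := norm_lt_one_of_sq_eq hpq hq1
  set c := a * partitionFun p with hc
  set X : Fin n → ℂ := fun i => x i.succ with hX
  have hXr : X ∈ regularSet q n := comp_mem_regularSet hx (Fin.succ_injective n)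
  set K : Finset (Fin n) → ℂ := fun J => nPointContOn p c X J with hK
  have hprod : ∀ J : Finset (Fin n), ∏ i ∈ J, X i ≠ 0 := fun J =>
    Finset.prod_ne_zero_iff.2 fun i _ => hXr.1 i
  have hrhs : ∑ I : Finset (Fin n), (-1) ^ I.card * nPointCont p c (Iᶜ.card + 1) (mergeFirst x I) =
      ∑ L : Finset (Fin n), (∑ I ∈ L.powerset, (-1) ^ (L.card - I.card) *
        kernel p I.card (x 0 * ∏ i ∈ L, X i) (∏ i ∈ Lᶜ, X i)) * K Lᶜ := by
    simp only [nPointCont_mergeFirst, Finset.mul_sum]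
    have e : ∀ I : Finset (Fin n), ∀ I' ∈ Iᶜ.powerset, (-1 : ℂ) ^ I.card *
        (kernel p I'.card (x 0 * ∏ i ∈ I ∪ I', x i.succ) (∏ i ∈ (I ∪ I')ᶜ, x i.succ) *
          nPointContOn p c (fun i => x i.succ) (I ∪ I')ᶜ) =
        (fun I L => (-1 : ℂ) ^ I.card * (kernel p (L \ I).card (x 0 * ∏ i ∈ L, X i)
          (∏ i ∈ Lᶜ, X i) * K Lᶜ)) I (I ∪ I') := by
      intro I I' hI'
      rw [Finset.mem_powerset] at hI'
      dsimp only
      rw [Finset.union_sdiff_left, Finset.sdiff_eq_self_of_disjoint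
        (disjoint_compl_left.mono_left hI')]
    rw [Finset.sum_congr rfl fun I _ => Finset.sum_congr rfl (e I)]
    refine (sum_disjoint_pairs (fun I L => (-1 : ℂ) ^ I.card * (kernel p (L \ I).card
      (x 0 * ∏ i ∈ L, X i) (∏ i ∈ Lᶜ, X i) * K Lᶜ))).trans ?_
    refine Finset.sum_congr rfl fun L _ => ?_
    rw [Finset.sum_mul]
    -- Passing to complements inside `L` turns the kernel degree `(L \ I).card` into `I.card`, as in
    -- the binomial expansion.
    refine Finset.sum_bij' (fun I _ => L \ I) (fun I _ => L \ I) ?_ ?_ ?_ ?_ ?_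
    · intro I _
      simp
    · intro I _
      simp
    · intro I hI
      exact Finset.sdiff_sdiff_eq_self (Finset.mem_powerset.1 hI)
    · intro I hI
      exact Finset.sdiff_sdiff_eq_self (Finset.mem_powerset.1 hI)
    · intro I hI
      have h1 := Finset.card_sdiff_add_card_eq_card (Finset.mem_powerset.1 hI)
      rw [show L.card - (L \ I).card = I.card by omega]
      ring
  -- The prefactor produced by the kernel is the product of all the `t_i` whatever `L` is, so it can
  -- be taken out of the sum.
  have htot : ∀ L : Finset (Fin n), (∏ i ∈ Lᶜ, X i) ^ 2 * (x 0 * ∏ i ∈ L, X i) ^ 2 =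
      ∏ i, x i ^ 2 := fun L => by
    rw [Fin.prod_univ_succ, ← Finset.prod_mul_prod_compl L fun i : Fin n => x i.succ ^ 2,
      Finset.prod_pow, Finset.prod_pow]
    ring
  have hdef := sum_kernelDefect_eq_zero hpq hq0 hq1 a hXr
  rw [nPointCont_succ, hrhs]
  have hl : ∀ L : Finset (Fin n), kernel p L.card (scaleFirst p x 0 *
      ∏ i ∈ L, scaleFirst p x i.succ) (∏ i ∈ Lᶜ, scaleFirst p x i.succ) *
        nPointContOn p c (fun i => scaleFirst p x i.succ) Lᶜ =
      -(p * ∏ i, x i ^ 2) * ((∑ I ∈ L.powerset, (-1) ^ (L.card - I.card) *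
        kernel p I.card (x 0 * ∏ i ∈ L, X i) (∏ i ∈ Lᶜ, X i)) * K Lᶜ) +
      -(p * x 0) * ((∏ i ∈ L, X i) * kernelDefect p L.card (∏ i ∈ Lᶜ, X i) * K Lᶜ) := by
    intro L
    have e0 : scaleFirst p x 0 = p * x 0 := by simp [scaleFirst]
    have es : (fun i : Fin n => scaleFirst p x i.succ) = X := by
      funext i
      simp [scaleFirst, Fin.tail, hX]
    have es' : ∀ i : Fin n, scaleFirst p x i.succ = X i := congrFun es
    simp only [es', e0]
    have hσ : x 0 * ∏ i ∈ L, X i ≠ 0 := mul_ne_zero (hx.1 0) (hprod L)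
    rw [mul_assoc p, kernel_mul_left hp0 hp1 hσ (hprod Lᶜ) (kernelRegular_of_mem hpq hx L _),
      ← htot L]
    have h1 := hprod L
    have h2 := hprod Lᶜ
    have h3 := hx.1 0
    change _ * K Lᶜ = _
    field_simp
    ring
  rw [Finset.sum_congr rfl fun L _ => hl L, Finset.sum_add_distrib, ← Finset.mul_sum,
    ← Finset.mul_sum, hdef, mul_zero, add_zero]

end

/-! ### The theta function, the trace, and the two continuations. -/

section

variable {p q : ℂ}

lemma eulerProd_ne_zero (hq1 : ‖q‖ < 1) : eulerProd q ≠ 0 := by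
  have h := tprod_one_add_ne_zero_of_summable (f := fun m : ℕ => -q ^ (m + 1)) (fun m h => ?_) ?_
  · simpa [eulerProd, sub_eq_add_neg] using h
  · have h1 : q ^ (m + 1) = 1 := by linear_combination -h
    have h2 : ‖q‖ ^ (m + 1) = 1 := by rw [← norm_pow, h1, norm_one]
    have h3 := pow_lt_one₀ (norm_nonneg q) hq1 (Nat.succ_ne_zero m)
    exact h3.ne h2
  · simp only [norm_neg, norm_pow]
    exact (summable_nat_add_iff 1).2 (summable_geometric_of_lt_one (norm_nonneg q) hq1)

lemma summable_theta3_coeff (hp0 : p ≠ 0) (hp1 : ‖p‖ < 1) {C : ℝ} (hC : 0 < C) :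
    Summable fun j : ℤ => ‖p ^ (j ^ 2)‖ * C ^ j.natAbs := by
  refine (summable_gaussian_natAbs (norm_pos_iff.2 hp0) hp1 0 hC).congr fun j => ?_
  simp [norm_zpow]

lemma analyticAt_theta3 (hp0 : p ≠ 0) (hp1 : ‖p‖ < 1) {t : ℂ} (ht : t ≠ 0) :
    AnalyticAt ℂ (theta3 p) t :=
  analyticAt_tsum_zpow (fun _ hC => summable_theta3_coeff hp0 hp1 hC) ht

/-- Completing the square: `m ^ 2 + 2 * m = (m + 1) ^ 2 - 1`, followed by a shift of the summation
index. -/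
lemma theta3_mul_left (hpq : p ^ 2 = q) (hp0 : p ≠ 0) {t : ℂ} (ht : t ≠ 0) :
    theta3 p (q * t) = p⁻¹ * t⁻¹ * theta3 p t := by
  rw [theta3, theta3, ← tsum_mul_left, ← (Equiv.addRight (1 : ℤ)).tsum_eq fun m : ℤ =>
    p⁻¹ * t⁻¹ * (p ^ (m ^ 2) * t ^ m)]
  refine tsum_congr fun m => ?_
  rw [Equiv.coe_addRight, ← hpq, mul_zpow, zpow_add_one₀ ht,
    show (m + 1) ^ 2 = m ^ 2 + 2 * m + 1 by ring,
    zpow_add_one₀ hp0, zpow_add₀ hp0, zpow_mul p 2 m]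
  norm_cast
  field_simp

lemma nPointFun_eq (hpq : p ^ 2 = q) {n : ℕ} (x : Fin n → ℂ) :
    nPointFun q x = eulerProd q * partitionSum p x Finset.univ := by
  rw [nPointFun, partitionSum]
  congr 1
  refine tsum_congr fun μ => ?_
  rw [nPointTerm, ← hpq, pow_mul]
  rfl

lemma summable_nPointTerm (hpq : p ^ 2 = q) (hq0 : q ≠ 0) (hq1 : ‖q‖ < 1) {n : ℕ} {x : Fin n → ℂ}
    (hx : x ∈ convDomain q n) : Summable (nPointTerm q x) := by
  refine (isConvergent_of_mem_convDomain hpq hq0 hq1 hx).summable_partition.congr fun μ => ?_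
  rw [nPointTerm, ← hpq, pow_mul]
  rfl

lemma summable_diagCoeff (hpq : p ^ 2 = q) (hq0 : q ≠ 0) (hq1 : ‖q‖ < 1) {n : ℕ} {x : Fin n → ℂ}
    (hx : x ∈ convDomain q n) : Summable (diagCoeff (opProd p x)) := by
  refine ((isConvergent_of_mem_convDomain hpq hq0 hq1 hx).summable_norm_energy.of_norm).congr
    fun S => ?_
  rw [diagCoeff_opProd]

/-- The trace splits into the sum over charges and the sum over partitions. -/
lemma traceFun_eq (hpq : p ^ 2 = q) (hq0 : q ≠ 0) (hq1 : ‖q‖ < 1) {n : ℕ} {x : Fin n → ℂ}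
    (hx : x ∈ convDomain q n) :
    traceFun p x = theta3 p (∏ i, x i ^ 2) * partitionSum p x Finset.univ := by
  have hp0 := ne_zero_of_sq_eq hpq hq0
  have hc := isConvergent_of_mem_convDomain hpq hq0 hq1 hx
  have hs := summable_diagCoeff hpq hq0 hq1 hx
  have e : ∀ a : YoungDiagram × ℤ, diagCoeff (opProd p x) (mayaEquiv a) =
      p ^ (2 * a.1.card) * (∏ i, rowSum (x i) a.1) * (p ^ (a.2 ^ 2) * (∏ i, x i ^ 2) ^ a.2) := by
    rintro ⟨μ, c⟩
    change diagCoeff (opProd p x) (mayaOf μ c) = _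
    rw [diagCoeff_opProd, pow_twiceEnergy_mayaOf hp0]
    have : ∏ i, levelSum (x i) (mayaOf μ c) = (∏ i, x i ^ 2) ^ c * ∏ i, rowSum (x i) μ := by
      rw [← Finset.prod_zpow, ← Finset.prod_mul_distrib]
      refine Finset.prod_congr rfl fun i hi => ?_
      rw [levelSum_mayaOf (hc.x_ne_zero hi), rowSum, zpow_mul]
      norm_cast
    rw [this]
    ring
  have hs' := (mayaEquiv.summable_iff.2 hs).congr e
  rw [traceFun, trace, ← mayaEquiv.tsum_eq, tsum_congr e, hs'.tsum_prod]
  dsimp only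
  simp only [tsum_mul_left]
  rw [tsum_mul_right, mul_comm]
  rfl

theorem isContinuation_nPointCont (hpq : p ^ 2 = q) (hq0 : q ≠ 0) (hq1 : ‖q‖ < 1) (n : ℕ) :
    IsContinuation q (nPointFun q) (nPointCont p (eulerProd q * partitionFun p) n) where
  meromorphic := isMeromorphicOn_of_isQuotientAt hq0 hq1
    (isQuotientAt_nPointCont hpq (ne_zero_of_sq_eq hpq hq0) (norm_lt_one_of_sq_eq hpq hq1) _ n)
  analytic := analyticOnNhd_nPointCont hpq (ne_zero_of_sq_eq hpq hq0)
    (norm_lt_one_of_sq_eq hpq hq1) _ n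
  eqOn := fun x hx => by
    rw [nPointCont_eq_partitionSum _ _ _ _ (isConvergent_of_mem_convDomain hpq hq0 hq1 hx),
      nPointFun_eq hpq]

lemma analyticAt_theta3_prod (hpq : p ^ 2 = q) (hq0 : q ≠ 0) (hq1 : ‖q‖ < 1) {n : ℕ}
    {x : Fin n → ℂ} (hx : x ∈ torus n) (a : ℂ) :
    AnalyticAt ℂ (fun x : Fin n → ℂ => theta3 p (∏ i, x i ^ 2) * a) x := by
  refine AnalyticAt.fun_mul ?_ analyticAt_const
  exact AnalyticAt.comp (g := theta3 p) (f := fun x : Fin n → ℂ => ∏ i, x i ^ 2)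
    (analyticAt_theta3 (ne_zero_of_sq_eq hpq hq0) (norm_lt_one_of_sq_eq hpq hq1)
      (Finset.prod_ne_zero_iff.2 fun i _ => pow_ne_zero 2 (hx i)))
    (Finset.analyticAt_fun_prod _ fun i _ => (analyticAt_coord i x).fun_pow 2)

theorem isContinuation_trace (hpq : p ^ 2 = q) (hq0 : q ≠ 0) (hq1 : ‖q‖ < 1) (n : ℕ) :
    IsContinuation q (traceFun p) fun x : Fin n → ℂ =>
      theta3 p (∏ i, x i ^ 2) * (eulerProd q)⁻¹ *
        nPointCont p (eulerProd q * partitionFun p) n x where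
  meromorphic := isMeromorphicOn_of_isQuotientAt hq0 hq1 fun x hx =>
    (isQuotientAt_of_analyticAt (analyticAt_theta3_prod hpq hq0 hq1 hx _)).mul
    (isQuotientAt_nPointCont hpq (ne_zero_of_sq_eq hpq hq0) (norm_lt_one_of_sq_eq hpq hq1) _ n x hx)
  analytic := fun x hx => (analyticAt_theta3_prod hpq hq0 hq1 hx.1 _).fun_mul
    (analyticOnNhd_nPointCont hpq (ne_zero_of_sq_eq hpq hq0)
      (norm_lt_one_of_sq_eq hpq hq1) _ n x hx)
  eqOn := fun x hx => by
    have := eulerProd_ne_zero hq1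
    dsimp only
    rw [nPointCont_eq_partitionSum _ _ _ _ (isConvergent_of_mem_convDomain hpq hq0 hq1 hx),
      traceFun_eq hpq hq0 hq1 hx]
    field_simp

/-! ### Merged and scaled points. -/

lemma prod_cons_of_mem {m : ℕ} {M : Type*} [CommMonoid M] (f : Fin (m + 1) → M)
    (J : Finset (Fin (m + 1))) : ∏ i ∈ J, f i =
      (if 0 ∈ J then f 0 else 1) *
        ∏ j ∈ Finset.univ.filter (fun j : Fin m => j.succ ∈ J), f j.succ := by
  classical
  rw [← Finset.prod_ite_mem_eq, Fin.prod_univ_succ, Finset.prod_filter]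

/-- A partial product of the merged variables is a partial product of the original ones, over an
index set which contains `0` and `I` if the merged variable takes part, and neither otherwise. -/
lemma mergeFirst_mem_regularSet {n : ℕ} {x : Fin (n + 1) → ℂ} (hx : x ∈ regularSet q (n + 1))
    (I : Finset (Fin n)) : mergeFirst x I ∈ regularSet q (Iᶜ.card + 1) := by
  have h0 : mergeFirst x I 0 = x 0 * ∏ i ∈ I, x i.succ := rfl
  have hs : ∀ j : Fin Iᶜ.card, mergeFirst x I j.succ = x (Iᶜ.orderEmbOfFin rfl j).succ :=
    fun j => rfl
  refine ⟨fun i => ?_, fun m J hJ => ?_⟩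
  · refine Fin.cases ?_ (fun j => ?_) i
    · rw [h0]
      exact mul_ne_zero (hx.1 0) (Finset.prod_ne_zero_iff.2 fun i _ => hx.1 _)
    · rw [hs]
      exact hx.1 _
  · set e := Iᶜ.orderEmbOfFin rfl with he
    set J' := Finset.univ.filter (fun j : Fin Iᶜ.card => j.succ ∈ J) with hJ'
    have hJ'm : ∏ j ∈ J', mergeFirst x I j.succ ^ 2 =
        ∏ i ∈ J'.map e.toEmbedding, x i.succ ^ 2 := by
      rw [Finset.prod_map]
      rfl
    have hd : Disjoint I (J'.map e.toEmbedding) := by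
      rw [Finset.disjoint_left]
      intro i hi hi'
      obtain ⟨j, -, rfl⟩ := Finset.mem_map.1 hi'
      exact Finset.mem_compl.1 (Finset.orderEmbOfFin_mem Iᶜ rfl j) hi
    rw [prod_cons_of_mem, hJ'm]
    by_cases h : 0 ∈ J
    · have := hx.2 m (insert 0 ((I ∪ J'.map e.toEmbedding).map (Fin.succEmb n)))
        (Finset.insert_nonempty _ _)
      rw [prod_insert_zero_map_succ, Finset.prod_union hd] at this
      rw [if_pos h, h0, mul_pow, ← Finset.prod_pow, mul_assoc (x 0 ^ 2)]
      exact this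
    · have hne : J'.Nonempty := by
        obtain ⟨i, hi⟩ := hJ
        have hi0 : i ≠ 0 := fun h' => h (h' ▸ hi)
        obtain ⟨j, rfl⟩ := Fin.exists_succ_eq.2 hi0
        exact ⟨j, by simp [hJ', hi]⟩
      have := hx.2 m ((J'.map e.toEmbedding).map (Fin.succEmb n)) (by simpa using hne)
      rw [Finset.prod_map (J'.map e.toEmbedding)] at this
      rw [if_neg h, one_mul]
      exact this

/-- Hence the theta factor is common to all terms of the alternating sum. -/
lemma prod_mergeFirst_sq {n : ℕ} (x : Fin (n + 1) → ℂ) (I : Finset (Fin n)) :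
    ∏ i, mergeFirst x I i ^ 2 = ∏ i, x i ^ 2 := by
  have h0 : mergeFirst x I 0 = x 0 * ∏ i ∈ I, x i.succ := rfl
  have hs : ∀ j : Fin Iᶜ.card,
      mergeFirst x I j.succ = x (Iᶜ.orderEmbOfFin rfl j).succ := fun _ => rfl
  rw [Fin.prod_univ_succ, Fin.prod_univ_succ, h0]
  simp only [hs]
  rw [prod_orderEmbOfFin Iᶜ fun i : Fin n => x i.succ ^ 2,
    ← Finset.prod_mul_prod_compl I fun i : Fin n => x i.succ ^ 2, mul_pow, ← Finset.prod_pow I,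
    mul_assoc]

lemma prod_scaleFirst_sq (hpq : p ^ 2 = q) {n : ℕ} (x : Fin (n + 1) → ℂ) :
    ∏ i, scaleFirst p x i ^ 2 = q * ∏ i, x i ^ 2 := by
  rw [Fin.prod_univ_succ, Fin.prod_univ_succ, ← hpq]
  simp only [scaleFirst, Fin.cons_zero, Fin.cons_succ, Fin.tail]
  ring

lemma sum_powersetCard_eq {n : ℕ} (b : ℕ → ℂ) (f : Finset (Fin n) → ℂ) :
    ∑ s ∈ Finset.range (n + 1), b s * ∑ I ∈ (Finset.univ : Finset (Fin n)).powersetCard s, f I =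
      ∑ I : Finset (Fin n), b I.card * f I := by
  rw [← Finset.powerset_univ, Finset.sum_powerset, Finset.card_univ, Fintype.card_fin]
  refine Finset.sum_congr rfl fun s _ => ?_
  rw [Finset.mul_sum]
  refine Finset.sum_congr rfl fun I hI => ?_
  rw [(Finset.mem_powersetCard.1 hI).2]

end

end InfiniteWedge

end

theorem theorem5 (q p : ℂ) (hpq : p ^ 2 = q) (hq0 : q ≠ 0) (hq1 : ‖q‖ < 1) :
    -- the defining series converge (absolutely)
    (∀ (n : ℕ) (x : Fin n → ℂ), x ∈ InfiniteWedge.convDomain q n →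
      (∀ (i : Fin n) (S S' : InfiniteWedge.Maya),
        Summable fun j : ℤ => x i ^ (2 * j + 1) *
          InfiniteWedge.psi j (InfiniteWedge.psiStar j (InfiniteWedge.vec S)) S') ∧
      Summable (InfiniteWedge.diagCoeff (InfiniteWedge.opProd p x)) ∧
      (∀ (i : Fin n) (μ : YoungDiagram),
        Summable fun r : ℕ => x i ^ InfiniteWedge.twiceCoord μ r) ∧
      Summable (InfiniteWedge.nPointTerm q x)) ∧
    -- meromorphic continuations exist and are unique
    (∀ n : ℕ, ∃ G : (Fin n → ℂ) → ℂ,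
      InfiniteWedge.IsContinuation q (InfiniteWedge.traceFun p) G) ∧
    (∀ n : ℕ, ∃ G : (Fin n → ℂ) → ℂ,
      InfiniteWedge.IsContinuation q (InfiniteWedge.nPointFun q) G) ∧
    (∀ (n : ℕ) (f G G' : (Fin n → ℂ) → ℂ), InfiniteWedge.IsContinuation q f G →
      InfiniteWedge.IsContinuation q f G' → Set.EqOn G G' (InfiniteWedge.regularSet q n)) ∧
    -- the identities for the continuations `FF` of the trace and `F` of the `n`-point function
    (∀ FF F : ∀ n : ℕ, (Fin n → ℂ) → ℂ,
      (∀ n, InfiniteWedge.IsContinuation q (InfiniteWedge.traceFun p) (FF n)) →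
      (∀ n, InfiniteWedge.IsContinuation q (InfiniteWedge.nPointFun q) (F n)) →
      -- the `q`-difference equation for the trace
      (∀ (n : ℕ) (x : Fin (n + 1) → ℂ), x ∈ InfiniteWedge.regularSet q (n + 1) →
        FF (n + 1) (InfiniteWedge.scaleFirst p x) =
          ∑ s ∈ Finset.range (n + 1), (-1 : ℂ) ^ (s + 1) *
            ∑ I ∈ (Finset.univ : Finset (Fin n)).powersetCard s,
              FF (Iᶜ.card + 1) (InfiniteWedge.mergeFirst x I)) ∧
      -- the factorization
      (∀ (n : ℕ) (x : Fin n → ℂ), x ∈ InfiniteWedge.regularSet q n →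
        FF n x = InfiniteWedge.theta3 p (∏ i, x i ^ 2) * (InfiniteWedge.eulerProd q)⁻¹ * F n x) ∧
      -- the `q`-difference equation for the `n`-point function
      (∀ (n : ℕ) (x : Fin (n + 1) → ℂ), x ∈ InfiniteWedge.regularSet q (n + 1) →
        F (n + 1) (InfiniteWedge.scaleFirst p x) =
          -(p * ∏ i, x i ^ 2) *
            ∑ s ∈ Finset.range (n + 1), (-1 : ℂ) ^ s *
              ∑ I ∈ (Finset.univ : Finset (Fin n)).powersetCard s,
                F (Iᶜ.card + 1) (InfiniteWedge.mergeFirst x I))) := by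
  open InfiniteWedge in
  have hp0 := ne_zero_of_sq_eq hpq hq0
  have hcont := isContinuation_nPointCont hpq hq0 hq1
  have htrace := isContinuation_trace hpq hq0 hq1
  have huniq : ∀ (n : ℕ) (f G G' : (Fin n → ℂ) → ℂ), IsContinuation q f G →
      IsContinuation q f G' → Set.EqOn G G' (regularSet q n) := fun n f G G' hG hG' =>
    eqOn_regularSet hq0 hq1 hG.analytic hG'.analytic (hG.eqOn.trans hG'.eqOn.symm)
  refine ⟨fun n x hx => ⟨fun i S S' => ?_, summable_diagCoeff hpq hq0 hq1 hx, fun i μ => ?_,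
    summable_nPointTerm hpq hq0 hq1 hx⟩, fun n => ⟨_, htrace n⟩, fun n => ⟨_, hcont n⟩, huniq,
    fun FF F hFF hF => ?_⟩
  · exact summable_opT_coeff ((isConvergent_of_mem_convDomain hpq hq0 hq1 hx).one_lt_norm i
      (Finset.mem_univ i)) S S'
  · exact summable_twiceCoord ((isConvergent_of_mem_convDomain hpq hq0 hq1 hx).one_lt_norm i
      (Finset.mem_univ i)) μ
  have hF' : ∀ n, Set.EqOn (F n) _ (regularSet q n) := fun n => huniq n _ _ _ (hF n) (hcont n)
  have hFF' : ∀ n, Set.EqOn (FF n) _ (regularSet q n) :=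
    fun n => huniq n _ _ _ (hFF n) (htrace n)
  have hfact : ∀ (n : ℕ) (x : Fin n → ℂ), x ∈ regularSet q n →
      FF n x = theta3 p (∏ i, x i ^ 2) * (eulerProd q)⁻¹ * F n x := fun n x hx => by
    rw [hFF' n hx, hF' n hx]
  have hdiff : ∀ (n : ℕ) (x : Fin (n + 1) → ℂ), x ∈ regularSet q (n + 1) →
      F (n + 1) (scaleFirst p x) = -(p * ∏ i, x i ^ 2) * ∑ I : Finset (Fin n), (-1) ^ I.card *
        F (Iᶜ.card + 1) (mergeFirst x I) := fun n x hx => by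
    rw [hF' _ (scaleFirst_mem_regularSet hpq hq0 hx), nPointCont_scaleFirst hpq hq0 hq1 _ hx]
    congr 1
    exact Finset.sum_congr rfl fun I _ => by rw [hF' _ (mergeFirst_mem_regularSet hx I)]
  refine ⟨fun n x hx => ?_, hfact, fun n x hx => ?_⟩
  -- The equation for the trace is deduced from the one for the `n`-point function: the factor `p⁻¹
  -- * t⁻¹` of theta at `q * t`, with `t` the product of all variables, cancels `-(p * t)` up to
  -- sign, and this sign makes the exponent `s + 1`.
  · have ht : ∏ i, x i ^ 2 ≠ 0 := Finset.prod_ne_zero_iff.2 fun i _ => pow_ne_zero 2 (hx.1 i)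
    rw [sum_powersetCard_eq (fun s => (-1 : ℂ) ^ (s + 1)),
      hfact _ _ (scaleFirst_mem_regularSet hpq hq0 hx), hdiff n x hx, prod_scaleFirst_sq hpq,
      theta3_mul_left hpq hp0 ht, Finset.mul_sum, Finset.mul_sum]
    refine Finset.sum_congr rfl fun I _ => ?_
    rw [hfact _ _ (mergeFirst_mem_regularSet hx I), prod_mergeFirst_sq]
    field_simp
    ring
  · rw [sum_powersetCard_eq (fun s => (-1 : ℂ) ^ s), hdiff n x hx]
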